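/- On $M=\mathbb C^{12}$ with coordinates $(b_i,a_i,c_i)_{i=1,\dots,4}$ (indices mod 4) let $P$ be the linear Poisson tensor whose nonzero brackets $P^{st}=\{x^s,x^t\}$ are, up to antisymmetry, $\{b_i,a_i\}=-a_i$, $\{b_{i+1},a_i\}=a_i$, $\{b_i,c_i\}=-c_i$, $\{b_{i+2},c_i\}=c_i$, $\{a_i,a_{i+1}\}=-c_i$, and let $P'$ be the quadratic Poisson tensor with, for all $i$ (again up to antisymmetry, other brackets being zero), $\{b_i,b_{i+1}\}'=a_i$; $\{b_i,a_i\}'=-b_ia_i$, $\{b_{i+1},a_i\}'=b_{i+1}a_i$, $\{b_i,a_{i+1}\}'=c_i$, $\{b_i,a_{i+2}\}'=-c_{i+2}$; $\{a_i,a_{i+1}\}'=-b_{i+1}c_i-a_ia_{i+1}$; $\{b_i,c_i\}'=-b_ic_i$, $\{b_{i+2},c_i\}'=b_{i+2}c_i$; $\{a_i,c_i\}'=-a_ic_i$, $\{a_i,c_{i+1}\}'=-a_ic_{i+1}$, $\{a_i,c_{i+2}\}'=a_ic_{i+2}$, $\{a_i,c_{i+3}\}'=a_ic_{i+3}$; $\{c_i,c_{i+1}\}'=-c_ic_{i+1}$.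 Brackets are $\{f,g\}=\langle df,P\,dg\rangle$. Let $$L(\nu)=\begin{pmatrix} b_1&-\nu&c_3/\nu^2&a_4/\nu\\ a_1/\nu&b_2&-\nu&c_4/\nu^2\\ c_1/\nu^2&a_2/\nu&b_3&-\nu\\ -\nu&c_2/\nu^2&a_3/\nu&b_4\end{pmatrix}.$$ With $\rho=\nu^4$ one has $$\det(x\mathbf 1-L(\nu))=R(x,\rho)=x^4-\rho+H(x)+\frac{K(x)-x^2J_1}{\rho}+\frac{J_2}{\rho^2},$$ $$H(x)=-x^3H_0+x^2H_1-xH_2+H_3,\qquad K(x)=xK_0+K_1,$$ where $H_0=\sum b_i$, $J_1=c_1c_3+c_2c_4$, $J_2=c_1c_2c_3c_4$, and the Toda$^4_3$ Hamiltonian is $H_{GT}=\frac12\sum b_i^2-\sum a_i=\frac12H_0^2-H_1$. Let $S_\kappa$ be the level sets $(H_0,K_0,J_1,J_2)=\kappa\in\mathbb C^4$. Put $Z_1=-\partial_{b_4}$, $Z_2=\partial_{a_4}$, $(F_1,F_2)=(H_0,K_0)$, $G_{ij}=L_{Z_i}F_j$ and $Q=P'-\sum_{i,j}(G^{-1})_{ji}\,Z_i\wedge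 P'dF_j$, with $(Z\wedge X)\alpha=\alpha(Z)X-\alpha(X)Z$. Let $$\mathcal G(x)=\begin{pmatrix}L_{Z_1}H(x)&L_{Z_2}H(x)\\ L_{Z_1}K(x)&L_{Z_2}K(x)\end{pmatrix},\qquad \rho(x)=-\mathcal G_{22}(x)/\mathcal G_{12}(x).$$ Let $U\subset M$ be the set of points where $G$ is invertible, $\det\mathcal G(x)$ has four distinct roots $\lambda_1,\dots,\lambda_4$, at each of which $\mathcal G_{12}$ and $\mathcal G_{22}$ do not vanish, and the differentials of $H_0,K_0,J_1,J_2,H_1,H_2,H_3,K_1$ are linearly independent. Let $\mu_i=\log\rho(\lambda_i)$ (local holomorphic branches). **Proposition.** There is a nonzero polynomial $E$ on $\mathbb C^4$ such that, whenever $E(\kappa)\ne0$, $S_\kappa$ is nonempty, the differentials of $H_0,K_0,J_1,J_2$ are independent at every point of $S_\kappa$, the image of $P$ there is the tangent space of $S_\kappa$ (so $S_\kappa$ is an $8$-dimensional manifold on which $P$ is symplectic), and $S_\kappa\cap U$ is dense in $S_\kappa$. For every $\kappa$, near each point of $S_\kappa\cap U$ holomorphic branches of $(\lambda_i,\mu_i)$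 exist and form a chart of $S_\kappa$, and for any choice of branches the following holds at the points of $S_\kappa\cap U$ in their domain. 1. $P$ is nondegenerate on $S_\kappa$, and $H_1,H_2,H_3,K_1$ are in involution and have independent differentials on $S_\kappa$. 2. $(\lambda_i,\mu_i)$ are Darboux--Nijenhuis coordinates: they are local coordinates on $S_\kappa$, $\{\mu_i,\lambda_j\}=\delta_{ij}$, $\{\lambda_i,\lambda_j\}=\{\mu_i,\mu_j\}=0$, and $N=QP^{-1}$ is a well-defined operator on the tangent spaces of $S_\kappa$ with $d\lambda_i\circ N=\lambda_i\,d\lambda_i$ and $d\mu_i\circ N=\lambda_i\,d\mu_i$. 3. The system is separable in $(\lambda_i,\mu_i)$, the separation relations being the evaluation of the spectral curve at $x=\lambda_i$, $\rho=e^{\mu_i}$: for $i=1,\dots,4$, $\det(\lambda_i\mathbf 1-L(\nu))=0$ whenever $\nu^4=e^{\mu_i}$, that is, $$\Phi(\lambda_i,\mu_i;H_1,H_2,H_3,K_1)=0,$$ where $\Phi(x,y;h)$ is $R(x,e^y)$ with the Casimirs replaced by their values $\kappa$ and $(H_1,H_2,H_3,K_1)$ by $h$. These relations are nontrivial: $(\partial_x\Phi,\partial_y\Phi)\neq0$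 at each $(\lambda_i,\mu_i)$, and the $4\times4$ matrix $\big(\partial\Phi/\partial h_j(\lambda_i,\mu_i;H)\big)_{ij}$ is invertible. -/

import Mathlib

open Matrix

noncomputable section

namespace TodaFourThree

/-! ### Phase space `ℂ¹²` with coordinates `(b, a, c)` (indices `0, 1, 2, 3`, cyclic) -/

/-- Labels of the coordinates: `inl i` is `b_i`, `inr (inl i)` is `a_i`, `inr (inr i)` is `c_i`. -/
abbrev Idx := Fin 4 ⊕ (Fin 4 ⊕ Fin 4)

/-- The phase space `ℂ¹²`. -/
abbrev Phase := Idx → ℂ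

def bc (m : Phase) (i : Fin 4) : ℂ := m (Sum.inl i)
def ac (m : Phase) (i : Fin 4) : ℂ := m (Sum.inr (Sum.inl i))
def cc (m : Phase) (i : Fin 4) : ℂ := m (Sum.inr (Sum.inr i))

/-! ### The two Poisson tensors -/

def blockA1 (a : Fin 4 → ℂ) : Matrix (Fin 4) (Fin 4) ℂ :=
  !![-a 0, 0, 0, a 3;
     a 0, -a 1, 0, 0;
     0, a 1, -a 2, 0;
     0, 0, a 2, -a 3]

def blockC1 (c : Fin 4 → ℂ) : Matrix (Fin 4) (Fin 4) ℂ :=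
  !![-c 0, 0, c 2, 0;
     0, -c 1, 0, c 3;
     c 0, 0, -c 2, 0;
     0, c 1, 0, -c 3]

def blockC2 (c : Fin 4 → ℂ) : Matrix (Fin 4) (Fin 4) ℂ :=
  !![0, -c 0, 0, c 3;
     c 0, 0, -c 1, 0;
     0, c 1, 0, -c 2;
     -c 3, 0, c 2, 0]

/-- The linear Poisson tensor `P`; the entry `(s, t)` is the bracket of the coordinates `s`, `t`. -/
def bivP (m : Phase) : Matrix Idx Idx ℂ :=
  Matrix.fromBlocks 0 (Matrix.fromCols (blockA1 (ac m)) (blockC1 (cc m)))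
    (Matrix.fromRows (-(blockA1 (ac m))ᵀ) (-(blockC1 (cc m))ᵀ))
    (Matrix.fromBlocks (blockC2 (cc m)) 0 0 0)

def blockA2 (a : Fin 4 → ℂ) : Matrix (Fin 4) (Fin 4) ℂ :=
  !![0, a 0, 0, -a 3;
     -a 0, 0, a 1, 0;
     0, -a 1, 0, a 2;
     a 3, 0, -a 2, 0]

def blockB1 (b a c : Fin 4 → ℂ) : Matrix (Fin 4) (Fin 4) ℂ :=
  !![-(b 0 * a 0), c 0, -c 2, b 0 * a 3;
     b 1 * a 0, -(b 1 * a 1), c 1, -c 3;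
     -c 0, b 2 * a 1, -(b 2 * a 2), c 2;
     c 3, -c 1, b 3 * a 2, -(b 3 * a 3)]

def blockC3 (b c : Fin 4 → ℂ) : Matrix (Fin 4) (Fin 4) ℂ :=
  !![-(b 0 * c 0), 0, b 0 * c 2, 0;
     0, -(b 1 * c 1), 0, b 1 * c 3;
     c 0 * b 2, 0, -(b 2 * c 2), 0;
     0, c 1 * b 3, 0, -(b 3 * c 3)]

def blockA3 (b a c : Fin 4 → ℂ) : Matrix (Fin 4) (Fin 4) ℂ :=
  !![0, -(b 1 * c 0) - a 0 * a 1, 0, b 0 * c 3 + a 0 * a 3;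
     b 1 * c 0 + a 0 * a 1, 0, -(b 2 * c 1) - a 1 * a 2, 0;
     0, b 2 * c 1 + a 1 * a 2, 0, -(b 3 * c 2) - a 2 * a 3;
     -(b 0 * c 3) - a 0 * a 3, 0, b 3 * c 2 + a 2 * a 3, 0]

def blockC4 (a c : Fin 4 → ℂ) : Matrix (Fin 4) (Fin 4) ℂ :=
  !![-(a 0 * c 0), -(a 0 * c 1), a 0 * c 2, a 0 * c 3;
     c 0 * a 1, -(a 1 * c 1), -(a 1 * c 2), a 1 * c 3;
     c 0 * a 2, c 1 * a 2, -(a 2 * c 2), -(a 2 * c 3);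
     -(c 0 * a 3), c 1 * a 3, c 2 * a 3, -(a 3 * c 3)]

def blockA4 (c : Fin 4 → ℂ) : Matrix (Fin 4) (Fin 4) ℂ :=
  !![0, -(c 0 * c 1), 0, c 0 * c 3;
     c 0 * c 1, 0, -(c 1 * c 2), 0;
     0, c 1 * c 2, 0, -(c 2 * c 3);
     -(c 0 * c 3), 0, c 2 * c 3, 0]

/-- The second Poisson tensor `P'`. -/
def bivP' (m : Phase) : Matrix Idx Idx ℂ :=
  Matrix.fromBlocks (blockA2 (ac m))
    (Matrix.fromCols (blockB1 (bc m) (ac m) (cc m)) (blockC3 (bc m) (cc m)))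
    (Matrix.fromRows (-(blockB1 (bc m) (ac m) (cc m))ᵀ) (-(blockC3 (bc m) (cc m))ᵀ))
    (Matrix.fromBlocks (blockA3 (bc m) (ac m) (cc m)) (blockC4 (ac m) (cc m))
      (-(blockC4 (ac m) (cc m))ᵀ) (blockA4 (cc m)))

/-- The vector `B α` obtained by applying the bivector `B` to the covector `α`. -/
def sharp (B : Matrix Idx Idx ℂ) (α : Phase →L[ℂ] ℂ) : Phase :=
  B *ᵥ fun t => α (Pi.single t 1)

/-- The bracket `{f, g} = ⟨df, B dg⟩` at the point `m`. -/
def bracket (B : Phase → Matrix Idx Idx ℂ) (f g : Phase → ℂ) (m : Phase) : ℂ :=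
  fderiv ℂ f m (sharp (B m) (fderiv ℂ g m))

/-! ### Lax matrix, Hamiltonians and Casimirs -/

/-- The Hamiltonian of the `Toda^4_3` system. -/
def todaH (m : Phase) : ℂ := (1 / 2) * ∑ i, bc m i ^ 2 - ∑ i, ac m i

/-- The Lax matrix `L(ν)` with spectral parameter `ν`. -/
def lax (m : Phase) (ν : ℂ) : Matrix (Fin 4) (Fin 4) ℂ :=
  !![bc m 0, -ν, cc m 2 / ν ^ 2, ac m 3 / ν;
     ac m 0 / ν, bc m 1, -ν, cc m 3 / ν ^ 2;
     cc m 0 / ν ^ 2, ac m 1 / ν, bc m 2, -ν;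
     -ν, cc m 1 / ν ^ 2, ac m 2 / ν, bc m 3]

def H0 (m : Phase) : ℂ := ∑ i, bc m i

def H1 (m : Phase) : ℂ :=
  bc m 0 * bc m 1 + bc m 0 * bc m 2 + bc m 0 * bc m 3
    + bc m 1 * bc m 2 + bc m 1 * bc m 3 + bc m 2 * bc m 3 + ∑ i, ac m i

def H2 (m : Phase) : ℂ :=
  ∑ i, (cc m i + bc m i * (ac m (i + 1) + ac m (i + 2)) + bc m i * bc m (i + 1) * bc m (i + 2))

def H3 (m : Phase) : ℂ :=
  ∑ i, (bc m i * cc m (i + 1) + ac m i * bc m (i + 2) * bc m (i + 3))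
    + ac m 0 * ac m 2 + ac m 1 * ac m 3 + bc m 0 * bc m 1 * bc m 2 * bc m 3

def K0 (m : Phase) : ℂ :=
  ∑ i, (bc m i * cc m (i + 3) * cc m (i + 1) - cc m i * ac m (i + 3) * ac m (i + 2))

def K1 (m : Phase) : ℂ :=
  ∑ i, (ac m i * cc m (i + 1) * cc m (i + 2) + cc m i * bc m (i + 1) * ac m (i + 2) * ac m (i + 3))
    - ac m 0 * ac m 1 * ac m 2 * ac m 3
    - cc m 0 * cc m 2 * bc m 1 * bc m 3 - cc m 1 * cc m 3 * bc m 0 * bc m 2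

def J1 (m : Phase) : ℂ := cc m 0 * cc m 2 + cc m 1 * cc m 3

def J2 (m : Phase) : ℂ := cc m 0 * cc m 1 * cc m 2 * cc m 3

/-- The Casimirs `(H₀, K₀, J₁, J₂)` of `P`. -/
def casimirs (m : Phase) : Fin 4 → ℂ := ![H0 m, K0 m, J1 m, J2 m]

/-- The nontrivial Hamiltonians `(H₁, H₂, H₃, K₁)`. -/
def hams (m : Phase) : Fin 4 → ℂ := ![H1 m, H2 m, H3 m, K1 m]

/-- The expanded characteristic polynomial `R(x, ρ)`, as a function of the values
`κ = (H₀, K₀, J₁, J₂)` of the Casimirs and `h = (H₁, H₂, H₃, K₁)` of the Hamiltonians. -/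
def spectralFun (κ h : Fin 4 → ℂ) (x ρ : ℂ) : ℂ :=
  x ^ 4 - ρ + (-(κ 0 * x ^ 3) + h 0 * x ^ 2 - h 1 * x + h 2)
    + (κ 1 * x + h 3 - κ 2 * x ^ 2) / ρ + κ 3 / ρ ^ 2

/-- The coefficient `H(x)` of `ρ⁰` in `R(x, ρ) - x⁴`. -/
def polyH (x : ℂ) (m : Phase) : ℂ := -(x ^ 3 * H0 m) + x ^ 2 * H1 m - x * H2 m + H3 m

/-- The polynomial `K(x)`. -/
def polyK (x : ℂ) (m : Phase) : ℂ := x * K0 m + K1 m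

/-! ### The symplectic leaves of `P` -/

/-- The common level set `S_κ` of the Casimirs. -/
def leaf (κ : Fin 4 → ℂ) : Set Phase := {m | casimirs m = κ}

/-- The tangent space at `m` of the level set of the Casimirs through `m`. -/
def leafTangent (m : Phase) : Submodule ℂ Phase :=
  LinearMap.ker (fderiv ℂ casimirs m : Phase →ₗ[ℂ] (Fin 4 → ℂ))

/-- At `m`, the level set of the Casimirs is a regular one, and `P` induces on its tangent space a
nondegenerate bivector: the image of `P` is exactly the tangent space. -/
def IsSymplecticAt (m : Phase) : Prop :=
  Function.Surjective (fderiv ℂ casimirs m) ∧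
    Set.range (sharp (bivP m)) = (leafTangent m : Set Phase)

/-! ### The reduced second tensor -/

/-- The transversal vector fields `Z₁ = -∂/∂b₄` and `Z₂ = ∂/∂a₄`. -/
def Z : Fin 2 → Phase :=
  ![-Pi.single (Sum.inl 3) 1, Pi.single (Sum.inr (Sum.inl 3)) 1]

/-- The differentials of the two Casimirs `H₀`, `K₀` of `P` that are not Casimirs of `P'`. -/
def dF (m : Phase) : Fin 2 → (Phase →L[ℂ] ℂ) := ![fderiv ℂ H0 m, fderiv ℂ K0 m]

/-- The matrix `G` with entries `L_{Z_i} F_j`, where `F = (H₀, K₀)`. -/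
def redG (m : Phase) : Matrix (Fin 2) (Fin 2) ℂ := Matrix.of fun i j => dF m j (Z i)

/-- The bivector `Z ∧ X` with `(Z ∧ X) α = α(Z) X - α(X) Z`. -/
def wedge (Z X : Phase) : Matrix Idx Idx ℂ := Matrix.vecMulVec X Z - Matrix.vecMulVec Z X

/-- The bivector `Q = P' - Δ`, with `Δ = ∑ (G⁻¹)_{ji} Z_i ∧ P' dF_j`. -/
def bivQ (m : Phase) : Matrix Idx Idx ℂ :=
  bivP' m - ∑ i, ∑ j, (redG m)⁻¹ j i • wedge (Z i) (sharp (bivP' m) (dF m j))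

/-- `N` is the Nijenhuis operator `Q P⁻¹` on the tangent space of the leaf at `m`. -/
def IsNijenhuisOperator (m : Phase) (N : leafTangent m →ₗ[ℂ] leafTangent m) : Prop :=
  ∀ (α : Phase →L[ℂ] ℂ) (v : leafTangent m),
    sharp (bivP m) α = (v : Phase) → (N v : Phase) = sharp (bivQ m) α

/-! ### The coordinates `(λ_i, μ_i)` -/

/-- The matrix `𝒢(x)`: first row `L_{Z_j} H(x)`, second row `L_{Z_j} K(x)`. -/
def calG (m : Phase) (x : ℂ) : Matrix (Fin 2) (Fin 2) ℂ :=
  Matrix.of ![fun j => fderiv ℂ (polyH x) m (Z j), fun j => fderiv ℂ (polyK x) m (Z j)]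

/-- `ρ(x) = -𝒢₂₂(x) / 𝒢₁₂(x)`. -/
def rho (m : Phase) (x : ℂ) : ℂ := -calG m x 1 1 / calG m x 0 1

/-- On the open set `V`, the `λ_i` are holomorphic branches of the four distinct roots of `det 𝒢`,
and the `μ_i` are holomorphic branches of `log ρ(λ_i)`. -/
structure IsBranch (V : Set Phase) (lam mu : Fin 4 → Phase → ℂ) : Prop where
  isOpen : IsOpen V
  lam_holo : ∀ i, DifferentiableOn ℂ (lam i) V
  mu_holo : ∀ i, DifferentiableOn ℂ (mu i) V
  root : ∀ m ∈ V, ∀ i, (calG m (lam i m)).det = 0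
  distinct : ∀ m ∈ V, Function.Injective fun i => lam i m
  denom_ne : ∀ m ∈ V, ∀ i, calG m (lam i m) 0 1 ≠ 0
  exp_mu : ∀ m ∈ V, ∀ i, Complex.exp (mu i m) = rho m (lam i m)

/-- The points at which the construction makes sense: `G` is invertible (so that `Q` is defined and
`det 𝒢` has degree four), `det 𝒢` has four distinct roots, `ρ` is finite and nonzero at each of
them, and the eight functions `H₀, K₀, J₁, J₂, H₁, H₂, H₃, K₁` have independent differentials. -/
def regularSet : Set Phase :=
  {m | (redG m).det ≠ 0 ∧
    (∃ z : Fin 4 → ℂ, Function.Injective z ∧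
      ∀ i, (calG m (z i)).det = 0 ∧ calG m (z i) 0 1 ≠ 0 ∧ calG m (z i) 1 1 ≠ 0) ∧
    LinearIndependent ℂ
      (Sum.elim (fun i : Fin 4 => fderiv ℂ (fun x => casimirs x i) m)
        (fun i : Fin 4 => fderiv ℂ (fun x => hams x i) m))}

/-- `(λ, μ)` are Darboux-Nijenhuis coordinates at the point `m` of the leaf, for the pair of
bivectors induced by `P` and `Q`: their differentials form a basis of the cotangent space of the
leaf, they are canonical for `P`, and they diagonalize `N = Q P⁻¹` with eigenvalues `λ_i`. -/
structure IsDarbouxNijenhuisAt (lam mu : Fin 4 → Phase → ℂ) (m : Phase) : Prop where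
  basis : Function.Bijective fun v : leafTangent m =>
    (Sum.elim (fun i => fderiv ℂ (lam i) m v) (fun i => fderiv ℂ (mu i) m v) : Fin 4 ⊕ Fin 4 → ℂ)
  bracket_mu_lam : ∀ i j, bracket bivP (mu i) (lam j) m = if i = j then 1 else 0
  bracket_lam : ∀ i j, bracket bivP (lam i) (lam j) m = 0
  bracket_mu : ∀ i j, bracket bivP (mu i) (mu j) m = 0
  nijenhuis : ∃ N : leafTangent m →ₗ[ℂ] leafTangent m, IsNijenhuisOperator m N ∧
    ∀ (i : Fin 4) (v : leafTangent m),
      fderiv ℂ (lam i) m (N v) = lam i m * fderiv ℂ (lam i) m v ∧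
      fderiv ℂ (mu i) m (N v) = lam i m * fderiv ℂ (mu i) m v

/-! ### Integrability and separability -/

/-- On the leaf, near `m`, the Hamiltonians `H₁, H₂, H₃, K₁` are in involution and have independent
differentials at `m`. -/
def IsIntegrableAt (m : Phase) : Prop :=
  (∀ i j, bracket bivP (fun x => hams x i) (fun x => hams x j) m = 0) ∧
  LinearIndependent ℂ fun i : Fin 4 =>
    (fderiv ℂ (fun x => hams x i) m : Phase →ₗ[ℂ] ℂ).domRestrict (leafTangent m)

/-- On the subset `S`, the functions `Φ_i(x_i, y_i; h_1, …, h_4)` are separation relations for the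
Hamiltonians `h` in the coordinates `(x, y)`: they are holomorphic and vanish on `S`, each of them
depends effectively on its pair of coordinates, and they can be solved for the Hamiltonians. -/
structure IsSeparatedBy (S : Set Phase) (x y : Fin 4 → Phase → ℂ) (h : Phase → Fin 4 → ℂ)
    (Φ : Fin 4 → ℂ → ℂ → (Fin 4 → ℂ) → ℂ) : Prop where
  holo : ∀ i, Differentiable ℂ fun p : ℂ × ℂ × (Fin 4 → ℂ) => Φ i p.1 p.2.1 p.2.2
  relation : ∀ m ∈ S, ∀ i, Φ i (x i m) (y i m) (h m) = 0
  effective : ∀ m ∈ S, ∀ i,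
    deriv (fun s => Φ i s (y i m) (h m)) (x i m) ≠ 0 ∨
    deriv (fun s => Φ i (x i m) s (h m)) (y i m) ≠ 0
  solvable : ∀ m ∈ S,
    (Matrix.of fun i j : Fin 4 =>
      fderiv ℂ (Φ i (x i m) (y i m)) (h m) (Pi.single j 1)).det ≠ 0

end TodaFourThree

end

noncomputable section

namespace TodaFourThree

/-! Since `Z₁`, `Z₂` do not differentiate `J₁` and `J₂`, one has `L_{Z_j} R(x, ρ) = 𝒢₁ⱼ(x) +
𝒢₂ⱼ(x)/ρ`. Up to a power of `ν` these are two minors of `x - L(ν)`: the one without row and column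
4, and the one without row 1 and column 4. A pair `(λᵢ, ρ = exp μᵢ)` is a common zero of both
(`IsBranch.rel0`, `IsBranch.rel1`), that is, the row `(ρ, 1)` annihilates `𝒢(λᵢ)`.

Darboux-Nijenhuis property. Let `ω_k` be the gradient of `ρ 𝒢₁ₖ + 𝒢₂ₖ` at frozen `x` and `ρ`.
Differentiating the two relations writes `ω_1`, `ω_2` as combinations of `dλᵢ`, `dμᵢ`, with a
coefficient determinant that is nonzero because `λᵢ` is a simple root. The `ω_k` annihilate `Z₁` and
`Z₂`, and on the relations `P' ω_k - λᵢ P ω_k` is a combination of `Z₁`, `Z₂` (`omega0_pencil`,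
`omega1_pencil`). As `P` and `Q` both kill `dH₀` and `dK₀`, and `G` is invertible, this becomes `Q
ω_k = λᵢ P ω_k` (`mulVec_eq_smul_of_pencil`). Hence `dλᵢ` and `dμᵢ` are eigencovectors of the pencil
for the eigenvalue `λᵢ`. By skewness, eigencovectors for distinct eigenvalues are in involution,
while `{μᵢ, λᵢ} = 1` comes from `omega0_bivP_omega1`. The canonical brackets make the eight
differentials independent on the tangent space of the leaf, of dimension `12 - 4`, so they are
coordinates and `N` is diagonal in them.

Separation. The Desnanot-Jacobi identity writes `𝒢₁₂ · R` as a combination of the two relations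
(`g01_mul_spectralFun`), so `R` vanishes at `(λᵢ, exp μᵢ)`. Nontriviality follows by differentiating
`R = 0` and using the independence of the eight differentials, respectively of the coordinates.
Involution of the Hamiltonians is the Lenard-Magri argument.

Existence of charts is the implicit function theorem for the roots, a local logarithm, and the
inverse function theorem for `(λ, μ, casimirs)`.

Generic leaves. If `J₂ ≠ 0` and `J₁² ≠ 4 J₂`, all `c_i` are nonzero and `c₁c₃ ≠ c₂c₄`; the equation
`P g = v` is then solved by hand (`exists_bivP_eq`). For density, the part of the leaf with given `p
= c₁c₃`, `q = c₂c₄` is the image of an entire parametrization, so every point is joined to a base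
point by an entire curve. A polynomial vanishing off the regular set (`regularizer`) restricts to an
entire function on the curve. If it is nonzero at the base point, its zeros are isolated. The
exceptional polynomial in `κ` is the norm of its value at the base point under the exchange of `p`
and `q` (`exists_norm`). -/

/-- The vector with `b`-, `a`- and `c`-components given by the three arguments. -/
def vec (b a c : Fin 4 → ℂ) : Phase := Sum.elim b (Sum.elim a c)

@[simp] theorem bc_vec (b a c : Fin 4 → ℂ) : bc (vec b a c) = b := rfl
@[simp] theorem ac_vec (b a c : Fin 4 → ℂ) : ac (vec b a c) = a := rfl
@[simp] theorem cc_vec (b a c : Fin 4 → ℂ) : cc (vec b a c) = c := rfl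

/-! ### Covectors and the coordinate pairing -/

/-- The covector with components `g`. -/
def covec (g : Phase) : Phase →L[ℂ] ℂ :=
  ∑ t, g t • (ContinuousLinearMap.proj t : (Idx → ℂ) →L[ℂ] ℂ)

theorem covec_apply (g v : Phase) : covec g v = g ⬝ᵥ v := by
  simp [covec, dotProduct]

theorem covec_single (g : Phase) (t : Idx) : covec g (Pi.single t 1) = g t := by
  simp [covec_apply]

theorem sharp_covec (B : Matrix Idx Idx ℂ) (g : Phase) : sharp B (covec g) = B *ᵥ g := by
  simp [sharp, covec_single]

theorem apply_eq_dotProduct (α : Phase →L[ℂ] ℂ) (v : Phase) :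
    α v = (fun t => α (Pi.single t 1)) ⬝ᵥ v := by
  conv_lhs => rw [show v = ∑ t, v t • (Pi.single t 1 : Phase) by
    ext s; simp [Finset.sum_apply, Pi.single_apply]]
  simp [dotProduct, mul_comm]

theorem eq_covec (α : Phase →L[ℂ] ℂ) : α = covec fun t => α (Pi.single t 1) := by
  ext v
  rw [covec_apply, apply_eq_dotProduct]

theorem dotProduct_phase (g v : Phase) : g ⬝ᵥ v =
    (bc g 0 * bc v 0 + bc g 1 * bc v 1 + bc g 2 * bc v 2 + bc g 3 * bc v 3)
    + ((ac g 0 * ac v 0 + ac g 1 * ac v 1 + ac g 2 * ac v 2 + ac g 3 * ac v 3)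
    + (cc g 0 * cc v 0 + cc g 1 * cc v 1 + cc g 2 * cc v 2 + cc g 3 * cc v 3)) := by
  simp [dotProduct, Fintype.sum_sum_type, Fin.sum_univ_four, bc, ac, cc]

/-! ### Gradients of the Hamiltonians and of the entries of `𝒢` -/

def gradH0 (_ : Phase) : Phase :=
  vec ![1, 1, 1, 1]
    ![0, 0, 0, 0]
    ![0, 0, 0, 0]

def gradH1 (m : Phase) : Phase :=
  vec ![bc m 1 + bc m 2 + bc m 3, bc m 0 + bc m 2 + bc m 3, bc m 0 + bc m 1 + bc m 3, bc m 0 +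
    bc m 1 + bc m 2]
    ![1, 1, 1, 1]
    ![0, 0, 0, 0]

def gradH2 (m : Phase) : Phase :=
  vec ![bc m 1 * bc m 2 + bc m 1 * bc m 3 + bc m 2 * bc m 3 + ac m 1 + ac m 2, bc m 0 * bc m 2 +
    bc m 0 * bc m 3 + bc m 2 * bc m 3 + ac m 2 + ac m 3, bc m 0 * bc m 1 + bc m 0 * bc m 3 +
    bc m 1 * bc m 3 + ac m 0 + ac m 3, bc m 0 * bc m 1 + bc m 0 * bc m 2 + bc m 1 * bc m 2 +
    ac m 0 + ac m 1]
    ![bc m 2 + bc m 3, bc m 0 + bc m 3, bc m 0 + bc m 1, bc m 1 + bc m 2]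
    ![1, 1, 1, 1]

def gradH3 (m : Phase) : Phase :=
  vec ![bc m 1 * bc m 2 * bc m 3 + bc m 1 * ac m 2 + bc m 3 * ac m 1 + cc m 1,
    bc m 0 * bc m 2 * bc m 3 + bc m 0 * ac m 2 + bc m 2 * ac m 3 + cc m 2,
    bc m 0 * bc m 1 * bc m 3 + bc m 1 * ac m 3 + bc m 3 * ac m 0 + cc m 3,
    bc m 0 * bc m 1 * bc m 2 + bc m 0 * ac m 1 + bc m 2 * ac m 0 + cc m 0]
    ![bc m 2 * bc m 3 + ac m 2, bc m 0 * bc m 3 + ac m 3, bc m 0 * bc m 1 + ac m 0,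
      bc m 1 * bc m 2 + ac m 1]
    ![bc m 3, bc m 0, bc m 1, bc m 2]

def gradK0 (m : Phase) : Phase :=
  vec ![cc m 1 * cc m 3, cc m 0 * cc m 2, cc m 1 * cc m 3, cc m 0 * cc m 2]
    ![-ac m 1 * cc m 2 - ac m 3 * cc m 1, -ac m 0 * cc m 2 - ac m 2 * cc m 3, -ac m 1 * cc m 3 -
      ac m 3 * cc m 0, -ac m 0 * cc m 1 - ac m 2 * cc m 0]
    ![bc m 1 * cc m 2 + bc m 3 * cc m 2 - ac m 2 * ac m 3, bc m 0 * cc m 3 + bc m 2 * cc m 3 -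
      ac m 0 * ac m 3, bc m 1 * cc m 0 + bc m 3 * cc m 0 - ac m 0 * ac m 1, bc m 0 * cc m 1 +
      bc m 2 * cc m 1 - ac m 1 * ac m 2]

def gradK1 (m : Phase) : Phase :=
  vec ![-bc m 2 * cc m 1 * cc m 3 + ac m 1 * ac m 2 * cc m 3, -bc m 3 * cc m 0 * cc m 2 +
    ac m 2 * ac m 3 * cc m 0, -bc m 0 * cc m 1 * cc m 3 + ac m 0 * ac m 3 * cc m 1,
    -bc m 1 * cc m 0 * cc m 2 + ac m 0 * ac m 1 * cc m 2]
    ![bc m 2 * ac m 3 * cc m 1 + bc m 3 * ac m 1 * cc m 2 - ac m 1 * ac m 2 * ac m 3 +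
      cc m 1 * cc m 2, bc m 0 * ac m 2 * cc m 3 + bc m 3 * ac m 0 * cc m 2 -
      ac m 0 * ac m 2 * ac m 3 + cc m 2 * cc m 3, bc m 0 * ac m 1 * cc m 3 +
      bc m 1 * ac m 3 * cc m 0 - ac m 0 * ac m 1 * ac m 3 + cc m 0 * cc m 3,
      bc m 1 * ac m 2 * cc m 0 + bc m 2 * ac m 0 * cc m 1 - ac m 0 * ac m 1 * ac m 2 +
      cc m 0 * cc m 1]
    ![-bc m 1 * bc m 3 * cc m 2 + bc m 1 * ac m 2 * ac m 3 + ac m 2 * cc m 3 + ac m 3 * cc m 1,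
      -bc m 0 * bc m 2 * cc m 3 + bc m 2 * ac m 0 * ac m 3 + ac m 0 * cc m 2 + ac m 3 * cc m 0,
      -bc m 1 * bc m 3 * cc m 0 + bc m 3 * ac m 0 * ac m 1 + ac m 0 * cc m 1 + ac m 1 * cc m 3,
      -bc m 0 * bc m 2 * cc m 1 + bc m 0 * ac m 1 * ac m 2 + ac m 1 * cc m 2 + ac m 2 * cc m 0]

def gradJ1 (m : Phase) : Phase :=
  vec ![0, 0, 0, 0]
    ![0, 0, 0, 0]
    ![cc m 2, cc m 3, cc m 0, cc m 1]

def gradJ2 (m : Phase) : Phase :=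
  vec ![0, 0, 0, 0]
    ![0, 0, 0, 0]
    ![cc m 1 * cc m 2 * cc m 3, cc m 0 * cc m 2 * cc m 3, cc m 0 * cc m 1 * cc m 3,
      cc m 0 * cc m 1 * cc m 2]

def g00 (m : Phase) (x : ℂ) : ℂ :=
  -bc m 0 * bc m 1 * bc m 2 + bc m 0 * bc m 1 * x + bc m 0 * bc m 2 * x - bc m 0 * ac m 1 -
    bc m 0 * x ^ 2 + bc m 1 * bc m 2 * x - bc m 1 * x ^ 2 - bc m 2 * ac m 0 - bc m 2 * x ^ 2 +
    ac m 0 * x + ac m 1 * x - cc m 0 + x ^ 3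

def g00x (m : Phase) (x : ℂ) : ℂ :=
  bc m 0 * bc m 1 + bc m 0 * bc m 2 - 2 * bc m 0 * x + bc m 1 * bc m 2 - 2 * bc m 1 * x -
    2 * bc m 2 * x + ac m 0 + ac m 1 + 3 * x ^ 2

def gradG00 (m : Phase) (x : ℂ) : Phase :=
  vec ![-bc m 1 * bc m 2 + bc m 1 * x + bc m 2 * x - ac m 1 - x ^ 2, -bc m 0 * bc m 2 +
    bc m 0 * x + bc m 2 * x - x ^ 2, -bc m 0 * bc m 1 + bc m 0 * x + bc m 1 * x - ac m 0 - x ^ 2, 0]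
    ![-bc m 2 + x, -bc m 0 + x, 0, 0]
    ![-1, 0, 0, 0]

def g01 (m : Phase) (x : ℂ) : ℂ :=
  bc m 1 * bc m 2 - bc m 1 * x - bc m 2 * x + ac m 1 + x ^ 2

def g01x (m : Phase) (x : ℂ) : ℂ :=
  -bc m 1 - bc m 2 + 2 * x

def gradG01 (m : Phase) (x : ℂ) : Phase :=
  vec ![0, bc m 2 - x, bc m 1 - x, 0]
    ![0, 1, 0, 0]
    ![0, 0, 0, 0]

def g10 (m : Phase) (x : ℂ) : ℂ :=
  bc m 1 * cc m 0 * cc m 2 - ac m 0 * ac m 1 * cc m 2 - cc m 0 * cc m 2 * x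

def g10x (m : Phase) (_ : ℂ) : ℂ :=
  -cc m 0 * cc m 2

def gradG10 (m : Phase) (x : ℂ) : Phase :=
  vec ![0, cc m 0 * cc m 2, 0, 0]
    ![-ac m 1 * cc m 2, -ac m 0 * cc m 2, 0, 0]
    ![bc m 1 * cc m 2 - cc m 2 * x, 0, bc m 1 * cc m 0 - ac m 0 * ac m 1 - cc m 0 * x, 0]

def g11 (m : Phase) (x : ℂ) : ℂ :=
  bc m 1 * ac m 2 * cc m 0 + bc m 2 * ac m 0 * cc m 1 - ac m 0 * ac m 1 * ac m 2 -
    ac m 0 * cc m 1 * x - ac m 2 * cc m 0 * x + cc m 0 * cc m 1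

def g11x (m : Phase) (_ : ℂ) : ℂ :=
  -ac m 0 * cc m 1 - ac m 2 * cc m 0

def gradG11 (m : Phase) (x : ℂ) : Phase :=
  vec ![0, ac m 2 * cc m 0, ac m 0 * cc m 1, 0]
    ![bc m 2 * cc m 1 - ac m 1 * ac m 2 - cc m 1 * x, -ac m 0 * ac m 2, bc m 1 * cc m 0 -
      ac m 0 * ac m 1 - cc m 0 * x, 0]
    ![bc m 1 * ac m 2 - ac m 2 * x + cc m 1, bc m 2 * ac m 0 - ac m 0 * x + cc m 0, 0, 0]

/-! ### The two tensors applied to a vector -/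

theorem bivP_mulVec (m v : Phase) : bivP m *ᵥ v = vec
    ![(-ac m 0) * ac v 0 + (ac m 3) * ac v 3 + (-cc m 0) * cc v 0 + (cc m 2) * cc v 2,
      (ac m 0) * ac v 0 + (-ac m 1) * ac v 1 + (-cc m 1) * cc v 1 + (cc m 3) * cc v 3,
      (ac m 1) * ac v 1 + (-ac m 2) * ac v 2 + (cc m 0) * cc v 0 + (-cc m 2) * cc v 2,
      (ac m 2) * ac v 2 + (-ac m 3) * ac v 3 + (cc m 1) * cc v 1 + (-cc m 3) * cc v 3]
    ![(ac m 0) * bc v 0 + (-ac m 0) * bc v 1 + (-cc m 0) * ac v 1 + (cc m 3) * ac v 3,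
      (ac m 1) * bc v 1 + (-ac m 1) * bc v 2 + (cc m 0) * ac v 0 + (-cc m 1) * ac v 2,
      (ac m 2) * bc v 2 + (-ac m 2) * bc v 3 + (cc m 1) * ac v 1 + (-cc m 2) * ac v 3,
      (-ac m 3) * bc v 0 + (ac m 3) * bc v 3 + (-cc m 3) * ac v 0 + (cc m 2) * ac v 2]
    ![(cc m 0) * bc v 0 + (-cc m 0) * bc v 2,
      (cc m 1) * bc v 1 + (-cc m 1) * bc v 3,
      (-cc m 2) * bc v 0 + (cc m 2) * bc v 2,
      (-cc m 3) * bc v 1 + (cc m 3) * bc v 3] := by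
  ext s; rcases s with i | i | i <;> fin_cases i <;>
    
    simp [bivP, blockA1, blockC1, blockC2, mulVec,
      dotProduct, Fintype.sum_sum_type, Fin.sum_univ_four, vec, bc, ac, cc] <;> ring

theorem bivP'_mulVec (m v : Phase) : bivP' m *ᵥ v = vec
    ![(ac m 0) * bc v 1 + (-ac m 3) * bc v 3 + (-bc m 0 * ac m 0) * ac v 0 + (cc m 0) * ac v 1 +
      (-cc m 2) * ac v 2 + (bc m 0 * ac m 3) * ac v 3 + (-bc m 0 * cc m 0) * cc v 0 +
      (bc m 0 * cc m 2) * cc v 2,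
      (-ac m 0) * bc v 0 + (ac m 1) * bc v 2 + (bc m 1 * ac m 0) * ac v 0 +
        (-bc m 1 * ac m 1) * ac v 1 + (cc m 1) * ac v 2 + (-cc m 3) * ac v 3 +
        (-bc m 1 * cc m 1) * cc v 1 + (bc m 1 * cc m 3) * cc v 3,
      (-ac m 1) * bc v 1 + (ac m 2) * bc v 3 + (-cc m 0) * ac v 0 + (bc m 2 * ac m 1) * ac v 1 +
        (-bc m 2 * ac m 2) * ac v 2 + (cc m 2) * ac v 3 + (bc m 2 * cc m 0) * cc v 0 +
        (-bc m 2 * cc m 2) * cc v 2,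
      (ac m 3) * bc v 0 + (-ac m 2) * bc v 2 + (cc m 3) * ac v 0 + (-cc m 1) * ac v 1 +
        (bc m 3 * ac m 2) * ac v 2 + (-bc m 3 * ac m 3) * ac v 3 + (bc m 3 * cc m 1) * cc v 1 +
        (-bc m 3 * cc m 3) * cc v 3]
    ![(bc m 0 * ac m 0) * bc v 0 + (-bc m 1 * ac m 0) * bc v 1 + (cc m 0) * bc v 2 +
      (-cc m 3) * bc v 3 + (-bc m 1 * cc m 0 - ac m 0 * ac m 1) * ac v 1 + (bc m 0 * cc m 3 +
      ac m 0 * ac m 3) * ac v 3 + (-ac m 0 * cc m 0) * cc v 0 + (-ac m 0 * cc m 1) * cc v 1 +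
      (ac m 0 * cc m 2) * cc v 2 + (ac m 0 * cc m 3) * cc v 3,
      (-cc m 0) * bc v 0 + (bc m 1 * ac m 1) * bc v 1 + (-bc m 2 * ac m 1) * bc v 2 +
        (cc m 1) * bc v 3 + (bc m 1 * cc m 0 + ac m 0 * ac m 1) * ac v 0 + (-bc m 2 * cc m 1 -
        ac m 1 * ac m 2) * ac v 2 + (ac m 1 * cc m 0) * cc v 0 + (-ac m 1 * cc m 1) * cc v 1 +
        (-ac m 1 * cc m 2) * cc v 2 + (ac m 1 * cc m 3) * cc v 3,
      (cc m 2) * bc v 0 + (-cc m 1) * bc v 1 + (bc m 2 * ac m 2) * bc v 2 +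
        (-bc m 3 * ac m 2) * bc v 3 + (bc m 2 * cc m 1 + ac m 1 * ac m 2) * ac v 1 +
        (-bc m 3 * cc m 2 - ac m 2 * ac m 3) * ac v 3 + (ac m 2 * cc m 0) * cc v 0 +
        (ac m 2 * cc m 1) * cc v 1 + (-ac m 2 * cc m 2) * cc v 2 + (-ac m 2 * cc m 3) * cc v 3,
      (-bc m 0 * ac m 3) * bc v 0 + (cc m 3) * bc v 1 + (-cc m 2) * bc v 2 +
        (bc m 3 * ac m 3) * bc v 3 + (-bc m 0 * cc m 3 - ac m 0 * ac m 3) * ac v 0 +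
        (bc m 3 * cc m 2 + ac m 2 * ac m 3) * ac v 2 + (-ac m 3 * cc m 0) * cc v 0 +
        (ac m 3 * cc m 1) * cc v 1 + (ac m 3 * cc m 2) * cc v 2 + (-ac m 3 * cc m 3) * cc v 3]
    ![(bc m 0 * cc m 0) * bc v 0 + (-bc m 2 * cc m 0) * bc v 2 + (ac m 0 * cc m 0) * ac v 0 +
      (-ac m 1 * cc m 0) * ac v 1 + (-ac m 2 * cc m 0) * ac v 2 + (ac m 3 * cc m 0) * ac v 3 +
      (-cc m 0 * cc m 1) * cc v 1 + (cc m 0 * cc m 3) * cc v 3,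
      (bc m 1 * cc m 1) * bc v 1 + (-bc m 3 * cc m 1) * bc v 3 + (ac m 0 * cc m 1) * ac v 0 +
        (ac m 1 * cc m 1) * ac v 1 + (-ac m 2 * cc m 1) * ac v 2 + (-ac m 3 * cc m 1) * ac v 3 +
        (cc m 0 * cc m 1) * cc v 0 + (-cc m 1 * cc m 2) * cc v 2,
      (-bc m 0 * cc m 2) * bc v 0 + (bc m 2 * cc m 2) * bc v 2 + (-ac m 0 * cc m 2) * ac v 0 +
        (ac m 1 * cc m 2) * ac v 1 + (ac m 2 * cc m 2) * ac v 2 + (-ac m 3 * cc m 2) * ac v 3 +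
        (cc m 1 * cc m 2) * cc v 1 + (-cc m 2 * cc m 3) * cc v 3,
      (-bc m 1 * cc m 3) * bc v 1 + (bc m 3 * cc m 3) * bc v 3 + (-ac m 0 * cc m 3) * ac v 0 +
        (-ac m 1 * cc m 3) * ac v 1 + (ac m 2 * cc m 3) * ac v 2 + (ac m 3 * cc m 3) * ac v 3 +
        (-cc m 0 * cc m 3) * cc v 0 + (cc m 2 * cc m 3) * cc v 2] := by
  ext s; rcases s with i | i | i <;> fin_cases i <;>
    
    simp [bivP', blockA2, blockB1, blockC3, blockA3, blockC4, blockA4,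
      mulVec, dotProduct, Fintype.sum_sum_type, Fin.sum_univ_four, vec, bc, ac, cc] <;> ring


theorem bivP_skew (m g h : Phase) : g ⬝ᵥ (bivP m *ᵥ h) = -(h ⬝ᵥ (bivP m *ᵥ g)) := by
  rw [bivP_mulVec, bivP_mulVec, dotProduct_phase, dotProduct_phase]
  simp only [bc_vec, ac_vec, cc_vec, cons_val]
  ring

theorem bivP'_skew (m g h : Phase) : g ⬝ᵥ (bivP' m *ᵥ h) = -(h ⬝ᵥ (bivP' m *ᵥ g)) := by
  rw [bivP'_mulVec, bivP'_mulVec, dotProduct_phase, dotProduct_phase]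
  simp only [bc_vec, ac_vec, cc_vec, cons_val]
  ring

theorem phase_ext {v w : Phase} (hb : ∀ i, bc v i = bc w i) (ha : ∀ i, ac v i = ac w i)
    (hc : ∀ i, cc v i = cc w i) : v = w := by
  ext s
  rcases s with i | i | i
  exacts [hb i, ha i, hc i]

/-! ### Lenard relations -/

/-- The identities below form two Lenard chains, `H₀, H₁, H₂, H₃` and `K₀, K₁`, both starting at a
Casimir of `P`; the second one stops at a Casimir of `P'`. `J₁` and `J₂` are Casimirs of both
tensors. -/
theorem bivP_gradH0 (m : Phase) : bivP m *ᵥ gradH0 m = 0 := by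
  rw [bivP_mulVec]
  refine phase_ext ?_ ?_ ?_ <;> intro i <;> fin_cases i <;>
    simp [gradH0, vec, bc, ac, cc]

theorem bivP'_gradH0 (m : Phase) : bivP' m *ᵥ gradH0 m = -(bivP m *ᵥ gradH1 m) := by
  rw [bivP_mulVec, bivP'_mulVec]
  refine phase_ext ?_ ?_ ?_ <;> intro i <;> fin_cases i <;>
    simp [gradH0, gradH1, vec, bc, ac, cc] <;> ring

theorem bivP'_gradH1 (m : Phase) : bivP' m *ᵥ gradH1 m = -(bivP m *ᵥ gradH2 m) := by
  rw [bivP_mulVec, bivP'_mulVec]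
  refine phase_ext ?_ ?_ ?_ <;> intro i <;> fin_cases i <;>
    simp [gradH1, gradH2, vec, bc, ac, cc] <;> ring

theorem bivP'_gradH2 (m : Phase) : bivP' m *ᵥ gradH2 m = -(bivP m *ᵥ gradH3 m) := by
  rw [bivP_mulVec, bivP'_mulVec]
  refine phase_ext ?_ ?_ ?_ <;> intro i <;> fin_cases i <;>
    simp [gradH2, gradH3, vec, bc, ac, cc] <;> ring

theorem bivP_gradK0 (m : Phase) : bivP m *ᵥ gradK0 m = 0 := by
  rw [bivP_mulVec]
  refine phase_ext ?_ ?_ ?_ <;> intro i <;> fin_cases i <;>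
    simp [gradK0, vec, bc, ac, cc] <;> ring

theorem bivP'_gradK0 (m : Phase) : bivP' m *ᵥ gradK0 m = bivP m *ᵥ gradK1 m := by
  rw [bivP_mulVec, bivP'_mulVec]
  refine phase_ext ?_ ?_ ?_ <;> intro i <;> fin_cases i <;>
    simp [gradK0, gradK1, vec, bc, ac, cc] <;> ring

theorem bivP'_gradK1 (m : Phase) : bivP' m *ᵥ gradK1 m = 0 := by
  rw [bivP'_mulVec]
  refine phase_ext ?_ ?_ ?_ <;> intro i <;> fin_cases i <;>
    simp [gradK1, vec, bc, ac, cc] <;> ring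

theorem bivP_gradJ1 (m : Phase) : bivP m *ᵥ gradJ1 m = 0 := by
  rw [bivP_mulVec]
  refine phase_ext ?_ ?_ ?_ <;> intro i <;> fin_cases i <;>
    simp [gradJ1, vec, bc, ac, cc] <;> ring

theorem bivP'_gradJ1 (m : Phase) : bivP' m *ᵥ gradJ1 m = 0 := by
  rw [bivP'_mulVec]
  refine phase_ext ?_ ?_ ?_ <;> intro i <;> fin_cases i <;>
    simp [gradJ1, vec, bc, ac, cc] <;> ring

theorem bivP_gradJ2 (m : Phase) : bivP m *ᵥ gradJ2 m = 0 := by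
  rw [bivP_mulVec]
  refine phase_ext ?_ ?_ ?_ <;> intro i <;> fin_cases i <;>
    simp [gradJ2, vec, bc, ac, cc] <;> ring

theorem bivP'_gradJ2 (m : Phase) : bivP' m *ᵥ gradJ2 m = 0 := by
  rw [bivP'_mulVec]
  refine phase_ext ?_ ?_ ?_ <;> intro i <;> fin_cases i <;>
    simp [gradJ2, vec, bc, ac, cc] <;> ring

/-! ### Elementary identities -/

theorem todaH_eq (m : Phase) : todaH m = (1 / 2) * H0 m ^ 2 - H1 m := by
  simp only [todaH, H0, H1, Fin.sum_univ_four]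
  ring

theorem det_lax (m : Phase) (x ν : ℂ) (hν : ν ≠ 0) :
    (x • (1 : Matrix (Fin 4) (Fin 4) ℂ) - lax m ν).det
      = spectralFun (casimirs m) (hams m) x (ν ^ 4) := by
  have h : (x • (1 : Matrix (Fin 4) (Fin 4) ℂ) - lax m ν) =
      !![x - bc m 0, ν, -(cc m 2 / ν ^ 2), -(ac m 3 / ν);
         -(ac m 0 / ν), x - bc m 1, ν, -(cc m 3 / ν ^ 2);
         -(cc m 0 / ν ^ 2), -(ac m 1 / ν), x - bc m 2, ν;
         ν, -(cc m 1 / ν ^ 2), -(ac m 2 / ν), x - bc m 3] := by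
    ext i j
    fin_cases i <;> fin_cases j <;> simp [lax]
  rw [h]
  simp only [det_succ_row_zero, Fin.sum_univ_succ, det_unique]
  simp [Fin.succAbove, spectralFun, casimirs, hams, H0, H1, H2, H3, K0, K1, J1, J2,
    Fin.sum_univ_four]
  field_simp
  ring

/-! ### Derivatives -/

theorem hasFDerivAt_bc (m : Phase) (i : Fin 4) : HasFDerivAt (fun p : Phase => bc p i)
    (ContinuousLinearMap.proj (Sum.inl i) : (Idx → ℂ) →L[ℂ] ℂ) m :=
  (ContinuousLinearMap.proj (Sum.inl i) : (Idx → ℂ) →L[ℂ] ℂ).hasFDerivAt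

theorem hasFDerivAt_ac (m : Phase) (i : Fin 4) : HasFDerivAt (fun p : Phase => ac p i)
    (ContinuousLinearMap.proj (Sum.inr (Sum.inl i)) : (Idx → ℂ) →L[ℂ] ℂ) m :=
  (ContinuousLinearMap.proj (Sum.inr (Sum.inl i)) : (Idx → ℂ) →L[ℂ] ℂ).hasFDerivAt

theorem hasFDerivAt_cc (m : Phase) (i : Fin 4) : HasFDerivAt (fun p : Phase => cc p i)
    (ContinuousLinearMap.proj (Sum.inr (Sum.inr i)) : (Idx → ℂ) →L[ℂ] ℂ) m :=
  (ContinuousLinearMap.proj (Sum.inr (Sum.inr i)) : (Idx → ℂ) →L[ℂ] ℂ).hasFDerivAt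

theorem hasFDerivAt_H0 (m : Phase) : HasFDerivAt H0 (covec (gradH0 m)) m := by
  unfold H0
  simp only [Fin.sum_univ_four, Fin.isValue]
  apply HasFDerivAt.congr_fderiv
  · repeat' first
      | exact hasFDerivAt_bc _ _ | exact hasFDerivAt_ac _ _ | exact hasFDerivAt_cc _ _
      | apply HasFDerivAt.fun_add
  · ext v
    simp [covec_apply, dotProduct_phase, gradH0, vec, bc, ac, cc]
    try ring

theorem hasFDerivAt_H1 (m : Phase) : HasFDerivAt H1 (covec (gradH1 m)) m := by
  unfold H1
  simp only [Fin.sum_univ_four, Fin.isValue]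
  apply HasFDerivAt.congr_fderiv
  · repeat' first
      | exact hasFDerivAt_bc _ _ | exact hasFDerivAt_ac _ _ | exact hasFDerivAt_cc _ _
      | apply HasFDerivAt.fun_add | apply HasFDerivAt.fun_sub | apply HasFDerivAt.fun_mul
  · ext v
    simp [covec_apply, dotProduct_phase, gradH1, vec, bc, ac, cc]
    try ring

theorem hasFDerivAt_H2 (m : Phase) : HasFDerivAt H2 (covec (gradH2 m)) m := by
  unfold H2
  simp only [Fin.sum_univ_four, Fin.isValue, Fin.reduceAdd, zero_add]
  apply HasFDerivAt.congr_fderiv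
  · repeat' first
      | exact hasFDerivAt_bc _ _ | exact hasFDerivAt_ac _ _ | exact hasFDerivAt_cc _ _
      | apply HasFDerivAt.fun_add | apply HasFDerivAt.fun_sub | apply HasFDerivAt.fun_mul
  · ext v
    simp [covec_apply, dotProduct_phase, gradH2, vec, bc, ac, cc]
    try ring

theorem hasFDerivAt_H3 (m : Phase) : HasFDerivAt H3 (covec (gradH3 m)) m := by
  unfold H3
  simp only [Fin.sum_univ_four, Fin.isValue, Fin.reduceAdd, zero_add]
  apply HasFDerivAt.congr_fderiv
  · repeat' first
      | exact hasFDerivAt_bc _ _ | exact hasFDerivAt_ac _ _ | exact hasFDerivAt_cc _ _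
      | apply HasFDerivAt.fun_add | apply HasFDerivAt.fun_sub | apply HasFDerivAt.fun_mul
  · ext v
    simp [covec_apply, dotProduct_phase, gradH3, vec, bc, ac, cc]
    try ring

theorem hasFDerivAt_K0 (m : Phase) : HasFDerivAt K0 (covec (gradK0 m)) m := by
  unfold K0
  simp only [Fin.sum_univ_four, Fin.isValue, Fin.reduceAdd, zero_add]
  apply HasFDerivAt.congr_fderiv
  · repeat' first
      | exact hasFDerivAt_bc _ _ | exact hasFDerivAt_ac _ _ | exact hasFDerivAt_cc _ _
      | apply HasFDerivAt.fun_add | apply HasFDerivAt.fun_sub | apply HasFDerivAt.fun_mul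
  · ext v
    simp [covec_apply, dotProduct_phase, gradK0, vec, bc, ac, cc]
    try ring

theorem hasFDerivAt_K1 (m : Phase) : HasFDerivAt K1 (covec (gradK1 m)) m := by
  unfold K1
  simp only [Fin.sum_univ_four, Fin.isValue, Fin.reduceAdd, zero_add]
  apply HasFDerivAt.congr_fderiv
  · repeat' first
      | exact hasFDerivAt_bc _ _ | exact hasFDerivAt_ac _ _ | exact hasFDerivAt_cc _ _
      | apply HasFDerivAt.fun_add | apply HasFDerivAt.fun_sub | apply HasFDerivAt.fun_mul
  · ext v
    simp [covec_apply, dotProduct_phase, gradK1, vec, bc, ac, cc]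
    try ring

theorem hasFDerivAt_J1 (m : Phase) : HasFDerivAt J1 (covec (gradJ1 m)) m := by
  unfold J1
  apply HasFDerivAt.congr_fderiv
  · repeat' first
      | exact hasFDerivAt_bc _ _ | exact hasFDerivAt_ac _ _ | exact hasFDerivAt_cc _ _
      | apply HasFDerivAt.fun_add | apply HasFDerivAt.fun_sub | apply HasFDerivAt.fun_mul
  · ext v
    simp [covec_apply, dotProduct_phase, gradJ1, vec, bc, ac, cc]
    try ring

theorem hasFDerivAt_J2 (m : Phase) : HasFDerivAt J2 (covec (gradJ2 m)) m := by
  unfold J2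
  apply HasFDerivAt.congr_fderiv
  · repeat' first
      | exact hasFDerivAt_bc _ _ | exact hasFDerivAt_ac _ _ | exact hasFDerivAt_cc _ _
      | apply HasFDerivAt.fun_add | apply HasFDerivAt.fun_sub | apply HasFDerivAt.fun_mul
  · ext v
    simp [covec_apply, dotProduct_phase, gradJ2, vec, bc, ac, cc]
    try ring

/-- The spectral parameter moves with the point, so that the relations satisfied by `λᵢ` can be
differentiated along the branch; the two summands are the gradient at frozen `x` and the
contribution of `dx`. -/
theorem hasFDerivAt_g00 {m : Phase} {y : Phase → ℂ} {y' : Phase →L[ℂ] ℂ}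
    (hy : HasFDerivAt y y' m) : HasFDerivAt (fun p => g00 p (y p))
      (covec (gradG00 m (y m)) + g00x m (y m) • y') m := by
  unfold g00
  simp only [pow_succ, pow_zero, one_mul]
  apply HasFDerivAt.congr_fderiv
  · repeat' first
      | exact hasFDerivAt_bc _ _ | exact hasFDerivAt_ac _ _ | exact hasFDerivAt_cc _ _ | exact hy
      | apply HasFDerivAt.fun_add | apply HasFDerivAt.fun_sub | apply HasFDerivAt.fun_mul
      | apply HasFDerivAt.fun_neg
  · ext v
    simp [covec_apply, dotProduct_phase, gradG00, g00x, vec, bc, ac, cc]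
    try ring

theorem hasFDerivAt_g01 {m : Phase} {y : Phase → ℂ} {y' : Phase →L[ℂ] ℂ}
    (hy : HasFDerivAt y y' m) : HasFDerivAt (fun p => g01 p (y p))
      (covec (gradG01 m (y m)) + g01x m (y m) • y') m := by
  unfold g01
  simp only [pow_succ, pow_zero, one_mul]
  apply HasFDerivAt.congr_fderiv
  · repeat' first
      | exact hasFDerivAt_bc _ _ | exact hasFDerivAt_ac _ _ | exact hasFDerivAt_cc _ _ | exact hy
      | apply HasFDerivAt.fun_add | apply HasFDerivAt.fun_sub | apply HasFDerivAt.fun_mul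
  · ext v
    simp [covec_apply, dotProduct_phase, gradG01, g01x, vec, bc, ac, cc]
    try ring

theorem hasFDerivAt_g10 {m : Phase} {y : Phase → ℂ} {y' : Phase →L[ℂ] ℂ}
    (hy : HasFDerivAt y y' m) : HasFDerivAt (fun p => g10 p (y p))
      (covec (gradG10 m (y m)) + g10x m (y m) • y') m := by
  unfold g10
  apply HasFDerivAt.congr_fderiv
  · repeat' first
      | exact hasFDerivAt_bc _ _ | exact hasFDerivAt_ac _ _ | exact hasFDerivAt_cc _ _ | exact hy
      | apply HasFDerivAt.fun_add | apply HasFDerivAt.fun_sub | apply HasFDerivAt.fun_mul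
  · ext v
    simp [covec_apply, dotProduct_phase, gradG10, g10x, vec, bc, ac, cc]
    try ring

theorem hasFDerivAt_g11 {m : Phase} {y : Phase → ℂ} {y' : Phase →L[ℂ] ℂ}
    (hy : HasFDerivAt y y' m) : HasFDerivAt (fun p => g11 p (y p))
      (covec (gradG11 m (y m)) + g11x m (y m) • y') m := by
  unfold g11
  apply HasFDerivAt.congr_fderiv
  · repeat' first
      | exact hasFDerivAt_bc _ _ | exact hasFDerivAt_ac _ _ | exact hasFDerivAt_cc _ _ | exact hy
      | apply HasFDerivAt.fun_add | apply HasFDerivAt.fun_sub | apply HasFDerivAt.fun_mul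
  · ext v
    simp [covec_apply, dotProduct_phase, gradG11, g11x, vec, bc, ac, cc]
    try ring

theorem hasFDerivAt_polyH (x : ℂ) (m : Phase) : HasFDerivAt (polyH x)
    (covec (-(x ^ 3 • gradH0 m) + x ^ 2 • gradH1 m - x • gradH2 m + gradH3 m)) m := by
  refine HasFDerivAt.congr_fderiv (((((hasFDerivAt_H0 m).const_mul (x ^ 3)).neg.add
    ((hasFDerivAt_H1 m).const_mul (x ^ 2))).sub ((hasFDerivAt_H2 m).const_mul x)).add
    (hasFDerivAt_H3 m)) ?_
  ext v
  simp [covec_apply]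

theorem hasFDerivAt_polyK (x : ℂ) (m : Phase) : HasFDerivAt (polyK x)
    (covec (x • gradK0 m + gradK1 m)) m := by
  refine HasFDerivAt.congr_fderiv (((hasFDerivAt_K0 m).const_mul x).add (hasFDerivAt_K1 m)) ?_
  ext v
  simp [covec_apply]

/-! ### The transversal fields and the matrices `𝒢` and `G` -/

theorem Z_zero : Z 0 = vec ![0, 0, 0, -1] 0 0 := by
  refine phase_ext ?_ ?_ ?_ <;> intro i <;> fin_cases i <;> simp [Z, vec, bc, ac, cc]

theorem Z_one : Z 1 = vec 0 ![0, 0, 0, 1] 0 := by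
  refine phase_ext ?_ ?_ ?_ <;> intro i <;> fin_cases i <;> simp [Z, vec, bc, ac, cc]

theorem dotProduct_Z_zero (g : Phase) : g ⬝ᵥ Z 0 = -bc g 3 := by
  simp [Z_zero, dotProduct_phase]

theorem dotProduct_Z_one (g : Phase) : g ⬝ᵥ Z 1 = ac g 3 := by
  simp [Z_one, dotProduct_phase]

theorem calG_eq (m : Phase) (x : ℂ) : calG m x = !![g00 m x, g01 m x; g10 m x, g11 m x] := by
  ext i k
  fin_cases i <;> fin_cases k <;>
    simp [calG, (hasFDerivAt_polyH x m).fderiv, (hasFDerivAt_polyK x m).fderiv, covec_apply,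
      dotProduct_Z_zero, dotProduct_Z_one, gradH0, gradH1, gradH2, gradH3, gradK0, gradK1,
      vec, bc, ac, cc, g00, g01, g10, g11] <;> ring

/-- The derivative of `K₀` along `∂/∂a₄`, that is, the leading coefficient of `det 𝒢`. -/
def lead (m : Phase) : ℂ := -(ac m 0 * cc m 1) - ac m 2 * cc m 0

theorem redG_eq (m : Phase) : redG m = !![-1, -(cc m 0 * cc m 2); 0, lead m] := by
  ext i k
  fin_cases i <;> fin_cases k <;>
    simp [redG, dF, (hasFDerivAt_H0 m).fderiv, (hasFDerivAt_K0 m).fderiv, covec_apply, lead,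
      dotProduct_Z_zero, dotProduct_Z_one, gradH0, gradK0, vec, bc, ac, cc]

/-- `G` is triangular, so it is invertible exactly when `det 𝒢` has degree four. -/
theorem det_redG (m : Phase) : (redG m).det = -lead m := by
  simp [redG_eq, det_fin_two]

/-! ### The polynomial `det 𝒢(x)` -/

/-- The coefficient of `x ^ 0` in `det 𝒢(x)`. -/
def coeffDet0 (m : Phase) : ℂ :=
  -bc m 0 * bc m 1 ^ 2 * bc m 2 * ac m 2 * cc m 0 -
    bc m 0 * bc m 1 * bc m 2 ^ 2 * ac m 0 * cc m 1 +
    bc m 0 * bc m 1 * bc m 2 * ac m 0 * ac m 1 * ac m 2 -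
    bc m 0 * bc m 1 * bc m 2 * cc m 0 * cc m 1 - bc m 0 * bc m 1 * ac m 1 * ac m 2 * cc m 0 -
    bc m 0 * bc m 2 * ac m 0 * ac m 1 * cc m 1 + bc m 0 * ac m 0 * ac m 1 ^ 2 * ac m 2 -
    bc m 0 * ac m 1 * cc m 0 * cc m 1 - bc m 1 ^ 2 * bc m 2 * cc m 0 * cc m 2 +
    bc m 1 * bc m 2 * ac m 0 * ac m 1 * cc m 2 - bc m 1 * bc m 2 * ac m 0 * ac m 2 * cc m 0 -
    bc m 1 * ac m 1 * cc m 0 * cc m 2 - bc m 1 * ac m 2 * cc m 0 ^ 2 -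
    bc m 2 ^ 2 * ac m 0 ^ 2 * cc m 1 + bc m 2 * ac m 0 ^ 2 * ac m 1 * ac m 2 -
    2 * bc m 2 * ac m 0 * cc m 0 * cc m 1 + ac m 0 * ac m 1 ^ 2 * cc m 2 +
    ac m 0 * ac m 1 * ac m 2 * cc m 0 - cc m 0 ^ 2 * cc m 1

/-- The coefficient of `x ^ 1` in `det 𝒢(x)`. -/
def coeffDet1 (m : Phase) : ℂ :=
  bc m 0 * bc m 1 ^ 2 * ac m 2 * cc m 0 + 2 * bc m 0 * bc m 1 * bc m 2 * ac m 0 * cc m 1 +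
    2 * bc m 0 * bc m 1 * bc m 2 * ac m 2 * cc m 0 - bc m 0 * bc m 1 * ac m 0 * ac m 1 * ac m 2 +
    bc m 0 * bc m 1 * cc m 0 * cc m 1 + bc m 0 * bc m 2 ^ 2 * ac m 0 * cc m 1 -
    bc m 0 * bc m 2 * ac m 0 * ac m 1 * ac m 2 + bc m 0 * bc m 2 * cc m 0 * cc m 1 +
    bc m 0 * ac m 0 * ac m 1 * cc m 1 + bc m 0 * ac m 1 * ac m 2 * cc m 0 +
    bc m 1 ^ 2 * bc m 2 * ac m 2 * cc m 0 + bc m 1 ^ 2 * cc m 0 * cc m 2 +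
    bc m 1 * bc m 2 ^ 2 * ac m 0 * cc m 1 - bc m 1 * bc m 2 * ac m 0 * ac m 1 * ac m 2 +
    bc m 1 * bc m 2 * cc m 0 * cc m 1 + 2 * bc m 1 * bc m 2 * cc m 0 * cc m 2 -
    bc m 1 * ac m 0 * ac m 1 * cc m 2 + bc m 1 * ac m 0 * ac m 2 * cc m 0 +
    bc m 1 * ac m 1 * ac m 2 * cc m 0 + 2 * bc m 2 * ac m 0 ^ 2 * cc m 1 +
    bc m 2 * ac m 0 * ac m 1 * cc m 1 - bc m 2 * ac m 0 * ac m 1 * cc m 2 +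
    bc m 2 * ac m 0 * ac m 2 * cc m 0 - ac m 0 ^ 2 * ac m 1 * ac m 2 -
    ac m 0 * ac m 1 ^ 2 * ac m 2 + 2 * ac m 0 * cc m 0 * cc m 1 + ac m 1 * cc m 0 * cc m 1 +
    ac m 1 * cc m 0 * cc m 2 + ac m 2 * cc m 0 ^ 2

/-- The coefficient of `x ^ 2` in `det 𝒢(x)`. -/
def coeffDet2 (m : Phase) : ℂ :=
  -bc m 0 * bc m 1 * ac m 0 * cc m 1 - 2 * bc m 0 * bc m 1 * ac m 2 * cc m 0 -
    2 * bc m 0 * bc m 2 * ac m 0 * cc m 1 - bc m 0 * bc m 2 * ac m 2 * cc m 0 +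
    bc m 0 * ac m 0 * ac m 1 * ac m 2 - bc m 0 * cc m 0 * cc m 1 - bc m 1 ^ 2 * ac m 2 * cc m 0 -
    2 * bc m 1 * bc m 2 * ac m 0 * cc m 1 - 2 * bc m 1 * bc m 2 * ac m 2 * cc m 0 +
    bc m 1 * ac m 0 * ac m 1 * ac m 2 - bc m 1 * cc m 0 * cc m 1 - 2 * bc m 1 * cc m 0 * cc m 2 -
    bc m 2 ^ 2 * ac m 0 * cc m 1 + bc m 2 * ac m 0 * ac m 1 * ac m 2 - bc m 2 * cc m 0 * cc m 1 -
    bc m 2 * cc m 0 * cc m 2 - ac m 0 ^ 2 * cc m 1 - ac m 0 * ac m 1 * cc m 1 +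
    ac m 0 * ac m 1 * cc m 2 - ac m 0 * ac m 2 * cc m 0 - ac m 1 * ac m 2 * cc m 0

/-- The coefficient of `x ^ 3` in `det 𝒢(x)`. -/
def coeffDet3 (m : Phase) : ℂ :=
  bc m 0 * ac m 0 * cc m 1 + bc m 0 * ac m 2 * cc m 0 + bc m 1 * ac m 0 * cc m 1 +
    2 * bc m 1 * ac m 2 * cc m 0 + 2 * bc m 2 * ac m 0 * cc m 1 + bc m 2 * ac m 2 * cc m 0 -
    ac m 0 * ac m 1 * ac m 2 + cc m 0 * cc m 1 + cc m 0 * cc m 2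


theorem det_calG (m : Phase) (x : ℂ) :
    (calG m x).det = g00 m x * g11 m x - g01 m x * g10 m x := by
  simp [calG_eq, det_fin_two]

theorem det_calG_eq_quartic (m : Phase) (x : ℂ) : (calG m x).det =
    lead m * x ^ 4 + coeffDet3 m * x ^ 3 + coeffDet2 m * x ^ 2 + coeffDet1 m * x + coeffDet0 m := by
  simp only [det_calG, g00, g01, g10, g11, lead, coeffDet0, coeffDet1, coeffDet2, coeffDet3]
  ring

/-- The derivative of `det 𝒢(x)` with respect to `x`. -/
def derivDet (m : Phase) (x : ℂ) : ℂ :=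
  g00x m x * g11 m x + g00 m x * g11x m x - g01x m x * g10 m x - g01 m x * g10x m x

theorem derivDet_eq (m : Phase) (x : ℂ) : derivDet m x =
    4 * lead m * x ^ 3 + 3 * coeffDet3 m * x ^ 2 + 2 * coeffDet2 m * x + coeffDet1 m := by
  simp only [derivDet, g00, g01, g10, g11, g00x, g01x, g10x, g11x, lead, coeffDet1, coeffDet2,
    coeffDet3]
  ring

/-- A double root together with three further roots is too much for degree four. The argument takes
successive divided differences. -/
theorem quartic_deriv_ne_zero {a b c d e r s t u : ℂ} (ha : a ≠ 0)
    (hr : a * r ^ 4 + b * r ^ 3 + c * r ^ 2 + d * r + e = 0)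
    (hs : a * s ^ 4 + b * s ^ 3 + c * s ^ 2 + d * s + e = 0)
    (ht : a * t ^ 4 + b * t ^ 3 + c * t ^ 2 + d * t + e = 0)
    (hu : a * u ^ 4 + b * u ^ 3 + c * u ^ 2 + d * u + e = 0)
    (hrs : s ≠ r) (hrt : t ≠ r) (hru : u ≠ r) (hst : s ≠ t) (hsu : s ≠ u) (htu : t ≠ u) :
    4 * a * r ^ 3 + 3 * b * r ^ 2 + 2 * c * r + d ≠ 0 := by
  intro h
  -- Dividing the quartic by `(X - r)²` leaves a quadratic that vanishes at the other roots.
  have key : ∀ s, s ≠ r → a * s ^ 4 + b * s ^ 3 + c * s ^ 2 + d * s + e = 0 →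
      a * (s ^ 2 + 2 * s * r + 3 * r ^ 2) + b * (s + 2 * r) + c = 0 := by
    intro s hs h'
    refine mul_left_cancel₀ (pow_ne_zero 2 (sub_ne_zero.2 hs)) ?_
    linear_combination h' - hr - (s - r) * h
  have key2 : ∀ s t, s ≠ t → s ≠ r → t ≠ r →
      a * s ^ 4 + b * s ^ 3 + c * s ^ 2 + d * s + e = 0 →
      a * t ^ 4 + b * t ^ 3 + c * t ^ 2 + d * t + e = 0 → a * (s + t + 2 * r) + b = 0 := by
    intro s t hst hs ht h1 h2
    refine mul_left_cancel₀ (sub_ne_zero.2 hst) ?_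
    linear_combination key s hs h1 - key t ht h2
  have h1 := key2 s t hst hrs hrt hs ht
  have h2 := key2 s u hsu hrs hru hs hu
  exact mul_ne_zero ha (sub_ne_zero.2 htu) (by linear_combination h1 - h2)

theorem derivDet_ne_zero {m : Phase} (hm : lead m ≠ 0) {z : Fin 4 → ℂ} (hz : Function.Injective z)
    (h0 : ∀ i, (calG m (z i)).det = 0) (i : Fin 4) : derivDet m (z i) ≠ 0 := by
  have h : ∀ i, _ := fun i => (det_calG_eq_quartic m (z i)).symm.trans (h0 i)
  have hne : ∀ i j, i ≠ j → z i ≠ z j := fun i j hij hh => hij (hz hh)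
  rw [derivDet_eq]
  fin_cases i
  · exact quartic_deriv_ne_zero hm (h 0) (h 1) (h 2) (h 3) (hne _ _ (by decide))
      (hne _ _ (by decide)) (hne _ _ (by decide)) (hne _ _ (by decide)) (hne _ _ (by decide))
      (hne _ _ (by decide))
  · exact quartic_deriv_ne_zero hm (h 1) (h 0) (h 2) (h 3) (hne _ _ (by decide))
      (hne _ _ (by decide)) (hne _ _ (by decide)) (hne _ _ (by decide)) (hne _ _ (by decide))
      (hne _ _ (by decide))
  · exact quartic_deriv_ne_zero hm (h 2) (h 0) (h 1) (h 3) (hne _ _ (by decide))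
      (hne _ _ (by decide)) (hne _ _ (by decide)) (hne _ _ (by decide)) (hne _ _ (by decide))
      (hne _ _ (by decide))
  · exact quartic_deriv_ne_zero hm (h 3) (h 0) (h 1) (h 2) (hne _ _ (by decide))
      (hne _ _ (by decide)) (hne _ _ (by decide)) (hne _ _ (by decide)) (hne _ _ (by decide))
      (hne _ _ (by decide))

/-! ### The reduced tensor -/

/-- The gradients of `H₀` and `K₀`. -/
def gradF (m : Phase) : Fin 2 → Phase := ![gradH0 m, gradK0 m]

theorem dF_eq (m : Phase) (j : Fin 2) : dF m j = covec (gradF m j) := by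
  fin_cases j
  · exact (hasFDerivAt_H0 m).fderiv
  · exact (hasFDerivAt_K0 m).fderiv

theorem redG_apply (m : Phase) (i j : Fin 2) : redG m i j = gradF m j ⬝ᵥ Z i := by
  simp [redG, dF_eq, covec_apply]

theorem bivP_gradF (m : Phase) (j : Fin 2) : bivP m *ᵥ gradF m j = 0 := by
  fin_cases j
  · exact bivP_gradH0 m
  · exact bivP_gradK0 m

/-- `P' dK₀` lies in the image of `P`, and `dH₀` annihilates that image; the other cases follow from
skewness. -/
theorem gradF_bivP'_gradF (m : Phase) (i j : Fin 2) :
    gradF m i ⬝ᵥ (bivP' m *ᵥ gradF m j) = 0 := by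
  have h : gradH0 m ⬝ᵥ (bivP' m *ᵥ gradK0 m) = 0 := by
    rw [bivP'_gradK0, bivP_skew, bivP_gradH0]; simp
  have hs : ∀ g : Phase, g ⬝ᵥ (bivP' m *ᵥ g) = 0 := fun g => self_eq_neg.1 (bivP'_skew m g g)
  fin_cases i <;> fin_cases j
  · exact hs _
  · exact h
  · change gradK0 m ⬝ᵥ (bivP' m *ᵥ gradH0 m) = 0
    rw [bivP'_skew, h, neg_zero]
  · exact hs _

theorem wedge_mulVec (Z X g : Phase) :
    wedge Z X *ᵥ g = (g ⬝ᵥ Z) • X - (g ⬝ᵥ X) • Z := by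
  simp [wedge, sub_mulVec, vecMulVec_mulVec, dotProduct_comm]

theorem bivQ_mulVec (m g : Phase) : bivQ m *ᵥ g = bivP' m *ᵥ g - ∑ i, ∑ j, (redG m)⁻¹ j i •
    ((g ⬝ᵥ Z i) • (bivP' m *ᵥ gradF m j) - (g ⬝ᵥ (bivP' m *ᵥ gradF m j)) • Z i) := by
  simp only [bivQ, sub_mulVec, Matrix.sum_mulVec, smul_mulVec, wedge_mulVec, dF_eq, sharp_covec]

theorem bivQ_skew (m g h : Phase) : g ⬝ᵥ (bivQ m *ᵥ h) = -(h ⬝ᵥ (bivQ m *ᵥ g)) := by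
  simp only [bivQ_mulVec, Fin.sum_univ_two, dotProduct_sub, dotProduct_add, dotProduct_smul,
    smul_eq_mul, bivP'_skew m g h]
  ring

/-- This is what the correction `Δ` is designed for: the factor `G⁻¹` makes it reproduce `P' dF_l`,
and its terms along `Z_i` vanish because `H₀`, `K₀` are in involution for `P'`. -/
theorem bivQ_gradF {m : Phase} (hm : lead m ≠ 0) (l : Fin 2) : bivQ m *ᵥ gradF m l = 0 := by
  have hG : (redG m)⁻¹ * redG m = 1 :=
    nonsing_inv_mul _ (isUnit_iff_ne_zero.2 (by rw [det_redG]; exact neg_ne_zero.2 hm))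
  have h : ∀ j, (redG m)⁻¹ j 0 * redG m 0 l + (redG m)⁻¹ j 1 * redG m 1 l
      = (1 : Matrix (Fin 2) (Fin 2) ℂ) j l := fun j => by
    rw [← hG, mul_apply, Fin.sum_univ_two]
  have h0 := h 0
  have h1 := h 1
  simp only [bivQ_mulVec, Fin.sum_univ_two, ← redG_apply, gradF_bivP'_gradF, zero_smul, sub_zero]
  ext s
  simp only [Pi.sub_apply, Pi.add_apply, Pi.smul_apply, smul_eq_mul, Pi.zero_apply]
  fin_cases l
  · simp [one_apply] at h0 h1 ⊢
    linear_combination -(bivP' m *ᵥ gradF m 0) s * h0 - (bivP' m *ᵥ gradF m 1) s * h1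
  · simp [one_apply] at h0 h1 ⊢
    linear_combination -(bivP' m *ᵥ gradF m 0) s * h0 - (bivP' m *ᵥ gradF m 1) s * h1

theorem bivQ_eq_zero {m g : Phase} (h0 : g ⬝ᵥ Z 0 = 0) (h1 : g ⬝ᵥ Z 1 = 0)
    (hg : bivP' m *ᵥ g = 0) : bivQ m *ᵥ g = 0 := by
  simp only [bivQ_mulVec, Fin.sum_univ_two, h0, h1, hg, bivP'_skew m g]
  simp

/-- On covectors annihilating both `Z_i`, the correction has values in the span of the `Z_i` only.
-/
theorem exists_bivQ_mulVec {m g : Phase} (h0 : g ⬝ᵥ Z 0 = 0) (h1 : g ⬝ᵥ Z 1 = 0) :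
    ∃ u v : ℂ, bivQ m *ᵥ g = bivP' m *ᵥ g + u • Z 0 + v • Z 1 := by
  refine ⟨(redG m)⁻¹ 0 0 * (g ⬝ᵥ (bivP' m *ᵥ gradF m 0))
    + (redG m)⁻¹ 1 0 * (g ⬝ᵥ (bivP' m *ᵥ gradF m 1)),
    (redG m)⁻¹ 0 1 * (g ⬝ᵥ (bivP' m *ᵥ gradF m 0))
    + (redG m)⁻¹ 1 1 * (g ⬝ᵥ (bivP' m *ᵥ gradF m 1)), ?_⟩
  simp only [bivQ_mulVec, Fin.sum_univ_two, h0, h1]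
  ext s
  simp only [Pi.sub_apply, Pi.add_apply, Pi.smul_apply, smul_eq_mul]
  ring

theorem bivQ_gradJ1 (m : Phase) : bivQ m *ᵥ gradJ1 m = 0 :=
  bivQ_eq_zero (by simp [dotProduct_Z_zero, gradJ1]) (by simp [dotProduct_Z_one, gradJ1])
    (bivP'_gradJ1 m)

theorem bivQ_gradJ2 (m : Phase) : bivQ m *ᵥ gradJ2 m = 0 :=
  bivQ_eq_zero (by simp [dotProduct_Z_zero, gradJ2]) (by simp [dotProduct_Z_one, gradJ2])
    (bivP'_gradJ2 m)

/-! ### The covectors `ρ d𝒢₁ₖ + d𝒢₂ₖ` -/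

/-- The gradient of `ρ 𝒢₁₁ + 𝒢₂₁` at fixed `x` and `ρ`. -/
def omega0 (m : Phase) (x r : ℂ) : Phase := r • gradG00 m x + gradG10 m x

/-- The gradient of `ρ 𝒢₁₂ + 𝒢₂₂` at fixed `x` and `ρ`. -/
def omega1 (m : Phase) (x r : ℂ) : Phase := r • gradG01 m x + gradG11 m x

theorem omega0_pencil {m : Phase} {x r : ℂ} (h0 : r * g00 m x + g10 m x = 0)
    (h1 : r * g01 m x + g11 m x = 0) : ∃ u v : ℂ,
    bivP' m *ᵥ omega0 m x r = x • (bivP m *ᵥ omega0 m x r) + u • Z 0 + v • Z 1 := by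
  -- The coefficients are read off from the `b₄`- and `a₄`-components, which then match trivially.
  -- The content lies in the other ten components.
  refine ⟨-bc (bivP' m *ᵥ omega0 m x r - x • (bivP m *ᵥ omega0 m x r)) 3,
    ac (bivP' m *ᵥ omega0 m x r - x • (bivP m *ᵥ omega0 m x r)) 3, ?_⟩
  simp only [bivP_mulVec, bivP'_mulVec, Z_zero, Z_one]
  simp only [g00, g01, g10, g11] at h0 h1
  refine phase_ext ?_ ?_ ?_ <;> intro i <;> fin_cases i <;>
    simp [omega0, gradG00, gradG10, vec, bc, ac, cc] at h0 h1 ⊢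
  · ring
  · ring
  · ring
  · ring
  · ring
  · linear_combination m (Sum.inr (Sum.inl 2)) * h0 - m (Sum.inr (Sum.inr 2)) * h1
  · ring
  · linear_combination m (Sum.inr (Sum.inr 1)) * h0
  · ring
  · linear_combination -m (Sum.inr (Sum.inr 3)) * h0

theorem omega1_pencil {m : Phase} {x r : ℂ} (h0 : r * g00 m x + g10 m x = 0)
    (h1 : r * g01 m x + g11 m x = 0) : ∃ u v : ℂ,
    bivP' m *ᵥ omega1 m x r = x • (bivP m *ᵥ omega1 m x r) + u • Z 0 + v • Z 1 := by
  refine ⟨-bc (bivP' m *ᵥ omega1 m x r - x • (bivP m *ᵥ omega1 m x r)) 3,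
    ac (bivP' m *ᵥ omega1 m x r - x • (bivP m *ᵥ omega1 m x r)) 3, ?_⟩
  simp only [bivP_mulVec, bivP'_mulVec, Z_zero, Z_one]
  simp only [g00, g01, g10, g11] at h0 h1
  refine phase_ext ?_ ?_ ?_ <;> intro i <;> fin_cases i <;>
    simp [omega1, gradG01, gradG11, vec, bc, ac, cc] at h0 h1 ⊢
  · linear_combination -h0 - (m (Sum.inl 0) - x) * h1
  · ring
  · ring
  · linear_combination -m (Sum.inr (Sum.inl 0)) * h1
  · ring
  · linear_combination m (Sum.inr (Sum.inl 2)) * h1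
  · linear_combination -m (Sum.inr (Sum.inr 0)) * h1
  · linear_combination m (Sum.inr (Sum.inr 1)) * h1
  · linear_combination m (Sum.inr (Sum.inr 2)) * h1
  · linear_combination -m (Sum.inr (Sum.inr 3)) * h1

/-- This is the source of `{μᵢ, λᵢ} = 1`: the bracket equals `ρ` times the derivative of `det 𝒢`,
modulo the two relations. -/
theorem omega0_bivP_omega1 {m : Phase} {x r : ℂ} (h0 : r * g00 m x + g10 m x = 0)
    (h1 : r * g01 m x + g11 m x = 0) :
    omega0 m x r ⬝ᵥ (bivP m *ᵥ omega1 m x r) = r * derivDet m x := by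
  simp only [bivP_mulVec, dotProduct_phase, derivDet, g00x, g01x, g10x, g11x, g00, g01, g10,
    g11] at h0 h1 ⊢
  simp [omega0, omega1, gradG00, gradG01, gradG10, gradG11, vec, bc, ac, cc] at h0 h1 ⊢
  linear_combination
    (-m (Sum.inl 1) * r - m (Sum.inl 2) * r + m (Sum.inr (Sum.inl 0)) * m (Sum.inr (Sum.inr 1))
      + m (Sum.inr (Sum.inl 2)) * m (Sum.inr (Sum.inr 0)) + 2 * x * r) * h0
    + (-m (Sum.inl 0) * m (Sum.inl 1) * r - m (Sum.inl 0) * m (Sum.inl 2) * r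
      + 2 * m (Sum.inl 0) * x * r + m (Sum.inl 1) * x * r + m (Sum.inl 2) * x * r
      - m (Sum.inr (Sum.inl 0)) * r - m (Sum.inr (Sum.inr 0)) * m (Sum.inr (Sum.inr 2))
      - 2 * x ^ 2 * r) * h1

/-- The defect `Q g - x P g` is a combination of `Z₁`, `Z₂`. Pairing with `dH₀` and `dK₀`, which
annihilate the images of `P` and `Q`, gives a homogeneous linear system for its coefficients whose
matrix is the transpose of `G`. -/
theorem mulVec_eq_smul_of_pencil {m g : Phase} {x u v : ℂ} (hm : lead m ≠ 0) (h0 : g ⬝ᵥ Z 0 = 0)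
    (h1 : g ⬝ᵥ Z 1 = 0) (hg : bivP' m *ᵥ g = x • (bivP m *ᵥ g) + u • Z 0 + v • Z 1) :
    bivQ m *ᵥ g = x • (bivP m *ᵥ g) := by
  obtain ⟨u', v', h⟩ := exists_bivQ_mulVec h0 h1
  have hQ : bivQ m *ᵥ g = x • (bivP m *ᵥ g) + (u + u') • Z 0 + (v + v') • Z 1 := by
    rw [h, hg]; module
  have hF : ∀ l, (u + u') * (gradF m l ⬝ᵥ Z 0) + (v + v') * (gradF m l ⬝ᵥ Z 1) = 0 := by
    intro l
    have h2 : gradF m l ⬝ᵥ (bivQ m *ᵥ g) = 0 := by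
      rw [bivQ_skew, bivQ_gradF hm]; simp
    have h3 : gradF m l ⬝ᵥ (bivP m *ᵥ g) = 0 := by
      rw [bivP_skew, bivP_gradF]; simp
    rw [hQ] at h2
    simpa [dotProduct_add, h3] using h2
  have hF0 := hF 0
  have hF1 := hF 1
  simp only [← redG_apply, redG_eq] at hF0 hF1
  simp at hF0 hF1
  have hu : u + u' = 0 := by linear_combination -hF0
  rw [hu] at hF1 hQ
  have hv : v + v' = 0 := by simpa [hm] using hF1
  rw [hQ, hv]
  simp

theorem bivQ_omega0 {m : Phase} {x r : ℂ} (hm : lead m ≠ 0) (h0 : r * g00 m x + g10 m x = 0)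
    (h1 : r * g01 m x + g11 m x = 0) :
    bivQ m *ᵥ omega0 m x r = x • (bivP m *ᵥ omega0 m x r) := by
  obtain ⟨u, v, h⟩ := omega0_pencil h0 h1
  exact mulVec_eq_smul_of_pencil hm
    (by simp [dotProduct_Z_zero, omega0, gradG00, gradG10, vec, bc])
    (by simp [dotProduct_Z_one, omega0, gradG00, gradG10, vec, ac]) h

theorem bivQ_omega1 {m : Phase} {x r : ℂ} (hm : lead m ≠ 0) (h0 : r * g00 m x + g10 m x = 0)
    (h1 : r * g01 m x + g11 m x = 0) :
    bivQ m *ᵥ omega1 m x r = x • (bivP m *ᵥ omega1 m x r) := by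
  obtain ⟨u, v, h⟩ := omega1_pencil h0 h1
  exact mulVec_eq_smul_of_pencil hm
    (by simp [dotProduct_Z_zero, omega1, gradG01, gradG11, vec, bc])
    (by simp [dotProduct_Z_one, omega1, gradG01, gradG11, vec, ac]) h

/-- Here `gl` and `gm` play the roles of `dλᵢ` and `dμᵢ`. The hypotheses `hw0`, `hw1` are a linear
system for them with right-hand sides `ω_1`, `ω_2`, so the eigenvector equations transfer by
Cramer's rule and the bracket scales by the determinant. -/
theorem canonical_of_omega {m gl gm : Phase} {x r : ℂ} (hm : lead m ≠ 0) (hr : r ≠ 0)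
    (hd : derivDet m x ≠ 0)
    (h0 : r * g00 m x + g10 m x = 0) (h1 : r * g01 m x + g11 m x = 0)
    (hw0 : omega0 m x r + (r * g00x m x + g10x m x) • gl + (r * g00 m x) • gm = 0)
    (hw1 : omega1 m x r + (r * g01x m x + g11x m x) • gl + (r * g01 m x) • gm = 0) :
    bivQ m *ᵥ gl = x • (bivP m *ᵥ gl) ∧ bivQ m *ᵥ gm = x • (bivP m *ᵥ gm) ∧
      gm ⬝ᵥ (bivP m *ᵥ gl) = 1 := by
  set D0 := r * g00x m x + g10x m x with hD0
  set D1 := r * g01x m x + g11x m x with hD1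
  -- The relations replace `r 𝒢₁ₖ` by `-𝒢₂ₖ`, which turns the determinant of the system, up to the
  -- factor `-r`, into the derivative of `det 𝒢`.
  have hdet : g00 m x * D1 - g01 m x * D0 = derivDet m x := by
    rw [hD0, hD1, derivDet]
    linear_combination -g00x m x * h1 + g01x m x * h0
  have e0 : omega0 m x r = -(D0 • gl) - (r * g00 m x) • gm := by
    linear_combination hw0
  have e1 : omega1 m x r = -(D1 • gl) - (r * g01 m x) • gm := by
    linear_combination hw1
  have q0 := bivQ_omega0 hm h0 h1
  have q1 := bivQ_omega1 hm h0 h1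
  have hp := omega0_bivP_omega1 h0 h1
  rw [e0] at q0 hp
  rw [e1] at q1 hp
  simp only [mulVec_sub, mulVec_neg, mulVec_smul] at q0 q1 hp
  have hrd : r * derivDet m x ≠ 0 := mul_ne_zero hr hd
  refine ⟨?_, ?_, ?_⟩
  · ext s
    have a0 := congrFun q0 s
    have a1 := congrFun q1 s
    simp only [Pi.sub_apply, Pi.neg_apply, Pi.smul_apply, smul_eq_mul] at a0 a1 ⊢
    -- Eliminating `gm` from the two equations leaves `gl` multiplied by `r * derivDet m x`.
    refine mul_left_cancel₀ hrd ?_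
    rw [← hdet]
    linear_combination -(r * g00 m x) * a1 + (r * g01 m x) * a0
  · ext s
    have a0 := congrFun q0 s
    have a1 := congrFun q1 s
    simp only [Pi.sub_apply, Pi.neg_apply, Pi.smul_apply, smul_eq_mul] at a0 a1 ⊢
    refine mul_left_cancel₀ hrd ?_
    rw [← hdet]
    linear_combination D0 * a1 - D1 * a0
  · have s0 : ∀ g : Phase, g ⬝ᵥ (bivP m *ᵥ g) = 0 := fun g => self_eq_neg.1 (bivP_skew m g g)
    simp only [sub_dotProduct, neg_dotProduct, smul_dotProduct, dotProduct_sub, dotProduct_neg,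
      dotProduct_smul, smul_eq_mul, s0, bivP_skew m gl gm] at hp
    refine mul_left_cancel₀ hrd ?_
    linear_combination hp - r * (gm ⬝ᵥ (bivP m *ᵥ gl)) * hdet

/-! ### Consequences on the domain of the branches -/

theorem IsBranch.rel1 {V : Set Phase} {lam mu : Fin 4 → Phase → ℂ} (h : IsBranch V lam mu)
    {m : Phase} (hm : m ∈ V) (i : Fin 4) :
    Complex.exp (mu i m) * g01 m (lam i m) + g11 m (lam i m) = 0 := by
  have h1 := h.denom_ne m hm i
  have h2 := h.exp_mu m hm i
  simp only [rho, calG_eq] at h1 h2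
  simp at h1 h2
  rw [h2]
  field_simp
  ring

/-- The vanishing of `det 𝒢` makes the rows proportional, so the factor `ρ` defined by the second
column also works for the first. -/
theorem IsBranch.rel0 {V : Set Phase} {lam mu : Fin 4 → Phase → ℂ} (h : IsBranch V lam mu)
    {m : Phase} (hm : m ∈ V) (i : Fin 4) :
    Complex.exp (mu i m) * g00 m (lam i m) + g10 m (lam i m) = 0 := by
  have h1 := h.denom_ne m hm i
  have h2 := h.root m hm i
  rw [det_calG] at h2
  simp [calG_eq] at h1
  refine mul_left_cancel₀ h1 ?_
  linear_combination g00 m (lam i m) * h.rel1 hm i - h2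

/-! ### Gradients, tangent spaces of the leaves, involution -/

/-- The vector of partial derivatives of `f` at `m`. -/
def grad (f : Phase → ℂ) (m : Phase) : Phase := fun t => fderiv ℂ f m (Pi.single t 1)

theorem covec_grad (f : Phase → ℂ) (m : Phase) : covec (grad f m) = fderiv ℂ f m :=
  (eq_covec _).symm

theorem fderiv_apply (f : Phase → ℂ) (m v : Phase) : fderiv ℂ f m v = grad f m ⬝ᵥ v := by
  rw [← covec_grad, covec_apply]

theorem sharp_fderiv (B : Matrix Idx Idx ℂ) (f : Phase → ℂ) (m : Phase) :
    sharp B (fderiv ℂ f m) = B *ᵥ grad f m := rfl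

theorem bracket_eq (B : Phase → Matrix Idx Idx ℂ) (f g : Phase → ℂ) (m : Phase) :
    bracket B f g m = grad f m ⬝ᵥ (B m *ᵥ grad g m) := by
  rw [bracket, sharp_fderiv, fderiv_apply]

theorem covec_injective {g h : Phase} (hgh : covec g = covec h) : g = h := by
  ext t
  rw [← covec_single g, hgh, covec_single]

theorem grad_eq {f : Phase → ℂ} {m g : Phase} (h : HasFDerivAt f (covec g) m) : grad f m = g :=
  covec_injective (by rw [covec_grad, h.fderiv])

/-- The gradients of the Casimirs. -/
def gradC (m : Phase) : Fin 4 → Phase := ![gradH0 m, gradK0 m, gradJ1 m, gradJ2 m]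

/-- The gradients of the Hamiltonians. -/
def gradHam (m : Phase) : Fin 4 → Phase := ![gradH1 m, gradH2 m, gradH3 m, gradK1 m]

theorem hasFDerivAt_casimirs_apply (m : Phase) (i : Fin 4) :
    HasFDerivAt (fun x => casimirs x i) (covec (gradC m i)) m := by
  fin_cases i
  exacts [hasFDerivAt_H0 m, hasFDerivAt_K0 m, hasFDerivAt_J1 m, hasFDerivAt_J2 m]

theorem hasFDerivAt_hams_apply (m : Phase) (i : Fin 4) :
    HasFDerivAt (fun x => hams x i) (covec (gradHam m i)) m := by
  fin_cases i
  exacts [hasFDerivAt_H1 m, hasFDerivAt_H2 m, hasFDerivAt_H3 m, hasFDerivAt_K1 m]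

theorem hasFDerivAt_casimirs (m : Phase) : HasFDerivAt casimirs
    (ContinuousLinearMap.pi fun i => covec (gradC m i)) m :=
  hasFDerivAt_pi.2 fun i => hasFDerivAt_casimirs_apply m i

theorem fderiv_casimirs (m v : Phase) : fderiv ℂ casimirs m v = fun i => gradC m i ⬝ᵥ v := by
  rw [(hasFDerivAt_casimirs m).fderiv]
  ext i
  simp [covec_apply]

theorem mem_leafTangent {m v : Phase} : v ∈ leafTangent m ↔ ∀ i, gradC m i ⬝ᵥ v = 0 := by
  rw [leafTangent, LinearMap.mem_ker, ContinuousLinearMap.coe_coe, fderiv_casimirs, funext_iff]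
  rfl

theorem bivP_gradC (m : Phase) (i : Fin 4) : bivP m *ᵥ gradC m i = 0 := by
  fin_cases i
  exacts [bivP_gradH0 m, bivP_gradK0 m, bivP_gradJ1 m, bivP_gradJ2 m]

theorem bivQ_gradC {m : Phase} (hm : lead m ≠ 0) (i : Fin 4) : bivQ m *ᵥ gradC m i = 0 := by
  fin_cases i
  exacts [bivQ_gradF hm 0, bivQ_gradF hm 1, bivQ_gradJ1 m, bivQ_gradJ2 m]

theorem bivP_mem_leafTangent (m g : Phase) : bivP m *ᵥ g ∈ leafTangent m :=
  mem_leafTangent.2 fun i => by rw [bivP_skew, bivP_gradC]; simp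

theorem bivQ_mem_leafTangent {m : Phase} (hm : lead m ≠ 0) (g : Phase) :
    bivQ m *ᵥ g ∈ leafTangent m :=
  mem_leafTangent.2 fun i => by rw [bivQ_skew, bivQ_gradC hm]; simp

/-- Moving along the chains trades `P` for `P'` and shifts an index. Brackets within the `H` chain
reduce to `g · P g` or `g · P' g`, and brackets with `K₁` reduce to `P' dK₁ = 0`. -/
theorem involution (m : Phase) (i j : Fin 4) :
    gradHam m i ⬝ᵥ (bivP m *ᵥ gradHam m j) = 0 := by
  have s : ∀ g : Phase, g ⬝ᵥ (bivP m *ᵥ g) = 0 := fun g => self_eq_neg.1 (bivP_skew m g g)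
  have s' : ∀ g : Phase, g ⬝ᵥ (bivP' m *ᵥ g) = 0 := fun g => self_eq_neg.1 (bivP'_skew m g g)
  have h2 : bivP m *ᵥ gradH2 m = -(bivP' m *ᵥ gradH1 m) := by rw [bivP'_gradH1, neg_neg]
  have h3 : bivP m *ᵥ gradH3 m = -(bivP' m *ᵥ gradH2 m) := by rw [bivP'_gradH2, neg_neg]
  have h12 : gradH1 m ⬝ᵥ (bivP m *ᵥ gradH2 m) = 0 := by simp [h2, s']
  have h23 : gradH2 m ⬝ᵥ (bivP m *ᵥ gradH3 m) = 0 := by simp [h3, s']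
  have h13 : gradH1 m ⬝ᵥ (bivP m *ᵥ gradH3 m) = 0 := by
    rw [h3, dotProduct_neg, bivP'_skew, bivP'_gradH1]; simp [s]
  have hK3 : gradK1 m ⬝ᵥ (bivP m *ᵥ gradH3 m) = 0 := by
    rw [h3, dotProduct_neg, bivP'_skew, bivP'_gradK1]; simp
  have hK2 : gradK1 m ⬝ᵥ (bivP m *ᵥ gradH2 m) = 0 := by
    rw [h2, dotProduct_neg, bivP'_skew, bivP'_gradK1]; simp
  have hK1 : gradK1 m ⬝ᵥ (bivP m *ᵥ gradH1 m) = 0 := by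
    have h1 : bivP m *ᵥ gradH1 m = -(bivP' m *ᵥ gradH0 m) := by rw [bivP'_gradH0, neg_neg]
    rw [h1, dotProduct_neg, bivP'_skew, bivP'_gradK1]; simp
  fin_cases i <;> fin_cases j
  · exact s _
  · exact h12
  · exact h13
  · exact (bivP_skew _ _ _).trans (neg_eq_zero.2 hK1)
  · exact (bivP_skew _ _ _).trans (neg_eq_zero.2 h12)
  · exact s _
  · exact h23
  · exact (bivP_skew _ _ _).trans (neg_eq_zero.2 hK2)
  · exact (bivP_skew _ _ _).trans (neg_eq_zero.2 h13)
  · exact (bivP_skew _ _ _).trans (neg_eq_zero.2 h23)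
  · exact s _
  · exact (bivP_skew _ _ _).trans (neg_eq_zero.2 hK3)
  · exact hK1
  · exact hK2
  · exact hK3
  · exact s _

/-! ### Differentials of the branches -/

theorem IsBranch.hasFDerivAt_lam {V : Set Phase} {lam mu : Fin 4 → Phase → ℂ}
    (h : IsBranch V lam mu) {m : Phase} (hm : m ∈ V) (i : Fin 4) :
    HasFDerivAt (lam i) (covec (grad (lam i) m)) m := by
  rw [covec_grad]
  exact ((h.lam_holo i).differentiableAt (h.isOpen.mem_nhds hm)).hasFDerivAt

theorem IsBranch.hasFDerivAt_mu {V : Set Phase} {lam mu : Fin 4 → Phase → ℂ}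
    (h : IsBranch V lam mu) {m : Phase} (hm : m ∈ V) (i : Fin 4) :
    HasFDerivAt (mu i) (covec (grad (mu i) m)) m := by
  rw [covec_grad]
  exact ((h.mu_holo i).differentiableAt (h.isOpen.mem_nhds hm)).hasFDerivAt

theorem HasFDerivAt.eq_zero_of_eqOn {V : Set Phase} (hV : IsOpen V) {m : Phase} (hm : m ∈ V)
    {f : Phase → ℂ} {f' : Phase →L[ℂ] ℂ} (hf : HasFDerivAt f f' m) (h0 : ∀ p ∈ V, f p = 0) :
    f' = 0 :=
  hf.unique ((hasFDerivAt_const (0 : ℂ) m).congr_of_eventuallyEq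
    (Filter.eventuallyEq_of_mem (hV.mem_nhds hm) h0))

theorem IsBranch.omega0_eq {V : Set Phase} {lam mu : Fin 4 → Phase → ℂ}
    (h : IsBranch V lam mu) {m : Phase} (hm : m ∈ V) (i : Fin 4) :
    omega0 m (lam i m) (Complex.exp (mu i m))
      + (Complex.exp (mu i m) * g00x m (lam i m) + g10x m (lam i m)) • grad (lam i) m
      + (Complex.exp (mu i m) * g00 m (lam i m)) • grad (mu i) m = 0 := by
  have hl := h.hasFDerivAt_lam hm i
  have := HasFDerivAt.eq_zero_of_eqOn h.isOpen hm
    (((h.hasFDerivAt_mu hm i).cexp.mul (hasFDerivAt_g00 hl)).add (hasFDerivAt_g10 hl))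
    (fun p hp => h.rel0 hp i)
  refine covec_injective ?_
  rw [show covec (0 : Phase) = 0 by ext v; simp [covec_apply], ← this]
  ext v
  simp [covec_apply, omega0, add_dotProduct]
  ring

theorem IsBranch.omega1_eq {V : Set Phase} {lam mu : Fin 4 → Phase → ℂ}
    (h : IsBranch V lam mu) {m : Phase} (hm : m ∈ V) (i : Fin 4) :
    omega1 m (lam i m) (Complex.exp (mu i m))
      + (Complex.exp (mu i m) * g01x m (lam i m) + g11x m (lam i m)) • grad (lam i) m
      + (Complex.exp (mu i m) * g01 m (lam i m)) • grad (mu i) m = 0 := by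
  have hl := h.hasFDerivAt_lam hm i
  have := HasFDerivAt.eq_zero_of_eqOn h.isOpen hm
    (((h.hasFDerivAt_mu hm i).cexp.mul (hasFDerivAt_g01 hl)).add (hasFDerivAt_g11 hl))
    (fun p hp => h.rel1 hp i)
  refine covec_injective ?_
  rw [show covec (0 : Phase) = 0 by ext v; simp [covec_apply], ← this]
  ext v
  simp [covec_apply, omega1, add_dotProduct]
  ring

theorem IsBranch.canonical {V : Set Phase} {lam mu : Fin 4 → Phase → ℂ} (h : IsBranch V lam mu)
    {m : Phase} (hm : m ∈ V) (hl : lead m ≠ 0) (i : Fin 4) :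
    bivQ m *ᵥ grad (lam i) m = lam i m • (bivP m *ᵥ grad (lam i) m) ∧
    bivQ m *ᵥ grad (mu i) m = lam i m • (bivP m *ᵥ grad (mu i) m) ∧
      grad (mu i) m ⬝ᵥ (bivP m *ᵥ grad (lam i) m) = 1 :=
  canonical_of_omega hl (Complex.exp_ne_zero _)
    (derivDet_ne_zero hl (h.distinct m hm) (h.root m hm) i) (h.rel0 hm i) (h.rel1 hm i)
    (h.omega0_eq hm i) (h.omega1_eq hm i)

/-- Eigencovectors of the pencil for distinct eigenvalues are in involution. -/
theorem dotProduct_eq_zero_of_eigen {m g h : Phase} {x y : ℂ} (hxy : x ≠ y)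
    (hg : bivQ m *ᵥ g = x • (bivP m *ᵥ g)) (hh : bivQ m *ᵥ h = y • (bivP m *ᵥ h)) :
    g ⬝ᵥ (bivP m *ᵥ h) = 0 := by
  have h1 := bivQ_skew m g h
  rw [hg, hh, dotProduct_smul, dotProduct_smul, smul_eq_mul, smul_eq_mul, bivP_skew m h g] at h1
  refine mul_left_cancel₀ (sub_ne_zero.2 hxy) ?_
  linear_combination -h1

/-- If the joint evaluation map were not onto, a nonzero functional would kill its range, and the
coefficients of that functional would be a linear relation among the covectors. -/
theorem surjective_of_linearIndependent {ι : Type*} [Fintype ι] {g : ι → Phase}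
    (hg : LinearIndependent ℂ fun i => covec (g i)) (w : ι → ℂ) :
    ∃ v : Phase, ∀ i, g i ⬝ᵥ v = w i := by
  classical
  by_contra hw
  let T : Phase →ₗ[ℂ] (ι → ℂ) := LinearMap.pi fun i => (covec (g i) : Phase →ₗ[ℂ] ℂ)
  have hT : LinearMap.range T < ⊤ := by
    rw [lt_top_iff_ne_top]
    intro htop
    obtain ⟨v, hv⟩ := LinearMap.range_eq_top.1 htop w
    exact hw ⟨v, fun i => by rw [← hv]; simp [T, covec_apply]⟩
  obtain ⟨f, hf, hle⟩ := Submodule.exists_le_ker_of_lt_top _ hT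
  refine hf (LinearMap.pi_ext' fun i => ?_)
  have := Fintype.linearIndependent_iff.1 hg (fun i => f (Pi.single i 1)) (by
    ext v
    have h1 : f (T v) = 0 := hle (LinearMap.mem_range_self T v)
    rw [LinearMap.pi_apply_eq_sum_univ f] at h1
    simp only [T, LinearMap.pi_apply, smul_eq_mul] at h1
    simp only [_root_.sum_apply, _root_.smul_apply, smul_eq_mul,
      _root_.zero_apply]
    rw [← h1]
    refine Finset.sum_congr rfl fun i _ => ?_
    rw [mul_comm]
    congr 2
    ext j; simp [Pi.single_apply, eq_comm]) i
  ext
  simpa using this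

theorem mem_regularSet_iff {m : Phase} : m ∈ regularSet ↔ lead m ≠ 0 ∧
    (∃ z : Fin 4 → ℂ, Function.Injective z ∧
      ∀ i, (calG m (z i)).det = 0 ∧ calG m (z i) 0 1 ≠ 0 ∧ calG m (z i) 1 1 ≠ 0) ∧
    LinearIndependent ℂ fun i => covec (Sum.elim (gradC m) (gradHam m) i) := by
  have : (fun i => covec (Sum.elim (gradC m) (gradHam m) i)) =
      Sum.elim (fun i : Fin 4 => fderiv ℂ (fun x => casimirs x i) m)
        (fun i : Fin 4 => fderiv ℂ (fun x => hams x i) m) := by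
    ext1 i
    rcases i with i | i
    · exact (hasFDerivAt_casimirs_apply m i).fderiv.symm
    · exact (hasFDerivAt_hams_apply m i).fderiv.symm
  rw [regularSet, Set.mem_ofPred_eq, det_redG, neg_ne_zero, this]

theorem surjective_fderiv_casimirs {m : Phase} (hm : LinearIndependent ℂ fun i => covec (gradC m i)) :
    Function.Surjective (fderiv ℂ casimirs m) := fun w => by
  obtain ⟨v, hv⟩ := surjective_of_linearIndependent hm w
  exact ⟨v, by rw [fderiv_casimirs]; exact funext hv⟩

theorem linearIndependent_gradC {m : Phase} (hm : m ∈ regularSet) :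
    LinearIndependent ℂ fun i => covec (gradC m i) :=
  (mem_regularSet_iff.1 hm).2.2.comp Sum.inl Sum.inl_injective

theorem finrank_leafTangent {m : Phase} (hm : Function.Surjective (fderiv ℂ casimirs m)) :
    Module.finrank ℂ (leafTangent m) = 8 := by
  have h := LinearMap.finrank_range_add_finrank_ker (fderiv ℂ casimirs m : Phase →ₗ[ℂ] (Fin 4 → ℂ))
  rw [LinearMap.range_eq_top.2 hm, finrank_top] at h
  simp at h
  rw [leafTangent]
  omega

/-! ### Darboux-Nijenhuis property -/

theorem IsBranch.lam_lam {V : Set Phase} {lam mu : Fin 4 → Phase → ℂ} (h : IsBranch V lam mu)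
    {m : Phase} (hm : m ∈ V) (hl : lead m ≠ 0) (i j : Fin 4) :
    grad (lam i) m ⬝ᵥ (bivP m *ᵥ grad (lam j) m) = 0 := by
  rcases eq_or_ne i j with rfl | hij
  · exact self_eq_neg.1 (bivP_skew m _ _)
  · exact dotProduct_eq_zero_of_eigen (fun e => hij (h.distinct m hm e))
      (h.canonical hm hl i).1 (h.canonical hm hl j).1

theorem IsBranch.mu_mu {V : Set Phase} {lam mu : Fin 4 → Phase → ℂ} (h : IsBranch V lam mu)
    {m : Phase} (hm : m ∈ V) (hl : lead m ≠ 0) (i j : Fin 4) :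
    grad (mu i) m ⬝ᵥ (bivP m *ᵥ grad (mu j) m) = 0 := by
  rcases eq_or_ne i j with rfl | hij
  · exact self_eq_neg.1 (bivP_skew m _ _)
  · exact dotProduct_eq_zero_of_eigen (fun e => hij (h.distinct m hm e))
      (h.canonical hm hl i).2.1 (h.canonical hm hl j).2.1

theorem IsBranch.mu_lam {V : Set Phase} {lam mu : Fin 4 → Phase → ℂ} (h : IsBranch V lam mu)
    {m : Phase} (hm : m ∈ V) (hl : lead m ≠ 0) (i j : Fin 4) :
    grad (mu i) m ⬝ᵥ (bivP m *ᵥ grad (lam j) m) = if i = j then 1 else 0 := by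
  rcases eq_or_ne i j with rfl | hij
  · simp [(h.canonical hm hl i).2.2]
  · rw [if_neg hij]
    exact dotProduct_eq_zero_of_eigen (fun e => hij (h.distinct m hm e))
      (h.canonical hm hl i).2.1 (h.canonical hm hl j).1

theorem IsBranch.lam_mu {V : Set Phase} {lam mu : Fin 4 → Phase → ℂ} (h : IsBranch V lam mu)
    {m : Phase} (hm : m ∈ V) (hl : lead m ≠ 0) (i j : Fin 4) :
    grad (lam i) m ⬝ᵥ (bivP m *ᵥ grad (mu j) m) = if i = j then -1 else 0 := by
  rw [bivP_skew, h.mu_lam hm hl]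
  rcases eq_or_ne i j with rfl | hij
  · simp
  · simp [hij, hij.symm]

/-- The differentials of the coordinates, restricted to the tangent space of the leaf. -/
def coordMap (lam mu : Fin 4 → Phase → ℂ) (m : Phase) :
    leafTangent m →ₗ[ℂ] (Fin 4 ⊕ Fin 4 → ℂ) :=
  LinearMap.pi fun s => (covec (grad (Sum.elim lam mu s) m) : Phase →ₗ[ℂ] ℂ).domRestrict _

theorem coordMap_apply (lam mu : Fin 4 → Phase → ℂ) (m : Phase) (v : leafTangent m)
    (s : Fin 4 ⊕ Fin 4) : coordMap lam mu m v s = grad (Sum.elim lam mu s) m ⬝ᵥ (v : Phase) := by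
  simp [coordMap, covec_apply]

/-- The covector whose image under `P` has prescribed components. -/
def coordInv (lam mu : Fin 4 → Phase → ℂ) (m : Phase) (w : Fin 4 ⊕ Fin 4 → ℂ) : Phase :=
  ∑ j, (w (Sum.inr j) • grad (lam j) m - w (Sum.inl j) • grad (mu j) m)

theorem IsBranch.coordMap_coordInv {V : Set Phase} {lam mu : Fin 4 → Phase → ℂ}
    (h : IsBranch V lam mu) {m : Phase} (hm : m ∈ V) (hl : lead m ≠ 0) (w : Fin 4 ⊕ Fin 4 → ℂ) :
    coordMap lam mu m ⟨bivP m *ᵥ coordInv lam mu m w, bivP_mem_leafTangent m _⟩ = w := by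
  ext s
  rw [coordMap_apply]
  simp only [coordInv, mulVec_sum, mulVec_sub, mulVec_smul, dotProduct_sum, dotProduct_sub,
    dotProduct_smul, smul_eq_mul]
  rcases s with i | i
  · simp [h.lam_lam hm hl, h.lam_mu hm hl]
  · simp [h.mu_lam hm hl, h.mu_mu hm hl]

/-- The canonical brackets give surjectivity through `coordInv`; injectivity follows because both
sides have dimension 8. -/
theorem IsBranch.coordMap_bijective {V : Set Phase} {lam mu : Fin 4 → Phase → ℂ}
    (h : IsBranch V lam mu) {m : Phase} (hm : m ∈ V) (hr : m ∈ regularSet) :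
    Function.Bijective (coordMap lam mu m) := by
  have hl := (mem_regularSet_iff.1 hr).1
  have hs : Function.Surjective (coordMap lam mu m) := fun w =>
    ⟨_, h.coordMap_coordInv hm hl w⟩
  refine ⟨(LinearMap.injective_iff_surjective_of_finrank_eq_finrank ?_).2 hs, hs⟩
  rw [finrank_leafTangent (surjective_fderiv_casimirs (linearIndependent_gradC hr))]
  simp

/-- A tangent vector has the same coordinates as the `P`-image of the covector `coordInv` built from
them, and is therefore equal to it. -/
theorem IsBranch.isSymplecticAt {V : Set Phase} {lam mu : Fin 4 → Phase → ℂ}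
    (h : IsBranch V lam mu) {m : Phase} (hm : m ∈ V) (hr : m ∈ regularSet) : IsSymplecticAt m := by
  have hl := (mem_regularSet_iff.1 hr).1
  refine ⟨surjective_fderiv_casimirs (linearIndependent_gradC hr), ?_⟩
  ext v
  constructor
  · rintro ⟨α, rfl⟩
    exact bivP_mem_leafTangent m _
  · intro hv
    refine ⟨covec (coordInv lam mu m (coordMap lam mu m ⟨v, hv⟩)), ?_⟩
    rw [sharp_covec]
    exact congrArg Subtype.val
      ((h.coordMap_bijective hm hr).1 (h.coordMap_coordInv hm hl (coordMap lam mu m ⟨v, hv⟩)))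

theorem sum_elim_apply_eq (lam mu : Fin 4 → Phase → ℂ) (m : Phase) (v : leafTangent m) :
    (Sum.elim (fun i => fderiv ℂ (lam i) m v) (fun i => fderiv ℂ (mu i) m v) : Fin 4 ⊕ Fin 4 → ℂ)
      = coordMap lam mu m v := by
  ext s
  rw [coordMap_apply]
  rcases s with i | i <;> simp [fderiv_apply]

theorem IsBranch.isDarbouxNijenhuisAt {V : Set Phase} {lam mu : Fin 4 → Phase → ℂ}
    (h : IsBranch V lam mu) {m : Phase} (hm : m ∈ V) (hr : m ∈ regularSet) :
    IsDarbouxNijenhuisAt lam mu m := by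
  have hl := (mem_regularSet_iff.1 hr).1
  have hb := h.coordMap_bijective hm hr
  refine ⟨?_, ?_, ?_, ?_, ?_⟩
  · simp_rw [sum_elim_apply_eq]
    exact hb
  · intro i j
    rw [bracket_eq, h.mu_lam hm hl]
  · intro i j
    rw [bracket_eq, h.lam_lam hm hl]
  · intro i j
    rw [bracket_eq, h.mu_mu hm hl]
  let e := LinearEquiv.ofBijective (coordMap lam mu m) hb
  let S : (Fin 4 ⊕ Fin 4 → ℂ) →ₗ[ℂ] (Fin 4 ⊕ Fin 4 → ℂ) :=
    LinearMap.pi fun s => Sum.elim (fun i => lam i m) (fun i => lam i m) s • LinearMap.proj s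
  let N : leafTangent m →ₗ[ℂ] leafTangent m := e.symm.toLinearMap ∘ₗ S ∘ₗ coordMap lam mu m
  have hN : ∀ v, coordMap lam mu m (N v) = S (coordMap lam mu m v) := fun v =>
    e.apply_symm_apply _
  refine ⟨N, ?_, ?_⟩
  · intro α v hv
    rw [eq_covec α, sharp_covec] at hv ⊢
    set a : Phase := fun t => α (Pi.single t 1)
    -- Both sides are tangent vectors, so comparing coordinates is enough. By skewness `Q` and `P`
    -- move onto `dλᵢ` or `dμᵢ`, where they differ by the factor `λᵢ`.
    have : N v = ⟨bivQ m *ᵥ a, bivQ_mem_leafTangent hl a⟩ := by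
      refine hb.1 ?_
      rw [hN]
      ext s
      simp only [S, LinearMap.pi_apply, LinearMap.smul_apply, LinearMap.proj_apply, coordMap_apply,
        ← hv, smul_eq_mul]
      rcases s with i | i
      · simp only [Sum.elim_inl]
        rw [bivQ_skew, (h.canonical hm hl i).1, bivP_skew]
        simp
      · simp only [Sum.elim_inr]
        rw [bivQ_skew, (h.canonical hm hl i).2.1, bivP_skew]
        simp
    rw [this]
  · intro i v
    have h1 := congrFun (hN v) (Sum.inl i)
    have h2 := congrFun (hN v) (Sum.inr i)
    simp only [S, LinearMap.pi_apply, LinearMap.smul_apply, LinearMap.proj_apply, coordMap_apply,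
      smul_eq_mul, Sum.elim_inl, Sum.elim_inr] at h1 h2
    rw [fderiv_apply, fderiv_apply, fderiv_apply, fderiv_apply]
    exact ⟨h1, h2⟩

theorem isIntegrableAt {m : Phase} (hr : m ∈ regularSet) : IsIntegrableAt m := by
  refine ⟨fun i j => ?_, ?_⟩
  · rw [bracket_eq, grad_eq (hasFDerivAt_hams_apply m i), grad_eq (hasFDerivAt_hams_apply m j)]
    exact involution m i j
  · have hli := (mem_regularSet_iff.1 hr).2.2
    rw [Fintype.linearIndependent_iff]
    intro c hc i
    -- This selects a vector tangent to the leaf on which `dHam` takes the value 1 at index `i` and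
    -- 0 at the others; it picks out the coefficient `c i`.
    have hsurj := surjective_of_linearIndependent hli (Sum.elim 0 (Pi.single i 1))
    obtain ⟨v, hv⟩ := hsurj
    have hvt : v ∈ leafTangent m := mem_leafTangent.2 fun j => by simpa using hv (Sum.inl j)
    have := LinearMap.congr_fun hc ⟨v, hvt⟩
    have hv' : ∀ j, gradHam m j ⬝ᵥ v = (Pi.single i 1 : Fin 4 → ℂ) j := fun j => by
      simpa using hv (Sum.inr j)
    simpa [(hasFDerivAt_hams_apply m _).fderiv, covec_apply, hv', Pi.single_apply] using this

/-! ### Separation relations -/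

/-- Desnanot-Jacobi identity for `A = x - L(ν)`: `det A` times its inner 2×2 minor equals `M₁₁ M₄₄ -
M₁₄ M₄₁`, where `M_{st}` omits row `s` and column `t`. The inner minor is `𝒢₁₂`, and `M₄₄`, `M₁₄`
are the two relations up to powers of `ν`. After multiplication by `ρ²` the cofactors in the
certificate are `ρ M₁₁` and `-ρ ν M₄₁`. -/
theorem g01_mul_spectralFun (m : Phase) {x r : ℂ} (hr : r ≠ 0)
    (h0 : r * g00 m x + g10 m x = 0) (h1 : r * g01 m x + g11 m x = 0) :
    g01 m x * spectralFun (casimirs m) (hams m) x r = 0 := by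
  have hs : spectralFun (casimirs m) (hams m) x r = ((x ^ 4 + polyH x m) * r ^ 2 - r ^ 3
      + (polyK x m - x ^ 2 * J1 m) * r + J2 m) / r ^ 2 := by
    simp only [spectralFun, casimirs, hams, polyH, polyK, cons_val]
    field_simp
    ring
  rw [hs, ← mul_div_assoc, div_eq_zero_iff]
  left
  simp only [g00, g10, g11, g01, polyH, polyK, H0, H1, H2, H3, K0, K1, J1, J2, Fin.sum_univ_four,
    Fin.isValue, Fin.reduceAdd, zero_add] at h0 h1 ⊢
  linear_combination (-bc m 1 * bc m 2 * bc m 3 * r + bc m 1 * bc m 2 * x * r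
    + bc m 1 * bc m 3 * x * r - bc m 1 * ac m 2 * r - bc m 1 * x ^ 2 * r + bc m 2 * bc m 3 * x * r
    + bc m 2 * cc m 1 * cc m 3 - bc m 2 * x ^ 2 * r - bc m 3 * ac m 1 * r - bc m 3 * x ^ 2 * r
    - ac m 1 * ac m 2 * cc m 3 + ac m 1 * x * r + ac m 2 * x * r - cc m 1 * cc m 3 * x
    - cc m 1 * r + x ^ 3 * r) * h0
    + (bc m 1 * bc m 2 * ac m 3 * r - bc m 1 * ac m 3 * x * r + bc m 1 * cc m 2 * r
    - bc m 2 * ac m 3 * x * r + bc m 2 * cc m 3 * r + ac m 1 * ac m 3 * r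
    + ac m 1 * cc m 2 * cc m 3 + ac m 3 * x ^ 2 * r - cc m 2 * x * r - cc m 3 * x * r - r ^ 2) * h1

theorem IsBranch.spectralFun_eq_zero {V : Set Phase} {lam mu : Fin 4 → Phase → ℂ}
    (h : IsBranch V lam mu) {m : Phase} (hm : m ∈ V) (i : Fin 4) :
    spectralFun (casimirs m) (hams m) (lam i m) (Complex.exp (mu i m)) = 0 := by
  have h1 := h.denom_ne m hm i
  simp [calG_eq] at h1
  exact (mul_eq_zero.1 (g01_mul_spectralFun m (Complex.exp_ne_zero _) (h.rel0 hm i)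
    (h.rel1 hm i))).resolve_left h1

/-- The partial derivatives of the separation relation with respect to the Hamiltonians. -/
def dPhiHam (x r : ℂ) : Fin 4 → ℂ := ![x ^ 2, -x, 1, r⁻¹]

/-- The partial derivatives of the separation relation with respect to the Casimirs. -/
def dPhiCas (x r : ℂ) : Fin 4 → ℂ := ![-x ^ 3, x / r, -(x ^ 2 / r), (r ^ 2)⁻¹]

/-- The partial derivative of `R(x, ρ)` with respect to `x`. -/
def dPhiX (κ h : Fin 4 → ℂ) (x r : ℂ) : ℂ :=
  4 * x ^ 3 + (-(3 * κ 0 * x ^ 2) + 2 * h 0 * x - h 1) + (κ 1 - 2 * κ 2 * x) / r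

/-- The partial derivative of `R(x, exp y)` with respect to `y`, where `ρ = exp y`. -/
def dPhiY (κ h : Fin 4 → ℂ) (x r : ℂ) : ℂ :=
  -r - (κ 1 * x + h 3 - κ 2 * x ^ 2) / r - 2 * κ 3 / r ^ 2

/-- Replacing division by `exp y` with `exp (-y)` makes the expression visibly entire, so only sum
and product rules are needed. -/
theorem spectralFun_exp (κ h : Fin 4 → ℂ) (x y : ℂ) : spectralFun κ h x (Complex.exp y) =
    x ^ 4 - Complex.exp y + (-(κ 0 * x ^ 3) + h 0 * x ^ 2 - h 1 * x + h 2)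
      + (κ 1 * x + h 3 - κ 2 * x ^ 2) * Complex.exp (-y) + κ 3 * Complex.exp (-y) ^ 2 := by
  rw [spectralFun, Complex.exp_neg, inv_pow, div_eq_mul_inv, div_eq_mul_inv]

theorem hasFDerivAt_spectralFun {E : Type*} [NormedAddCommGroup E] [NormedSpace ℂ E] {p : E}
    {κ h : E → Fin 4 → ℂ} {x y : E → ℂ} {κ' h' : Fin 4 → E →L[ℂ] ℂ} {x' y' : E →L[ℂ] ℂ}
    (hκ : ∀ i, HasFDerivAt (fun q => κ q i) (κ' i) p) (hh : ∀ i,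
      HasFDerivAt (fun q => h q i) (h' i) p)
    (hx : HasFDerivAt x x' p) (hy : HasFDerivAt y y' p) :
    HasFDerivAt (fun q => spectralFun (κ q) (h q) (x q) (Complex.exp (y q)))
      (dPhiX (κ p) (h p) (x p) (Complex.exp (y p)) • x'
        + dPhiY (κ p) (h p) (x p) (Complex.exp (y p)) • y'
        + ∑ i, dPhiCas (x p) (Complex.exp (y p)) i • κ' i
        + ∑ i, dPhiHam (x p) (Complex.exp (y p)) i • h' i) p := by
  simp only [spectralFun_exp, pow_succ, pow_zero, one_mul]
  apply HasFDerivAt.congr_fderiv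
  · repeat' first
      | exact hκ _ | exact hh _ | exact hx | exact hy
      | apply HasFDerivAt.fun_add | apply HasFDerivAt.fun_sub | apply HasFDerivAt.fun_mul
      | apply HasFDerivAt.fun_neg | apply HasFDerivAt.cexp
  · ext v
    simp [dPhiX, dPhiY, dPhiCas, dPhiHam, Fin.sum_univ_four, Complex.exp_neg]
    have := Complex.exp_ne_zero (y p)
    field_simp
    ring

theorem IsBranch.differential_relation {V : Set Phase} {lam mu : Fin 4 → Phase → ℂ}
    (h : IsBranch V lam mu) {m : Phase} (hm : m ∈ V) (i : Fin 4) :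
    dPhiX (casimirs m) (hams m) (lam i m) (Complex.exp (mu i m)) • covec (grad (lam i) m)
      + dPhiY (casimirs m) (hams m) (lam i m) (Complex.exp (mu i m)) • covec (grad (mu i) m)
      + ∑ j, dPhiCas (lam i m) (Complex.exp (mu i m)) j • covec (gradC m j)
      + ∑ j, dPhiHam (lam i m) (Complex.exp (mu i m)) j • covec (gradHam m j) = 0 :=
  HasFDerivAt.eq_zero_of_eqOn h.isOpen hm
    (hasFDerivAt_spectralFun (hasFDerivAt_casimirs_apply m) (hasFDerivAt_hams_apply m)
      (h.hasFDerivAt_lam hm i) (h.hasFDerivAt_mu hm i))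
    (fun _ hp => h.spectralFun_eq_zero hp i)

/-- If both partial derivatives vanished, the differentiated relation would be a linear relation
among the eight independent differentials, with coefficient 1 at `dH₃`. -/
theorem IsBranch.dPhi_ne_zero {V : Set Phase} {lam mu : Fin 4 → Phase → ℂ}
    (h : IsBranch V lam mu) {m : Phase} (hm : m ∈ V) (hr : m ∈ regularSet) (i : Fin 4) :
    dPhiX (casimirs m) (hams m) (lam i m) (Complex.exp (mu i m)) ≠ 0 ∨
      dPhiY (casimirs m) (hams m) (lam i m) (Complex.exp (mu i m)) ≠ 0 := by
  by_contra! hc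
  have hrel := h.differential_relation hm i
  simp only [hc.1, hc.2] at hrel
  rw [zero_smul ℂ (covec (grad (lam i) m)), zero_smul ℂ (covec (grad (mu i) m)), add_zero,
    zero_add] at hrel
  have := Fintype.linearIndependent_iff.1 (mem_regularSet_iff.1 hr).2.2
    (Sum.elim (dPhiCas (lam i m) (Complex.exp (mu i m))) (dPhiHam (lam i m) (Complex.exp (mu i m))))
    (by rw [Fintype.sum_sum_type]; exact hrel) (Sum.inr 2)
  simp [dPhiHam] at this

/-- A left null vector `w` eliminates the Hamiltonians from the differentiated relations. What
remains on the leaf is a relation among the independent `dλᵢ`, `dμᵢ`, whose coefficients are `w i`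
times the partial derivatives of `Φ` at `(λᵢ, μᵢ)`, which do not both vanish. -/
theorem IsBranch.det_dPhiHam_ne_zero {V : Set Phase} {lam mu : Fin 4 → Phase → ℂ}
    (h : IsBranch V lam mu) {m : Phase} (hm : m ∈ V) (hr : m ∈ regularSet) :
    (Matrix.of fun i j : Fin 4 => dPhiHam (lam i m) (Complex.exp (mu i m)) j).det ≠ 0 := by
  intro hdet
  obtain ⟨w, hw0, hw⟩ := Matrix.exists_vecMul_eq_zero_iff.2 hdet
  have hw' : ∀ j, ∑ i, w i * dPhiHam (lam i m) (Complex.exp (mu i m)) j = 0 := fun j =>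
    congrFun hw j
  have key : ∀ v : leafTangent m,
      ∑ i, w i * (dPhiX (casimirs m) (hams m) (lam i m) (Complex.exp (mu i m))
          * coordMap lam mu m v (Sum.inl i)
        + dPhiY (casimirs m) (hams m) (lam i m) (Complex.exp (mu i m))
          * coordMap lam mu m v (Sum.inr i)) = 0 := by
    intro v
    have h1 : ∀ i, dPhiX (casimirs m) (hams m) (lam i m) (Complex.exp (mu i m))
          * coordMap lam mu m v (Sum.inl i)
        + dPhiY (casimirs m) (hams m) (lam i m) (Complex.exp (mu i m))
          * coordMap lam mu m v (Sum.inr i)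
        = -∑ j, dPhiHam (lam i m) (Complex.exp (mu i m)) j * (gradHam m j ⬝ᵥ (v : Phase)) := by
      intro i
      have h2 := DFunLike.congr_fun (h.differential_relation hm i) (v : Phase)
      simp only [_root_.add_apply, _root_.sum_apply, _root_.smul_apply, _root_.zero_apply,
        covec_apply, mem_leafTangent.1 v.2, Finset.sum_const_zero, add_zero,
        smul_eq_mul, mul_zero] at h2
      rw [coordMap_apply, coordMap_apply, Sum.elim_inl, Sum.elim_inr]
      linear_combination h2
    simp only [h1, mul_neg, Finset.mul_sum, Finset.sum_neg_distrib]
    rw [Finset.sum_comm]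
    simp only [← mul_assoc, ← Finset.sum_mul, hw']
    simp
  have hs := (h.coordMap_bijective hm hr).2
  refine hw0 (funext fun i => ?_)
  obtain ⟨v1, hv1⟩ := hs (Pi.single (Sum.inl i) 1)
  obtain ⟨v2, hv2⟩ := hs (Pi.single (Sum.inr i) 1)
  have k1 := key v1
  have k2 := key v2
  rw [hv1] at k1
  rw [hv2] at k2
  simp [Pi.single_apply] at k1 k2
  rcases h.dPhi_ne_zero hm hr i with hx | hx
  · exact k1.resolve_right hx
  · exact k2.resolve_right hx

/-! ### Partial derivatives of `Φ` and the separation statement -/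

theorem hasDerivAt_spectralFun_x (κ h : Fin 4 → ℂ) (x y : ℂ) :
    HasDerivAt (fun s => spectralFun κ h s (Complex.exp y)) (dPhiX κ h x (Complex.exp y)) x := by
  have := (hasFDerivAt_spectralFun (p := x) (fun i => hasFDerivAt_const (κ i) x)
    (fun i => hasFDerivAt_const (h i) x) (hasFDerivAt_id x) (hasFDerivAt_const y x)).hasDerivAt
  simpa using this

theorem hasDerivAt_spectralFun_y (κ h : Fin 4 → ℂ) (x y : ℂ) :
    HasDerivAt (fun s => spectralFun κ h x (Complex.exp s)) (dPhiY κ h x (Complex.exp y)) y := by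
  have := (hasFDerivAt_spectralFun (p := y) (fun i => hasFDerivAt_const (κ i) y)
    (fun i => hasFDerivAt_const (h i) y) (hasFDerivAt_const x y) (hasFDerivAt_id y)).hasDerivAt
  simpa using this

theorem fderiv_spectralFun_h (κ h : Fin 4 → ℂ) (x y : ℂ) (j : Fin 4) :
    fderiv ℂ (fun h => spectralFun κ h x (Complex.exp y)) h (Pi.single j 1)
      = dPhiHam x (Complex.exp y) j := by
  have := (hasFDerivAt_spectralFun (p := h) (fun i => hasFDerivAt_const (κ i) h)
    (fun i => hasFDerivAt_apply i h) (hasFDerivAt_const x h) (hasFDerivAt_const y h))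
  rw [this.fderiv]
  simp [Pi.single_apply]

theorem differentiable_spectralFun (κ : Fin 4 → ℂ) :
    Differentiable ℂ fun p : ℂ × ℂ × (Fin 4 → ℂ) => spectralFun κ p.2.2 p.1 (Complex.exp p.2.1) :=
  fun p => (hasFDerivAt_spectralFun (p := p) (κ := fun _ => κ) (h := fun p => p.2.2)
    (x := fun p => p.1) (y := fun p => p.2.1) (fun i => hasFDerivAt_const (κ i) p)
    (fun i => (show DifferentiableAt ℂ (fun q : ℂ × ℂ × (Fin 4 → ℂ) => q.2.2 i) p by
      fun_prop).hasFDerivAt)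
    (differentiableAt_fst.hasFDerivAt)
    (show DifferentiableAt ℂ (fun q : ℂ × ℂ × (Fin 4 → ℂ) => q.2.1) p by
      fun_prop).hasFDerivAt).differentiableAt

theorem IsBranch.isSeparatedBy {V : Set Phase} {lam mu : Fin 4 → Phase → ℂ}
    (h : IsBranch V lam mu) (κ : Fin 4 → ℂ) :
    IsSeparatedBy (V ∩ leaf κ ∩ regularSet) lam mu hams
      (fun _ x y h => spectralFun κ h x (Complex.exp y)) where
  holo _ := differentiable_spectralFun κ
  relation := by
    rintro m ⟨⟨hm, rfl⟩, -⟩ i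
    exact h.spectralFun_eq_zero hm i
  effective := by
    rintro m ⟨⟨hm, rfl⟩, hr⟩ i
    rw [(hasDerivAt_spectralFun_x _ _ _ _).deriv, (hasDerivAt_spectralFun_y _ _ _ _).deriv]
    exact h.dPhi_ne_zero hm hr i
  solvable := by
    rintro m ⟨⟨hm, rfl⟩, hr⟩
    simp only [fderiv_spectralFun_h]
    exact h.det_dPhiHam_ne_zero hm hr

theorem IsBranch.det_lax_eq_zero {V : Set Phase} {lam mu : Fin 4 → Phase → ℂ}
    (h : IsBranch V lam mu) {m : Phase} (hm : m ∈ V) (i : Fin 4) {ν : ℂ}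
    (hν : ν ^ 4 = Complex.exp (mu i m)) :
    (lam i m • (1 : Matrix (Fin 4) (Fin 4) ℂ) - lax m ν).det = 0 := by
  have hν0 : ν ≠ 0 := by
    rintro rfl
    exact Complex.exp_ne_zero (mu i m) (by rw [← hν]; simp)
  rw [det_lax m _ ν hν0, hν]
  exact h.spectralFun_eq_zero hm i

/-! ### Polynomial functions -/

/-- `F` is given by a polynomial. -/
def IsPoly {σ : Type*} (F : (σ → ℂ) → ℂ) : Prop :=
  ∃ p : MvPolynomial σ ℂ, ∀ x, F x = MvPolynomial.eval x p

namespace IsPoly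

variable {σ τ : Type*} {F G : (σ → ℂ) → ℂ}

theorem const (c : ℂ) : IsPoly fun _ : σ → ℂ => c := ⟨MvPolynomial.C c, by simp⟩

theorem coord (i : σ) : IsPoly fun x : σ → ℂ => x i := ⟨MvPolynomial.X i, by simp⟩

theorem add (hF : IsPoly F) (hG : IsPoly G) : IsPoly fun x => F x + G x := by
  obtain ⟨p, hp⟩ := hF
  obtain ⟨q, hq⟩ := hG
  exact ⟨p + q, fun x => by simp [hp, hq]⟩

theorem mul (hF : IsPoly F) (hG : IsPoly G) : IsPoly fun x => F x * G x := by
  obtain ⟨p, hp⟩ := hF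
  obtain ⟨q, hq⟩ := hG
  exact ⟨p * q, fun x => by simp [hp, hq]⟩

theorem neg (hF : IsPoly F) : IsPoly fun x => -F x := by
  obtain ⟨p, hp⟩ := hF
  exact ⟨-p, fun x => by simp [hp]⟩

theorem sub (hF : IsPoly F) (hG : IsPoly G) : IsPoly fun x => F x - G x := by
  obtain ⟨p, hp⟩ := hF
  obtain ⟨q, hq⟩ := hG
  exact ⟨p - q, fun x => by simp [hp, hq]⟩

theorem sum {ι : Type*} (s : Finset ι) {F : ι → (σ → ℂ) → ℂ} (h : ∀ i ∈ s, IsPoly (F i)) :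
    IsPoly fun x => ∑ i ∈ s, F i x := by
  choose! p hp using h
  exact ⟨∑ i ∈ s, p i, fun x => by
    rw [map_sum]; exact Finset.sum_congr rfl fun i hi => hp i hi x⟩

theorem prod {ι : Type*} (s : Finset ι) {F : ι → (σ → ℂ) → ℂ} (h : ∀ i ∈ s, IsPoly (F i)) :
    IsPoly fun x => ∏ i ∈ s, F i x := by
  choose! p hp using h
  exact ⟨∏ i ∈ s, p i, fun x => by
    rw [map_prod]; exact Finset.prod_congr rfl fun i hi => hp i hi x⟩

theorem det {ι : Type*} [Fintype ι] [DecidableEq ι] {M : (σ → ℂ) → Matrix ι ι ℂ}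
    (h : ∀ i j, IsPoly fun x => M x i j) : IsPoly fun x => (M x).det := by
  simp only [Matrix.det_apply']
  exact sum _ fun _ _ => (const _).mul (prod _ fun _ _ => h _ _)

theorem comp {F : (τ → ℂ) → ℂ} (hF : IsPoly F) {φ : (σ → ℂ) → τ → ℂ}
    (hφ : ∀ t, IsPoly fun x => φ x t) : IsPoly fun x => F (φ x) := by
  obtain ⟨p, hp⟩ := hF
  choose q hq using hφ
  refine ⟨MvPolynomial.bind₁ q p, fun x => ?_⟩
  refine (hp _).trans ?_
  rw [MvPolynomial.eval, MvPolynomial.eval, MvPolynomial.eval₂Hom_bind₁]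
  congr 2
  exact funext fun t => hq t x

theorem differentiable [Fintype σ] (hF : IsPoly F) : Differentiable ℂ F := by
  obtain ⟨p, hp⟩ := hF
  rw [funext hp]
  clear hp
  induction p using MvPolynomial.induction_on with
  | C a => simp
  | add p q hp hq =>
    simp only [map_add]
    exact hp.add hq
  | mul_X p i hp =>
    simp only [map_mul, MvPolynomial.eval_X]
    exact hp.mul (differentiable_apply i)

end IsPoly

theorem isPoly_bc (i : Fin 4) : IsPoly fun m : Phase => bc m i := IsPoly.coord _
theorem isPoly_ac (i : Fin 4) : IsPoly fun m : Phase => ac m i := IsPoly.coord _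
theorem isPoly_cc (i : Fin 4) : IsPoly fun m : Phase => cc m i := IsPoly.coord _

theorem isPoly_gradC (i : Fin 4) (t : Idx) : IsPoly fun m => gradC m i t := by
  rcases t with t | t | t <;> fin_cases i <;> fin_cases t <;>
    simp only [gradC, gradH0, gradK0, gradJ1, gradJ2, vec, Sum.elim_inl, Sum.elim_inr,
      Fin.zero_eta, Fin.mk_one, Fin.reduceFinMk, cons_val] <;>
    repeat' first
      | exact isPoly_bc _ | exact isPoly_ac _ | exact isPoly_cc _ | exact IsPoly.const _
      | apply IsPoly.add | apply IsPoly.sub | apply IsPoly.mul | apply IsPoly.neg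

theorem isPoly_gradHam (i : Fin 4) (t : Idx) : IsPoly fun m => gradHam m i t := by
  rcases t with t | t | t <;> fin_cases i <;> fin_cases t <;>
    simp only [gradHam, gradH1, gradH2, gradH3, gradK1, vec, Sum.elim_inl, Sum.elim_inr,
      Fin.zero_eta, Fin.mk_one, Fin.reduceFinMk, cons_val] <;>
    repeat' first
      | exact isPoly_bc _ | exact isPoly_ac _ | exact isPoly_cc _ | exact IsPoly.const _
      | apply IsPoly.add | apply IsPoly.sub | apply IsPoly.mul | apply IsPoly.neg

theorem isPoly_lead : IsPoly lead := by
  unfold lead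
  repeat' first
      | exact isPoly_bc _ | exact isPoly_ac _ | exact isPoly_cc _ | exact IsPoly.const _
      | apply IsPoly.add | apply IsPoly.sub | apply IsPoly.mul | apply IsPoly.neg

theorem continuous_covec : Continuous covec := by
  unfold covec
  fun_prop

/-! ### The chart given by the branches -/

open Filter Topology in
theorem eventually_linearIndependent {m : Phase}
    (hm : LinearIndependent ℂ fun i => covec (Sum.elim (gradC m) (gradHam m) i)) :
    ∀ᶠ p in 𝓝 m, LinearIndependent ℂ fun i => covec (Sum.elim (gradC p) (gradHam p) i) := by
  have hc : Continuous fun p : Phase => fun i => covec (Sum.elim (gradC p) (gradHam p) i) := by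
    refine continuous_pi fun i => continuous_covec.comp (continuous_pi fun t => ?_)
    rcases i with i | i
    · exact (isPoly_gradC i t).differentiable.continuous
    · exact (isPoly_gradHam i t).differentiable.continuous
  exact (isOpen_setOfPred_linearIndependent.preimage hc).mem_nhds hm

theorem hasDerivAt_det_calG (m : Phase) (x : ℂ) :
    HasDerivAt (fun x => (calG m x).det) (derivDet m x) x := by
  simp only [det_calG_eq_quartic, derivDet_eq]
  have h := (((((hasDerivAt_pow 4 x).const_mul (lead m)).add
    ((hasDerivAt_pow 3 x).const_mul (coeffDet3 m))).add
    ((hasDerivAt_pow 2 x).const_mul (coeffDet2 m))).add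
    ((hasDerivAt_id x).const_mul (coeffDet1 m))).add_const (coeffDet0 m)
  refine h.congr_deriv ?_
  simp
  ring

theorem contDiffAt_g01 {l : Phase → ℂ} {m : Phase} (hl : ContDiffAt ℂ 1 l m) :
    ContDiffAt ℂ 1 (fun p => g01 p (l p)) m := by
  unfold g01 bc ac
  fun_prop

theorem contDiffAt_g11 {l : Phase → ℂ} {m : Phase} (hl : ContDiffAt ℂ 1 l m) :
    ContDiffAt ℂ 1 (fun p => g11 p (l p)) m := by
  unfold g11 bc ac cc
  fun_prop

theorem contDiff_det_calG : ContDiff ℂ 1 fun q : Phase × ℂ => (calG q.1 q.2).det := by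
  simp only [det_calG]
  unfold g00 g01 g10 g11 bc ac cc
  fun_prop

open Filter Topology in
/-- A simple root of `det 𝒢` extends to a differentiable branch. -/
theorem exists_root_branch {m : Phase} {z : ℂ} (hz : (calG m z).det = 0) (hd : derivDet m z ≠ 0) :
    ∃ l : Phase → ℂ, ContDiffAt ℂ 1 l m ∧ l m = z ∧ ∀ᶠ p in 𝓝 m, (calG p (l p)).det = 0 := by
  have hf : ContDiffAt ℂ 1 (fun q : Phase × ℂ => (calG q.1 q.2).det) (m, z) :=
    contDiff_det_calG.contDiffAt
  -- The partial derivative in `x` is multiplication by the nonzero number `derivDet m z`, which is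
  -- the invertibility required by the implicit function theorem.
  have hinr : fderiv ℂ (fun q : Phase × ℂ => (calG q.1 q.2).det) (m, z) ∘L .inr ℂ Phase ℂ
      = ((ContinuousLinearEquiv.unitsEquivAut ℂ (Units.mk0 _ hd) : ℂ ≃L[ℂ] ℂ) : ℂ →L[ℂ] ℂ) := by
    have h1 := ((hf.differentiableAt one_ne_zero).hasFDerivAt.comp z
      (hasFDerivAt_prodMk_right m z)).unique (hasDerivAt_det_calG m z).hasFDerivAt
    rw [h1]
    ext
    simp
  have hinv : (fderiv ℂ (fun q : Phase × ℂ => (calG q.1 q.2).det) (m, z) ∘L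
      .inr ℂ Phase ℂ).IsInvertible := ⟨_, hinr.symm⟩
  refine ⟨hf.implicitFunction one_ne_zero hinv, hf.contDiffAt_implicitFunction one_ne_zero hinv,
    hf.implicitFunction_apply_self one_ne_zero hinv, ?_⟩
  filter_upwards [hf.eventually_apply_implicitFunction one_ne_zero hinv] with p hp
  rw [hp, hz]

theorem rho_eq (m : Phase) (x : ℂ) : rho m x = -g11 m x / g01 m x := by
  simp [rho, calG_eq]

theorem calG_zero_one (m : Phase) (x : ℂ) : calG m x 0 1 = g01 m x := by simp [calG_eq]

theorem calG_one_one (m : Phase) (x : ℂ) : calG m x 1 1 = g11 m x := by simp [calG_eq]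

open Filter Topology in
theorem exists_log_branch {f : Phase → ℂ} {m : Phase} (hf : ContDiffAt ℂ 1 f m) (h0 : f m ≠ 0) :
    ∃ u : Phase → ℂ, ContDiffAt ℂ 1 u m ∧ ∀ᶠ p in 𝓝 m, Complex.exp (u p) = f p := by
  -- Normalizing by `f m` moves the argument of the logarithm close to 1, away from the branch cut,
  -- whatever the value of `f m`.
  refine ⟨fun p => Complex.log (f p / f m) + Complex.log (f m), ?_, ?_⟩
  · refine ContDiffAt.add (ContDiffAt.comp m (Complex.contDiffAt_log ?_) (hf.div_const _))
      contDiffAt_const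
    rw [div_self h0]
    exact Complex.one_mem_slitPlane
  · filter_upwards [hf.continuousAt.eventually_ne h0] with p hp
    rw [Complex.exp_add, Complex.exp_log (div_ne_zero hp h0), Complex.exp_log h0,
      div_mul_cancel₀ _ h0]

theorem isBranch_of_forall_mem {V : Set Phase} {lam mu : Fin 4 → Phase → ℂ} (hV : IsOpen V)
    (hl : ∀ p ∈ V, ∀ i, ContDiffAt ℂ 1 (lam i) p) (hu : ∀ p ∈ V, ∀ i, ContDiffAt ℂ 1 (mu i) p)
    (h0 : ∀ p ∈ V, ∀ i, (calG p (lam i p)).det = 0)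
    (hinj : ∀ p ∈ V, ∀ i j, i ≠ j → lam i p ≠ lam j p)
    (h1 : ∀ p ∈ V, ∀ i, g01 p (lam i p) ≠ 0)
    (he : ∀ p ∈ V, ∀ i, Complex.exp (mu i p) = -g11 p (lam i p) / g01 p (lam i p)) :
    IsBranch V lam mu where
  isOpen := hV
  lam_holo i p hp := ((hl p hp i).differentiableAt one_ne_zero).differentiableWithinAt
  mu_holo i p hp := ((hu p hp i).differentiableAt one_ne_zero).differentiableWithinAt
  root := h0
  distinct p hp i j hij := by
    by_contra hne
    exact hinj p hp i j hne hij
  denom_ne p hp i := by rw [calG_zero_one]; exact h1 p hp i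
  exp_mu p hp i := by rw [rho_eq]; exact he p hp i

theorem IsBranch.mem_regularSet {V : Set Phase} {lam mu : Fin 4 → Phase → ℂ}
    (h : IsBranch V lam mu) {p : Phase} (hp : p ∈ V) (hl : lead p ≠ 0)
    (h1 : ∀ i, g11 p (lam i p) ≠ 0)
    (hli : LinearIndependent ℂ fun i => covec (Sum.elim (gradC p) (gradHam p) i)) :
    p ∈ regularSet :=
  mem_regularSet_iff.2 ⟨hl, ⟨fun i => lam i p, h.distinct p hp, fun i =>
    ⟨h.root p hp i, h.denom_ne p hp i, by rw [calG_one_one]; exact h1 i⟩⟩, hli⟩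

open Filter Topology in
theorem exists_branch {m : Phase} (hm : m ∈ regularSet) :
    ∃ (V : Set Phase) (lam mu : Fin 4 → Phase → ℂ), m ∈ V ∧ V ⊆ regularSet ∧ IsBranch V lam mu ∧
      ∀ i, ContDiffAt ℂ 1 (lam i) m ∧ ContDiffAt ℂ 1 (mu i) m := by
  obtain ⟨hl, ⟨z, hz, hroot⟩, hli⟩ := mem_regularSet_iff.1 hm
  have hr0 : ∀ i, (calG m (z i)).det = 0 := fun i => (hroot i).1
  have hex : ∀ i, ∃ l : Phase → ℂ, ContDiffAt ℂ 1 l m ∧ l m = z i ∧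
      ∀ᶠ p in 𝓝 m, (calG p (l p)).det = 0 := fun i =>
    exists_root_branch (hr0 i) (derivDet_ne_zero hl hz hr0 i)
  choose lam hlam hlamz hlam0 using hex
  have h01 : ∀ i, ContDiffAt ℂ 1 (fun p => g01 p (lam i p)) m := fun i => contDiffAt_g01 (hlam i)
  have h11 : ∀ i, ContDiffAt ℂ 1 (fun p => g11 p (lam i p)) m := fun i => contDiffAt_g11 (hlam i)
  have hr1 : ∀ i, g01 m (lam i m) ≠ 0 := fun i => by
    rw [hlamz, ← calG_zero_one]; exact (hroot i).2.1
  have hr2 : ∀ i, g11 m (lam i m) ≠ 0 := fun i => by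
    rw [hlamz, ← calG_one_one]; exact (hroot i).2.2
  have hex : ∀ i, ∃ u : Phase → ℂ, ContDiffAt ℂ 1 u m ∧
      ∀ᶠ p in 𝓝 m, Complex.exp (u p) = -g11 p (lam i p) / g01 p (lam i p) := fun i =>
    exists_log_branch ((h11 i).neg.div (h01 i) (hr1 i))
      (div_ne_zero (neg_ne_zero.2 (hr2 i)) (hr1 i))
  choose mu hmu hmue using hex
  have e2 : ∀ i j, ∀ᶠ p in 𝓝 m, i ≠ j → lam i p ≠ lam j p := by
    intro i j
    rcases eq_or_ne i j with rfl | hij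
    · simp
    · filter_upwards [((hlam i).continuousAt.ne_iff_eventually_ne (hlam j).continuousAt).1
        (by rw [hlamz, hlamz]; exact fun h => hij (hz h))] with p hp _ using hp
  have ev := (eventually_all.2 hlam0).and <| (eventually_all.2 fun i => eventually_all.2 (e2 i)).and
    <| (eventually_all.2 fun i => (h01 i).continuousAt.eventually_ne (hr1 i)).and
    <| (eventually_all.2 fun i => (h11 i).continuousAt.eventually_ne (hr2 i)).and
    <| (eventually_all.2 fun i => (hlam i).eventually (by simp)).and
    <| (eventually_all.2 fun i => (hmu i).eventually (by simp)).and
    <| (isPoly_lead.differentiable.continuous.continuousAt.eventually_ne hl).and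
    <| (eventually_linearIndependent hli).and (eventually_all.2 hmue)
  obtain ⟨V, hV, hVo, hmV⟩ := eventually_nhds_iff.1 ev
  have hB : IsBranch V lam mu := isBranch_of_forall_mem hVo
    (fun p hp => (hV p hp).2.2.2.2.1) (fun p hp => (hV p hp).2.2.2.2.2.1) (fun p hp => (hV p hp).1)
    (fun p hp => (hV p hp).2.1) (fun p hp => (hV p hp).2.2.1)
    (fun p hp => (hV p hp).2.2.2.2.2.2.2.2)
  exact ⟨V, lam, mu, hmV, fun p hp => hB.mem_regularSet hp (hV p hp).2.2.2.2.2.2.1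
    (hV p hp).2.2.2.1 (hV p hp).2.2.2.2.2.2.2.1, hB, fun i => ⟨hlam i, hmu i⟩⟩

theorem contDiff_casimirs : ContDiff ℂ 1 casimirs := by
  refine contDiff_pi.2 fun i => ?_
  fin_cases i
  · change ContDiff ℂ 1 H0
    unfold H0 bc
    fun_prop
  · change ContDiff ℂ 1 K0
    unfold K0 bc ac cc
    fun_prop
  · change ContDiff ℂ 1 J1
    unfold J1 cc
    fun_prop
  · change ContDiff ℂ 1 J2
    unfold J2 cc
    fun_prop

/-- The map `(λ, μ, casimirs)` is a local biholomorphism of the phase space at `m`. The leaves are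
the fibres of its last component, so a single neighbourhood serves every `κ`. -/
theorem exists_chart {m : Phase} (hm : m ∈ regularSet) :
    ∃ (V : Set Phase) (lam mu : Fin 4 → Phase → ℂ), m ∈ V ∧ V ⊆ regularSet ∧ IsBranch V lam mu ∧
      ∀ κ : Fin 4 → ℂ,
        Set.InjOn (fun p => ((fun i => lam i p, fun i => mu i p) : (Fin 4 → ℂ) × (Fin 4 → ℂ)))
          (V ∩ leaf κ) ∧
        IsOpen ((fun p => ((fun i => lam i p, fun i => mu i p) : (Fin 4 → ℂ) × (Fin 4 → ℂ))) ''
          (V ∩ leaf κ)) := by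
  obtain ⟨V, lam, mu, hmV, hVr, hB, hd⟩ := exists_branch hm
  let Ψ : Phase → ((Fin 4 → ℂ) × (Fin 4 → ℂ)) × (Fin 4 → ℂ) := fun p =>
    ((fun i => lam i p, fun i => mu i p), casimirs p)
  have hl : ∀ i, HasStrictFDerivAt (lam i) (covec (grad (lam i) m)) m := fun i => by
    rw [covec_grad]; exact (hd i).1.hasStrictFDerivAt one_ne_zero
  have hu : ∀ i, HasStrictFDerivAt (mu i) (covec (grad (mu i) m)) m := fun i => by
    rw [covec_grad]; exact (hd i).2.hasStrictFDerivAt one_ne_zero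
  have hΨ := ((hasStrictFDerivAt_pi.2 hl).prodMk (hasStrictFDerivAt_pi.2 hu)).prodMk
    (contDiff_casimirs.contDiffAt.hasStrictFDerivAt (x := m) one_ne_zero)
  set T := ((ContinuousLinearMap.pi fun i => covec (grad (lam i) m)).prod
    (ContinuousLinearMap.pi fun i => covec (grad (mu i) m))).prod (fderiv ℂ casimirs m)
  -- A kernel vector is tangent to the leaf because the Casimir part vanishes, and on the tangent
  -- space `dλ`, `dμ` are already injective.
  have hinj : Function.Injective T.toLinearMap := by
    rw [← LinearMap.ker_eq_bot, LinearMap.ker_eq_bot']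
    intro v hv
    have hv' : T v = 0 := hv
    have hvt : v ∈ leafTangent m := congrArg Prod.snd hv'
    have h0 : coordMap lam mu m ⟨v, hvt⟩ = coordMap lam mu m 0 := by
      rw [map_zero]
      ext s
      rw [coordMap_apply]
      rcases s with i | i
      · exact (covec_apply _ _).symm.trans (congrFun (congrArg (fun w => w.1.1) hv') i)
      · exact (covec_apply _ _).symm.trans (congrFun (congrArg (fun w => w.1.2) hv') i)
    exact congrArg Subtype.val ((hB.coordMap_bijective hmV hm).1 h0)
  let e := (LinearMap.linearEquivOfInjective T.toLinearMap hinj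
    (by simp)).toContinuousLinearEquiv
  have he : HasStrictFDerivAt Ψ (e : Phase →L[ℂ] _) m := hΨ
  let Θ := he.toOpenPartialHomeomorph Ψ
  have hΘ : ∀ p, Θ p = Ψ p := fun p => rfl
  refine ⟨V ∩ Θ.source, lam, mu, ⟨hmV, he.mem_toOpenPartialHomeomorph_source⟩,
    fun p hp => hVr hp.1, ?_, fun κ => ⟨?_, ?_⟩⟩
  · exact
    { isOpen := hB.isOpen.inter Θ.open_source
      lam_holo := fun i => (hB.lam_holo i).mono Set.inter_subset_left
      mu_holo := fun i => (hB.mu_holo i).mono Set.inter_subset_left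
      root := fun p hp => hB.root p hp.1
      distinct := fun p hp => hB.distinct p hp.1
      denom_ne := fun p hp => hB.denom_ne p hp.1
      exp_mu := fun p hp => hB.exp_mu p hp.1 }
  · rintro p ⟨⟨-, hp⟩, hpκ⟩ q ⟨⟨-, hq⟩, hqκ⟩ hpq
    refine Θ.injOn hp hq ?_
    rw [hΘ, hΘ]
    exact Prod.ext hpq (hpκ.trans hqκ.symm)
  -- The image of the leaf is the slice at `κ` of an open set.
  · have ho : IsOpen (Θ '' (V ∩ Θ.source)) :=
      Θ.isOpen_image_of_subset_source (hB.isOpen.inter Θ.open_source) Set.inter_subset_right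
    have hc : Continuous fun w : (Fin 4 → ℂ) × (Fin 4 → ℂ) => (w, κ) := by fun_prop
    convert ho.preimage hc using 1
    ext w
    constructor
    · rintro ⟨p, ⟨hp, hpκ⟩, rfl⟩
      exact ⟨p, hp, Prod.ext rfl hpκ⟩
    · rintro ⟨p, hp, hpw⟩
      exact ⟨p, ⟨hp, congrArg Prod.snd hpw⟩, congrArg Prod.fst hpw⟩

/-! ### Generic leaves are symplectic -/

theorem gradC_zero (m v : Phase) : gradC m 0 ⬝ᵥ v = bc v 0 + bc v 1 + bc v 2 + bc v 3 := by
  simp [gradC, gradH0, dotProduct_phase]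

theorem gradC_one (m v : Phase) : gradC m 1 ⬝ᵥ v =
    cc m 1 * cc m 3 * (bc v 0 + bc v 2) + cc m 0 * cc m 2 * (bc v 1 + bc v 3)
    + ((-ac m 1 * cc m 2 - ac m 3 * cc m 1) * ac v 0 + (-ac m 0 * cc m 2 - ac m 2 * cc m 3) * ac v 1
    + (-ac m 1 * cc m 3 - ac m 3 * cc m 0) * ac v 2 + (-ac m 0 * cc m 1 - ac m 2 * cc m 0) * ac v 3)
    + (((bc m 1 + bc m 3) * cc m 2 - ac m 2 * ac m 3) * cc v 0
    + ((bc m 0 + bc m 2) * cc m 3 - ac m 0 * ac m 3) * cc v 1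
    + ((bc m 1 + bc m 3) * cc m 0 - ac m 0 * ac m 1) * cc v 2
    + ((bc m 0 + bc m 2) * cc m 1 - ac m 1 * ac m 2) * cc v 3) := by
  simp [gradC, gradK0, dotProduct_phase]
  ring

theorem gradC_two (m v : Phase) : gradC m 2 ⬝ᵥ v =
    cc m 2 * cc v 0 + cc m 3 * cc v 1 + cc m 0 * cc v 2 + cc m 1 * cc v 3 := by
  simp [gradC, gradJ1, dotProduct_phase]

theorem gradC_three (m v : Phase) : gradC m 3 ⬝ᵥ v =
    cc m 1 * cc m 3 * (cc m 2 * cc v 0 + cc m 0 * cc v 2)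
      + cc m 0 * cc m 2 * (cc m 3 * cc v 1 + cc m 1 * cc v 3) := by
  simp [gradC, gradJ2, dotProduct_phase]
  ring

/-- The system is block triangular: the `c₁`, `c₂` directions solve for `dJ₁`, `dJ₂`, and then the
`b₁`, `b₂` directions solve for `dH₀`, `dK₀`. Both blocks are invertible when `c₃ c₄ (c₁c₃ - c₂c₄) ≠
0`. -/
theorem surjective_fderiv_casimirs_of_ne {m : Phase} (h2 : cc m 2 ≠ 0) (h3 : cc m 3 ≠ 0)
    (hpq : cc m 0 * cc m 2 - cc m 1 * cc m 3 ≠ 0) :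
    Function.Surjective (fderiv ℂ casimirs m) := by
  intro w
  set D := cc m 0 * cc m 2 - cc m 1 * cc m 3 with hD
  set p := cc m 0 * cc m 2
  set q := cc m 1 * cc m 3
  set x := (p * w 2 - w 3) / D / cc m 2 with hx
  set y := (w 3 - q * w 2) / D / cc m 3 with hy
  have ex : D * (cc m 2 * x) = p * w 2 - w 3 := by rw [hx]; field_simp
  have ey : D * (cc m 3 * y) = w 3 - q * w 2 := by rw [hy]; field_simp
  set k := ((bc m 1 + bc m 3) * cc m 2 - ac m 2 * ac m 3) * x
    + ((bc m 0 + bc m 2) * cc m 3 - ac m 0 * ac m 3) * y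
  set z := (p * w 0 + k - w 1) / D with hz
  have ez : D * z = p * w 0 + k - w 1 := by rw [hz]; field_simp
  refine ⟨vec ![z, w 0 - z, 0, 0] 0 ![x, y, 0, 0], ?_⟩
  rw [fderiv_casimirs]
  ext i
  fin_cases i
  · simp [gradC_zero]
  · simp only [Fin.mk_one, gradC_one, bc_vec, ac_vec, cc_vec, cons_val, Pi.zero_apply]
    linear_combination -ez
  · simp only [Fin.reduceFinMk, gradC_two, cc_vec, cons_val]
    refine mul_left_cancel₀ hpq ?_
    linear_combination ex + ey
  · simp only [Fin.reduceFinMk, gradC_three, cc_vec, cons_val]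
    refine mul_left_cancel₀ hpq ?_
    linear_combination q * ex + p * ey

/-- The equation is solved block by block. The `c`-components of `v` determine the `b`-part of `g`,
the `a`-components its `a`-part, and the `b`-components its `c`-part. The four tangency conditions
are exactly the compatibility conditions met on the way. -/
theorem exists_bivP_eq {m v : Phase} (h0 : cc m 0 ≠ 0) (h1 : cc m 1 ≠ 0)
    (hpq : cc m 0 * cc m 2 - cc m 1 * cc m 3 ≠ 0) (hv : ∀ i, gradC m i ⬝ᵥ v = 0) :
    ∃ g : Phase, bivP m *ᵥ g = v := by
  have v0 := hv 0
  have v1 := hv 1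
  have v2 := hv 2
  have v3 := hv 3
  rw [gradC_zero] at v0
  rw [gradC_one] at v1
  rw [gradC_two] at v2
  rw [gradC_three] at v3
  set D := cc m 0 * cc m 2 - cc m 1 * cc m 3 with hD
  set x := cc v 0 / cc m 0 with hx
  set y := cc v 1 / cc m 1 with hy
  have c0 : cc v 0 = cc m 0 * x := by rw [hx]; field_simp
  have c1 : cc v 1 = cc m 1 * y := by rw [hy]; field_simp
  have c2 : cc v 2 = -(cc m 2 * x) := by
    refine mul_left_cancel₀ (mul_ne_zero hpq h0) ?_
    rw [c0, c1] at v2 v3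
    linear_combination cc m 0 * cc m 2 * v2 - v3
  have c3 : cc v 3 = -(cc m 3 * y) := by
    refine mul_left_cancel₀ h1 ?_
    rw [c0, c1, c2] at v2
    linear_combination v2
  rw [c0, c1, c2, c3] at v1
  -- Once the contribution of the `b`-part of `g` is removed, the `a`-components form a system with
  -- matrix `blockC2`. It splits into two 2×2 systems of determinant `±D`, solved by `A0, …, A3`.
  set s0 := ac v 0 - ac m 0 * (x - y) with hs0
  set s1 := ac v 1 - ac m 1 * y with hs1
  set s2 := ac v 2 with hs2
  set s3 := ac v 3 + ac m 3 * x with hs3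
  set A0 := (cc m 2 * s1 + cc m 1 * s3) / D with hA0
  set A1 := -(cc m 2 * s0 + cc m 3 * s2) / D with hA1
  set A2 := (cc m 3 * s1 + cc m 0 * s3) / D with hA2
  set A3 := -(cc m 1 * s0 + cc m 0 * s2) / D with hA3
  have e0 : D * A0 = cc m 2 * s1 + cc m 1 * s3 := by rw [hA0]; field_simp
  have e1 : D * A1 = -(cc m 2 * s0 + cc m 3 * s2) := by rw [hA1]; field_simp
  have e2 : D * A2 = cc m 3 * s1 + cc m 0 * s3 := by rw [hA2]; field_simp
  have e3 : D * A3 = -(cc m 1 * s0 + cc m 0 * s2) := by rw [hA3]; field_simp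
  clear_value A0 A1 A2 A3 x y
  set C0 := (-(ac m 0 * A0) + ac m 3 * A3 - bc v 0) / cc m 0 with hC0
  set C1 := (ac m 0 * A0 - ac m 1 * A1 - bc v 1) / cc m 1 with hC1
  have f0 : cc m 0 * C0 = -(ac m 0 * A0) + ac m 3 * A3 - bc v 0 := by rw [hC0]; field_simp
  have f1 : cc m 1 * C1 = ac m 0 * A0 - ac m 1 * A1 - bc v 1 := by rw [hC1]; field_simp
  clear_value C0 C1
  -- Rows 1 and 3 of the `b`-block contain the `c`-part of `g` with opposite signs, so their sum is
  -- a constraint; it is provided by tangency to `K₀` and `H₀`.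
  have key : ac m 1 * A1 - ac m 2 * A2 - ac m 0 * A0 + ac m 3 * A3 = bc v 0 + bc v 2 := by
    refine mul_left_cancel₀ hpq ?_
    linear_combination ac m 1 * e1 - ac m 2 * e2 - ac m 0 * e0 + ac m 3 * e3 + v1
      - cc m 0 * cc m 2 * v0
  refine ⟨vec ![x, y, 0, 0] ![A0, A1, A2, A3] ![C0, C1, 0, 0], ?_⟩
  rw [bivP_mulVec]
  simp only [bc_vec, ac_vec, cc_vec, cons_val]
  refine phase_ext ?_ ?_ ?_ <;> intro i <;> fin_cases i <;>
    simp only [bc_vec, ac_vec, cc_vec, Fin.zero_eta, Fin.mk_one, Fin.reduceFinMk, cons_val]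
  · linear_combination -f0
  · linear_combination -f1
  · linear_combination key + f0
  · linear_combination -key + f1 - v0
  · refine mul_left_cancel₀ hpq ?_
    linear_combination -cc m 0 * e1 + cc m 3 * e3
  · refine mul_left_cancel₀ hpq ?_
    linear_combination cc m 0 * e0 - cc m 1 * e2
  · refine mul_left_cancel₀ hpq ?_
    linear_combination cc m 1 * e1 - cc m 2 * e3
  · refine mul_left_cancel₀ hpq ?_
    linear_combination -cc m 3 * e0 + cc m 2 * e2
  · linear_combination -c0
  · linear_combination -c1
  · linear_combination -c2
  · linear_combination -c3

theorem isSymplecticAt_of_ne {m : Phase} (h0 : cc m 0 ≠ 0) (h1 : cc m 1 ≠ 0) (h2 : cc m 2 ≠ 0)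
    (h3 : cc m 3 ≠ 0) (hpq : cc m 0 * cc m 2 - cc m 1 * cc m 3 ≠ 0) : IsSymplecticAt m := by
  refine ⟨surjective_fderiv_casimirs_of_ne h2 h3 hpq, ?_⟩
  ext v
  constructor
  · rintro ⟨α, rfl⟩
    exact bivP_mem_leafTangent m _
  · intro hv
    obtain ⟨g, hg⟩ := exists_bivP_eq h0 h1 hpq (mem_leafTangent.1 hv)
    exact ⟨covec g, by rw [sharp_covec, hg]⟩

/-! ### Quartics with four distinct roots -/

/-- The discriminant of the quartic `a x⁴ + b x³ + c x² + d x + e`. -/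
def quarticDisc (a b c d e : ℂ) : ℂ :=
  256 * a ^ 3 * e ^ 3 - 192 * a ^ 2 * b * d * e ^ 2 - 128 * a ^ 2 * c ^ 2 * e ^ 2
    + 144 * a ^ 2 * c * d ^ 2 * e - 27 * a ^ 2 * d ^ 4 + 144 * a * b ^ 2 * c * e ^ 2
    - 6 * a * b ^ 2 * d ^ 2 * e - 80 * a * b * c ^ 2 * d * e + 18 * a * b * c * d ^ 3
    + 16 * a * c ^ 4 * e - 4 * a * c ^ 3 * d ^ 2 - 27 * b ^ 4 * e ^ 2 + 18 * b ^ 3 * c * d * e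
    - 4 * b ^ 3 * d ^ 3 - 4 * b ^ 2 * c ^ 3 * e + b ^ 2 * c ^ 2 * d ^ 2

/-- At a double root the two equations determine `d` and `e` from `a, b, c, r`, and the discriminant
then vanishes identically. -/
theorem quarticDisc_eq_zero {a b c d e r : ℂ}
    (h : a * r ^ 4 + b * r ^ 3 + c * r ^ 2 + d * r + e = 0)
    (h' : 4 * a * r ^ 3 + 3 * b * r ^ 2 + 2 * c * r + d = 0) : quarticDisc a b c d e = 0 := by
  obtain rfl : d = -(4 * a * r ^ 3 + 3 * b * r ^ 2 + 2 * c * r) := by linear_combination h'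
  obtain rfl : e = 3 * a * r ^ 4 + 2 * b * r ^ 3 + c * r ^ 2 := by linear_combination h
  rw [quarticDisc]
  ring

open Polynomial in
theorem exists_four_roots {a b c d e : ℂ} (ha : a ≠ 0) (hd : quarticDisc a b c d e ≠ 0) :
    ∃ z : Fin 4 → ℂ, Function.Injective z ∧
      ∀ i, a * z i ^ 4 + b * z i ^ 3 + c * z i ^ 2 + d * z i + e = 0 := by
  let P : ℂ[X] := C a * X ^ 4 + C b * X ^ 3 + C c * X ^ 2 + C d * X + C e
  have hdeg : P.natDegree = 4 := by
    simp only [P]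
    compute_degree!
  have hP0 : P ≠ 0 := by
    intro h
    rw [h] at hdeg
    simp at hdeg
  -- Over an algebraically closed field separability means having no common root with the
  -- derivative, and such a root would force the discriminant to vanish.
  have hsep : P.Separable := by
    rw [Polynomial.separable_def, Polynomial.isCoprime_iff_aeval_ne_zero_of_isAlgClosed ℂ ℂ]
    intro r
    by_contra! hr
    refine hd (quarticDisc_eq_zero (r := r) ?_ ?_)
    · simpa [P] using hr.1
    · have := hr.2
      simp [P] at this
      linear_combination this
  have hcard : P.roots.toFinset.card = 4 := by
    rw [Multiset.toFinset_card_of_nodup (nodup_roots hsep), ← hdeg]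
    exact (splits_iff_card_roots.1 (IsAlgClosed.splits P))
  refine ⟨fun i => (P.roots.toFinset.equivFinOfCardEq hcard).symm i, ?_, fun i => ?_⟩
  · exact Subtype.val_injective.comp (Equiv.injective _)
  · have h := ((P.roots.toFinset.equivFinOfCardEq hcard).symm i).2
    rw [Multiset.mem_toFinset, mem_roots hP0] at h
    simpa [P] using h

/-! ### A polynomial whose nonvanishing implies regularity -/

/-- The resultant of `det 𝒢` and the linear polynomial `𝒢₂₂`. -/
def res11 (m : Phase) : ℂ :=
  lead m * (-g11 m 0) ^ 4 + coeffDet3 m * (-g11 m 0) ^ 3 * lead m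
    + coeffDet2 m * (-g11 m 0) ^ 2 * lead m ^ 2 + coeffDet1 m * (-g11 m 0) * lead m ^ 3
    + coeffDet0 m * lead m ^ 4

/-- The slope of `𝒢₂₂` is again `lead m`, so a root `x` satisfies `-𝒢₂₂(0) = lead m * x` and `res11`
becomes `lead m ^ 4 * det 𝒢(x)`. -/
theorem res11_eq_zero {m : Phase} {x : ℂ} (hx : (calG m x).det = 0) (h : g11 m x = 0) :
    res11 m = 0 := by
  rw [det_calG_eq_quartic] at hx
  have h' : -g11 m 0 = lead m * x := by
    simp only [g11, lead] at h ⊢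
    linear_combination -h
  rw [res11, h']
  linear_combination lead m ^ 4 * hx

/-- The coefficient of `x` in the remainder of `det 𝒢` modulo `𝒢₁₂ = x² + s x + n`. -/
def remLin (m : Phase) (s n : ℂ) : ℂ :=
  lead m * (-s ^ 3 + 2 * s * n) + coeffDet3 m * (s ^ 2 - n) - coeffDet2 m * s + coeffDet1 m

/-- The constant coefficient of the remainder of `det 𝒢` modulo `𝒢₁₂ = x² + s x + n`. -/
def remConst (m : Phase) (s n : ℂ) : ℂ :=
  -(lead m * n * (s ^ 2 - n)) + coeffDet3 m * s * n - coeffDet2 m * n + coeffDet0 m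

/-- The resultant of `det 𝒢` and the quadratic polynomial `𝒢₁₂`. -/
def res01 (m : Phase) : ℂ :=
  remConst m (-(bc m 1 + bc m 2)) (g01 m 0) ^ 2
    + (bc m 1 + bc m 2) * remLin m (-(bc m 1 + bc m 2)) (g01 m 0)
      * remConst m (-(bc m 1 + bc m 2)) (g01 m 0)
    + g01 m 0 * remLin m (-(bc m 1 + bc m 2)) (g01 m 0) ^ 2

/-- At a common root the remainder of `det 𝒢` vanishes, so its constant term is `-x` times its
linear coefficient, and `res01` becomes the square of that coefficient times `𝒢₁₂(x)`. -/
theorem res01_eq_zero {m : Phase} {x : ℂ} (hx : (calG m x).det = 0) (h : g01 m x = 0) :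
    res01 m = 0 := by
  rw [det_calG_eq_quartic] at hx
  have h' : x ^ 2 - (bc m 1 + bc m 2) * x + g01 m 0 = 0 := by
    simp only [g01] at h ⊢
    linear_combination h
  rw [res01]
  set s := -(bc m 1 + bc m 2) with hs
  have hs' : bc m 1 + bc m 2 = -s := by rw [hs, neg_neg]
  rw [hs'] at h' ⊢
  set n := g01 m 0
  have hr : remConst m s n = -(remLin m s n * x) := by
    simp only [remConst, remLin]
    linear_combination hx - (lead m * (x ^ 2 - s * x + s ^ 2 - n) + coeffDet3 m * (x - s)
      + coeffDet2 m) * h'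
  rw [hr]
  linear_combination remLin m s n ^ 2 * h'

/-- Vectors dual to the gradients of the eight functions at a particular point. -/
def testVec : Fin 4 ⊕ Fin 4 → Phase :=
  Sum.elim
    ![vec ![0, 1, 1, -1] 0 0, vec ![-1, 1, 0, 0] 0 0, vec ![0, 1, 0, -1] 0 ![1, 0, 0, 0],
      vec 0 0 ![-1, 0, 0, 1]]
    ![vec 0 ![1, 0, 0, 0] ![1, 0, -1, 0], vec ![0, -1, 0, 1] 0 0, vec ![1, -1, -1, 1] 0 0,
      vec 0 0 ![-1, 0, 1, 0]]

/-- The differentials of the eight functions, evaluated on the test vectors. -/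
def testMatrix (m : Phase) : Matrix (Fin 4 ⊕ Fin 4) (Fin 4 ⊕ Fin 4) ℂ :=
  Matrix.of fun i j => Sum.elim (gradC m) (gradHam m) i ⬝ᵥ testVec j

theorem linearIndependent_of_det_testMatrix {m : Phase} (hm : (testMatrix m).det ≠ 0) :
    LinearIndependent ℂ fun i => covec (Sum.elim (gradC m) (gradHam m) i) := by
  rw [Fintype.linearIndependent_iff]
  intro c hc i
  have h : c ᵥ* testMatrix m = 0 := by
    ext j
    have := DFunLike.congr_fun hc (testVec j)
    simp only [_root_.sum_apply, _root_.smul_apply, covec_apply, smul_eq_mul,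
      _root_.zero_apply] at this
    exact this
  exact congrFun (eq_zero_of_vecMul_eq_zero hm h) i

/-- A polynomial function which vanishes outside the regular set. -/
def regularizer (m : Phase) : ℂ :=
  lead m * quarticDisc (lead m) (coeffDet3 m) (coeffDet2 m) (coeffDet1 m) (coeffDet0 m)
    * res11 m * res01 m * (testMatrix m).det

theorem mem_regularSet_of_regularizer {m : Phase} (hm : regularizer m ≠ 0) : m ∈ regularSet := by
  simp only [regularizer, mul_ne_zero_iff] at hm
  obtain ⟨⟨⟨⟨hl, hd⟩, h11⟩, h01⟩, ht⟩ := hm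
  obtain ⟨z, hz, hz0⟩ := exists_four_roots hl hd
  refine mem_regularSet_iff.2 ⟨hl, ⟨z, hz, fun i => ?_⟩, linearIndependent_of_det_testMatrix ht⟩
  have hdet : (calG m (z i)).det = 0 := by rw [det_calG_eq_quartic]; exact hz0 i
  refine ⟨hdet, ?_, ?_⟩
  · rw [calG_zero_one]
    exact fun h => h01 (res01_eq_zero hdet h)
  · rw [calG_one_one]
    exact fun h => h11 (res11_eq_zero hdet h)

theorem isPoly_coeffDet3 : IsPoly coeffDet3 := by
  unfold coeffDet3
  repeat' first
    | exact isPoly_bc _ | exact isPoly_ac _ | exact isPoly_cc _ | exact IsPoly.const _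
    | apply IsPoly.add | apply IsPoly.sub | apply IsPoly.mul

theorem isPoly_coeffDet2 : IsPoly coeffDet2 := by
  unfold coeffDet2
  repeat' first
    | exact isPoly_bc _ | exact isPoly_ac _ | exact isPoly_cc _ | exact IsPoly.const _
    | apply IsPoly.add | apply IsPoly.sub | apply IsPoly.mul | apply IsPoly.neg

theorem isPoly_coeffDet1 : IsPoly coeffDet1 := by
  unfold coeffDet1
  repeat' first
    | exact isPoly_bc _ | exact isPoly_ac _ | exact isPoly_cc _ | exact IsPoly.const _
    | apply IsPoly.add | apply IsPoly.sub | apply IsPoly.mul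

theorem isPoly_coeffDet0 : IsPoly coeffDet0 := by
  unfold coeffDet0
  repeat' first
    | exact isPoly_bc _ | exact isPoly_ac _ | exact isPoly_cc _ | exact IsPoly.const _
    | apply IsPoly.add | apply IsPoly.sub | apply IsPoly.mul | apply IsPoly.neg

theorem isPoly_g01 (x : ℂ) : IsPoly fun m => g01 m x := by
  unfold g01
  repeat' first
    | exact isPoly_bc _ | exact isPoly_ac _ | exact isPoly_cc _ | exact IsPoly.const _
    | apply IsPoly.add | apply IsPoly.sub | apply IsPoly.mul

theorem isPoly_g11 (x : ℂ) : IsPoly fun m => g11 m x := by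
  unfold g11
  repeat' first
    | exact isPoly_bc _ | exact isPoly_ac _ | exact isPoly_cc _ | exact IsPoly.const _
    | apply IsPoly.add | apply IsPoly.sub | apply IsPoly.mul

theorem isPoly_testMatrix (i j : Fin 4 ⊕ Fin 4) : IsPoly fun m => testMatrix m i j := by
  simp only [testMatrix, of_apply, dotProduct]
  refine IsPoly.sum _ fun t _ => IsPoly.mul ?_ (IsPoly.const _)
  rcases i with i | i
  · exact isPoly_gradC i t
  · exact isPoly_gradHam i t

theorem IsPoly.quarticDisc {σ : Type*} {a b c d e : (σ → ℂ) → ℂ} (ha : IsPoly a) (hb : IsPoly b)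
    (hc : IsPoly c) (hd : IsPoly d) (he : IsPoly e) :
    IsPoly fun x => quarticDisc (a x) (b x) (c x) (d x) (e x) := by
  unfold TodaFourThree.quarticDisc
  repeat' first
    | assumption | exact IsPoly.const _
    | apply IsPoly.add | apply IsPoly.sub | apply IsPoly.mul

theorem isPoly_res11 : IsPoly res11 := by
  unfold res11
  have h := isPoly_lead
  have h3 := isPoly_coeffDet3
  have h2 := isPoly_coeffDet2
  have h1 := isPoly_coeffDet1
  have h0 := isPoly_coeffDet0
  have hg := isPoly_g11 0
  -- Making the coefficients opaque turns them into atoms that are closed by `assumption`.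
  generalize lead = a, coeffDet3 = b, coeffDet2 = c, coeffDet1 = d, coeffDet0 = e, g11 = g at *
  repeat' first
    | assumption | exact IsPoly.const _
    | apply IsPoly.add | apply IsPoly.sub | apply IsPoly.mul | apply IsPoly.neg

theorem isPoly_res01 : IsPoly res01 := by
  unfold res01 remConst remLin
  have h := isPoly_lead
  have h3 := isPoly_coeffDet3
  have h2 := isPoly_coeffDet2
  have h1 := isPoly_coeffDet1
  have h0 := isPoly_coeffDet0
  have hg := isPoly_g01 0
  have hb1 := isPoly_bc 1
  have hb2 := isPoly_bc 2
  generalize lead = a, coeffDet3 = b, coeffDet2 = c, coeffDet1 = d, coeffDet0 = e, g01 = g,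
    bc = β at *
  repeat' first
    | assumption | exact IsPoly.const _
    | apply IsPoly.add | apply IsPoly.sub | apply IsPoly.mul | apply IsPoly.neg

theorem isPoly_regularizer : IsPoly regularizer :=
  (((isPoly_lead.mul (isPoly_lead.quarticDisc isPoly_coeffDet3 isPoly_coeffDet2 isPoly_coeffDet1
    isPoly_coeffDet0)).mul isPoly_res11).mul isPoly_res01).mul (IsPoly.det isPoly_testMatrix)

/-! ### The base point -/

/-- A point of the leaf with `c₁ c₃ = p` and `c₂ c₄ = q`; the parameter is `(H₀, K₀, p, q)`. -/
def basePoint (k : Fin 4 → ℂ) : Phase :=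
  vec ![0, 0, 0, k 0] ![1, 0, 0, k 0 * k 2 - k 1] ![1, 1, k 2, k 3]

/-- The term `c₂ a₁ a₄` of `K₀` absorbs the prescribed value, so nothing is divided by `p - q` and
the point depends polynomially on `k`. -/
theorem casimirs_basePoint (k : Fin 4 → ℂ) :
    casimirs (basePoint k) = ![k 0, k 1, k 2 + k 3, k 2 * k 3] := by
  ext i
  fin_cases i <;> simp [casimirs, basePoint, H0, K0, J1, J2, Fin.sum_univ_four]

theorem isPoly_basePoint (t : Idx) : IsPoly fun k : Fin 4 → ℂ => basePoint k t := by
  rcases t with t | t | t <;> fin_cases t <;>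
    simp only [basePoint, vec, Sum.elim_inl, Sum.elim_inr, Fin.zero_eta, Fin.mk_one,
      Fin.reduceFinMk, cons_val] <;>
    repeat' first
      | exact IsPoly.coord _ | exact IsPoly.const _ | apply IsPoly.sub | apply IsPoly.mul

/-- This point has `J₂ = 0`, so it is not on a generic leaf; it only certifies that `regularizer`
along the base points is not the zero polynomial. -/
theorem regularizer_basePoint_ne_zero : regularizer (basePoint ![0, 0, 1, 0]) ≠ 0 := by
  have ht : testMatrix (basePoint ![0, 0, 1, 0]) = 1 := by
    ext i j
    rcases i with i | i <;> rcases j with j | j <;> fin_cases i <;> fin_cases j <;>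
      simp [testMatrix, testVec, dotProduct_phase, gradC, gradHam, gradH0, gradH1, gradH2, gradH3,
        gradK0, gradK1, gradJ1, gradJ2, basePoint, one_apply]
  have h : lead (basePoint ![0, 0, 1, 0]) = -1 := by simp [lead, basePoint]
  have h3 : coeffDet3 (basePoint ![0, 0, 1, 0]) = 2 := by
    simp [coeffDet3, basePoint]; norm_num
  have h2 : coeffDet2 (basePoint ![0, 0, 1, 0]) = -1 := by simp [coeffDet2, basePoint]
  have h1 : coeffDet1 (basePoint ![0, 0, 1, 0]) = 2 := by simp [coeffDet1, basePoint]
  have h0 : coeffDet0 (basePoint ![0, 0, 1, 0]) = -1 := by simp [coeffDet0, basePoint]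
  have hg1 : g11 (basePoint ![0, 0, 1, 0]) 0 = 1 := by simp [g11, basePoint]
  have hg0 : g01 (basePoint ![0, 0, 1, 0]) 0 = 0 := by simp [g01, basePoint]
  have hb : bc (basePoint ![0, 0, 1, 0]) 1 + bc (basePoint ![0, 0, 1, 0]) 2 = 0 := by
    simp [basePoint]
  rw [regularizer, ht, det_one, res11, res01, remConst, remLin, hb, h, h3, h2, h1, h0, hg1, hg0,
    quarticDisc]
  norm_num

/-! ### Density of the regular points -/

/-- A polynomial in `κ₀, κ₁` and the roots `p, q` of `t² - κ₂ t + κ₃`, reduced modulo the relations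
between roots and coefficients. -/
theorem exists_reduced (P : MvPolynomial (Fin 4) ℂ) : ∃ U W : MvPolynomial (Fin 4) ℂ,
    ∀ k : Fin 4 → ℂ, MvPolynomial.eval k P =
      MvPolynomial.eval ![k 0, k 1, k 2 + k 3, k 2 * k 3] U
      + MvPolynomial.eval ![k 0, k 1, k 2 + k 3, k 2 * k 3] W * k 2 := by
  induction P using MvPolynomial.induction_on with
  | C a => exact ⟨MvPolynomial.C a, 0, by simp⟩
  | add P Q hP hQ =>
    obtain ⟨U, W, h⟩ := hP
    obtain ⟨U', W', h'⟩ := hQ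
    refine ⟨U + U', W + W', fun k => ?_⟩
    simp only [map_add, h, h']
    ring
  | mul_X P i hP =>
    obtain ⟨U, W, h⟩ := hP
    have h' : ∀ k : Fin 4 → ℂ, MvPolynomial.eval k (P * MvPolynomial.X i) =
      (MvPolynomial.eval ![k 0, k 1, k 2 + k 3, k 2 * k 3] U
      + MvPolynomial.eval ![k 0, k 1, k 2 + k 3, k 2 * k 3] W * k 2) * k i := fun k => by
      rw [map_mul, h, MvPolynomial.eval_X]
    fin_cases i
    · refine ⟨U * MvPolynomial.X 0, W * MvPolynomial.X 0, fun k => (h' k).trans ?_⟩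
      simp
      ring
    · refine ⟨U * MvPolynomial.X 1, W * MvPolynomial.X 1, fun k => (h' k).trans ?_⟩
      simp
      ring
    · refine ⟨-W * MvPolynomial.X 3, U + W * MvPolynomial.X 2, fun k => (h' k).trans ?_⟩
      simp
      ring
    · refine ⟨U * MvPolynomial.X 2 + W * MvPolynomial.X 3, -U, fun k => (h' k).trans ?_⟩
      simp
      ring

/-- A leaf determines `p, q` only up to order. The product of `e` with its transform under the
exchange is symmetric, hence a polynomial in the Casimir values. -/
theorem exists_norm {e : (Fin 4 → ℂ) → ℂ} (he : IsPoly e) {k₀ : Fin 4 → ℂ} (h0 : e k₀ ≠ 0) :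
    ∃ E : MvPolynomial (Fin 4) ℂ, E ≠ 0 ∧ ∀ k : Fin 4 → ℂ,
      MvPolynomial.eval ![k 0, k 1, k 2 + k 3, k 2 * k 3] E ≠ 0 → e k ≠ 0 := by
  obtain ⟨P, hP⟩ := he
  obtain ⟨U, W, h⟩ := exists_reduced P
  -- This is the norm `(U + W p)(U + W q)`, expanded by means of `p + q` and `p q`.
  have key : ∀ k : Fin 4 → ℂ, MvPolynomial.eval ![k 0, k 1, k 2 + k 3, k 2 * k 3]
      (U ^ 2 + U * W * MvPolynomial.X 2 + W ^ 2 * MvPolynomial.X 3)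
      = e k * e (k ∘ Equiv.swap 2 3) := by
    intro k
    have h1 := h (k ∘ Equiv.swap 2 3)
    have h2 : ![(k ∘ Equiv.swap 2 3) 0, (k ∘ Equiv.swap 2 3) 1,
        (k ∘ Equiv.swap 2 3) 2 + (k ∘ Equiv.swap 2 3) 3,
        (k ∘ Equiv.swap 2 3) 2 * (k ∘ Equiv.swap 2 3) 3]
        = ![k 0, k 1, k 2 + k 3, k 2 * k 3] := by
      have e0 : Equiv.swap (2 : Fin 4) 3 0 = 0 := by decide
      have e1 : Equiv.swap (2 : Fin 4) 3 1 = 1 := by decide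
      simp [e0, e1, add_comm, mul_comm]
    rw [h2] at h1
    rw [hP, hP, h, h1]
    simp
    ring
  refine ⟨_, ?_, fun k hk => left_ne_zero_of_mul ((key k) ▸ hk)⟩
  intro hE
  rw [hE] at key
  -- A zero norm would make the product of `P` and its renaming vanish, first as a function and then
  -- as a polynomial; the polynomial ring is a domain.
  have hmul : P * MvPolynomial.rename (Equiv.swap (2 : Fin 4) 3) P = 0 := by
    refine MvPolynomial.funext fun k => ?_
    rw [map_mul, MvPolynomial.eval_rename, ← hP, ← hP, ← key k]
    simp
  have hP0 : P ≠ 0 := by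
    rintro rfl
    exact h0 (by simp [hP])
  rcases mul_eq_zero.1 hmul with h | h
  · exact hP0 h
  · exact hP0 (MvPolynomial.rename_injective _ (Equiv.injective _) (h.trans (map_zero _).symm))

/-- The quadratic part of `K₀` in the coordinates `a`. -/
def quadA (a c : Fin 4 → ℂ) : ℂ :=
  c 0 * a 3 * a 2 + c 1 * a 0 * a 3 + c 2 * a 1 * a 0 + c 3 * a 2 * a 1

/-- A parametrization of a component of the leaf, where `c₁ c₃ = p` and `c₂ c₄ = q` for
`k = (H₀, K₀, p, q)`. -/
def leafPoint (k : Fin 4 → ℂ) (a : Fin 4 → ℂ) (β₀ β₁ γ₀ γ₁ : ℂ) : Phase :=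
  vec ![β₀, β₁,
      (k 1 - k 2 * k 0 + quadA a ![Complex.exp γ₀, Complex.exp γ₁, k 2 * Complex.exp (-γ₀),
        k 3 * Complex.exp (-γ₁)]) / (k 3 - k 2) - β₀,
      k 0 - (k 1 - k 2 * k 0 + quadA a ![Complex.exp γ₀, Complex.exp γ₁, k 2 * Complex.exp (-γ₀),
        k 3 * Complex.exp (-γ₁)]) / (k 3 - k 2) - β₁]
    a ![Complex.exp γ₀, Complex.exp γ₁, k 2 * Complex.exp (-γ₀), k 3 * Complex.exp (-γ₁)]

/-- With `s = b₁ + b₃`, the value of `K₀` is `q s + p (H₀ - s) - quadA`, which is solvable for `s`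
when `p ≠ q`. The exponentials parametrize the nonzero `c₁`, `c₂` by entire functions. -/
theorem casimirs_leafPoint {k : Fin 4 → ℂ} (hk : k 3 - k 2 ≠ 0) (a : Fin 4 → ℂ)
    (β₀ β₁ γ₀ γ₁ : ℂ) :
    casimirs (leafPoint k a β₀ β₁ γ₀ γ₁) = ![k 0, k 1, k 2 + k 3, k 2 * k 3] := by
  have e0 : Complex.exp γ₀ * Complex.exp (-γ₀) = 1 := by rw [← Complex.exp_add]; simp
  have e1 : Complex.exp γ₁ * Complex.exp (-γ₁) = 1 := by rw [← Complex.exp_add]; simp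
  rw [leafPoint]
  set x := Complex.exp γ₀
  set x' := Complex.exp (-γ₀)
  set y := Complex.exp γ₁
  set y' := Complex.exp (-γ₁)
  set s := (k 1 - k 2 * k 0 + quadA a ![x, y, k 2 * x', k 3 * y']) / (k 3 - k 2) with hs
  have hs' : (k 3 - k 2) * s = k 1 - k 2 * k 0 + quadA a ![x, y, k 2 * x', k 3 * y'] := by
    rw [hs]; field_simp
  clear_value s
  ext i
  fin_cases i
  · simp [casimirs, H0, Fin.sum_univ_four]
    ring
  · simp only [quadA, cons_val] at hs'
    simp only [casimirs, K0, Fin.sum_univ_four, Fin.mk_one, Fin.isValue, Fin.reduceAdd, zero_add,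
      cons_val, bc_vec, ac_vec, cc_vec]
    linear_combination hs' + (k 0 - s) * k 2 * e0 + s * k 3 * e1
  · simp only [casimirs, J1, Fin.reduceFinMk, cons_val, cc_vec]
    linear_combination k 2 * e0 + k 3 * e1
  · simp only [casimirs, J2, Fin.reduceFinMk, cons_val, cc_vec]
    linear_combination k 2 * k 3 * y * y' * e0 + k 2 * k 3 * e1

/-- The value of `a₄` makes the numerator of `b₁ + b₃` vanish. -/
theorem leafPoint_eq_basePoint (k : Fin 4 → ℂ) :
    leafPoint k ![1, 0, 0, k 0 * k 2 - k 1] 0 0 0 0 = basePoint k := by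
  have h : k 1 - k 2 * k 0 + (k 0 * k 2 - k 1) = 0 := by ring
  simp [leafPoint, basePoint, quadA, h]

theorem exists_eq_leafPoint {m : Phase} (h0 : cc m 0 ≠ 0) (h1 : cc m 1 ≠ 0) {k : Fin 4 → ℂ}
    (hk : k 3 - k 2 ≠ 0) (hk0 : H0 m = k 0) (hk1 : K0 m = k 1) (hk2 : cc m 0 * cc m 2 = k 2)
    (hk3 : cc m 1 * cc m 3 = k 3) :
    ∃ γ₀ γ₁ : ℂ, m = leafPoint k (ac m) (bc m 0) (bc m 1) γ₀ γ₁ := by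
  refine ⟨Complex.log (cc m 0), Complex.log (cc m 1), ?_⟩
  have e2 : k 2 * (cc m 0)⁻¹ = cc m 2 := by rw [← hk2]; field_simp
  have e3 : k 3 * (cc m 1)⁻¹ = cc m 3 := by rw [← hk3]; field_simp
  rw [leafPoint, Complex.exp_neg, Complex.exp_neg, Complex.exp_log h0, Complex.exp_log h1, e2, e3]
  have hs : (k 1 - k 2 * k 0 + quadA (ac m) ![cc m 0, cc m 1, cc m 2, cc m 3]) / (k 3 - k 2)
      = bc m 0 + bc m 2 := by
    rw [div_eq_iff hk, ← hk0, ← hk1, ← hk2, ← hk3]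
    simp only [quadA, K0, H0, Fin.sum_univ_four, Fin.isValue, Fin.reduceAdd, zero_add, cons_val]
    ring
  rw [hs, ← hk0]
  refine phase_ext ?_ ?_ ?_ <;> intro i <;> fin_cases i <;> simp [H0, Fin.sum_univ_four]
  ring

theorem differentiable_leafPoint (k : Fin 4 → ℂ) {a : ℂ → Fin 4 → ℂ} {β₀ β₁ γ₀ γ₁ : ℂ → ℂ}
    (ha : ∀ i, Differentiable ℂ fun u => a u i) (hβ₀ : Differentiable ℂ β₀)
    (hβ₁ : Differentiable ℂ β₁) (hγ₀ : Differentiable ℂ γ₀) (hγ₁ : Differentiable ℂ γ₁) :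
    Differentiable ℂ fun u => leafPoint k (a u) (β₀ u) (β₁ u) (γ₀ u) (γ₁ u) := by
  refine differentiable_pi.2 fun t => ?_
  rcases t with t | t | t <;> fin_cases t <;>
    simp only [leafPoint, quadA, vec, Sum.elim_inl, Sum.elim_inr, Fin.zero_eta, Fin.mk_one,
      Fin.reduceFinMk, cons_val] <;>
    fun_prop

open Filter Topology in
theorem mem_closure_regular {k : Fin 4 → ℂ} (hk : k 3 - k 2 ≠ 0)
    (hb : regularizer (basePoint k) ≠ 0) (a : Fin 4 → ℂ) (β₀ β₁ γ₀ γ₁ : ℂ) :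
    leafPoint k a β₀ β₁ γ₀ γ₁ ∈
      closure (leaf ![k 0, k 1, k 2 + k 3, k 2 * k 3] ∩ regularSet) := by
  -- Straight-line interpolation of the parameters, from the given point at `u = 0` to the base
  -- point at `u = 1`, stays on the leaf for every complex `u`.
  let path : ℂ → Phase := fun u =>
    leafPoint k (fun i => (1 - u) * a i + u * (![1, 0, 0, k 0 * k 2 - k 1] : Fin 4 → ℂ) i)
      ((1 - u) * β₀) ((1 - u) * β₁) ((1 - u) * γ₀) ((1 - u) * γ₁)
  have hd : Differentiable ℂ path :=
    differentiable_leafPoint k (fun i => by fun_prop) (by fun_prop) (by fun_prop) (by fun_prop)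
      (by fun_prop)
  have p0 : path 0 = leafPoint k a β₀ β₁ γ₀ γ₁ := by simp [path]
  have p1 : path 1 = basePoint k := by
    rw [← leafPoint_eq_basePoint k]
    simp [path]
  have hf : Differentiable ℂ fun u => regularizer (path u) :=
    isPoly_regularizer.differentiable.comp hd
  have han : AnalyticOnNhd ℂ (fun u => regularizer (path u)) Set.univ := fun u _ => hf.analyticAt u
  have hev : ∀ᶠ u in 𝓝[≠] (0 : ℂ), regularizer (path u) ≠ 0 := by
    -- An entire function that vanishes near 0 vanishes everywhere, in particular at `u = 1`,
    -- contradicting `hb`.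
    refine ((han 0 trivial).eventually_eq_zero_or_eventually_ne_zero).resolve_left fun hz => ?_
    have := han.eqOn_zero_of_preconnected_of_eventuallyEq_zero isPreconnected_univ
      (Set.mem_univ 0) hz (Set.mem_univ 1)
    simp only [p1, Pi.zero_apply] at this
    exact hb this
  rw [← p0]
  refine mem_closure_of_tendsto (b := 𝓝[≠] (0 : ℂ)) (f := path)
    ((hd 0).continuousAt.tendsto.mono_left nhdsWithin_le_nhds) ?_
  filter_upwards [hev] with u hu
  exact ⟨casimirs_leafPoint hk _ _ _ _ _, mem_regularSet_of_regularizer hu⟩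

/-- Each factor of the exceptional polynomial has its own task: the norm makes `regularizer` nonzero
at the base point for either order of `p, q`; `κ₃ = J₂` forces all `c_i ≠ 0`; and `κ₂² - 4 κ₃ = (p -
q)²` separates `p` from `q`. -/
theorem exists_generic : ∃ E : MvPolynomial (Fin 4) ℂ, E ≠ 0 ∧ ∀ κ : Fin 4 → ℂ,
    MvPolynomial.eval κ E ≠ 0 →
      (leaf κ).Nonempty ∧ (∀ m ∈ leaf κ, IsSymplecticAt m) ∧
        leaf κ ⊆ closure (leaf κ ∩ regularSet) := by
  obtain ⟨E, hE, hE'⟩ := exists_norm (isPoly_regularizer.comp isPoly_basePoint)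
    regularizer_basePoint_ne_zero
  have hdisc : (MvPolynomial.X 2 ^ 2 - 4 * MvPolynomial.X 3 : MvPolynomial (Fin 4) ℂ) ≠ 0 := by
    intro h
    have := congrArg (MvPolynomial.eval ![0, 0, 1, 0]) h
    simp at this
  refine ⟨E * MvPolynomial.X 3 * (MvPolynomial.X 2 ^ 2 - 4 * MvPolynomial.X 3),
    mul_ne_zero (mul_ne_zero hE (MvPolynomial.X_ne_zero _)) hdisc, fun κ hκ => ?_⟩
  simp only [map_mul, mul_ne_zero_iff, MvPolynomial.eval_X, map_sub, map_pow, map_ofNat] at hκ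
  obtain ⟨⟨hκE, hκ3⟩, hκd⟩ := hκ
  have hκvec : ∀ p q, p + q = κ 2 → p * q = κ 3 → ![κ 0, κ 1, p + q, p * q] = κ := by
    intro p q h2 h3
    ext i
    fin_cases i
    exacts [rfl, rfl, h2, h3]
  refine ⟨?_, fun m hm => ?_, fun m hm => ?_⟩
  -- The two numbers `(κ 2 ± s) / 2` are the roots of `t² - κ₂ t + κ₃`.
  · obtain ⟨s, hs⟩ := IsAlgClosed.exists_eq_mul_self (κ 2 ^ 2 - 4 * κ 3)
    refine ⟨basePoint ![κ 0, κ 1, (κ 2 + s) / 2, (κ 2 - s) / 2], ?_⟩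
    exact (casimirs_basePoint _).trans (hκvec ((κ 2 + s) / 2) ((κ 2 - s) / 2)
      (by ring) (by linear_combination hs / 4))
  all_goals
    have k0 : H0 m = κ 0 := congrFun hm 0
    have k1 : K0 m = κ 1 := congrFun hm 1
    have k2 : cc m 0 * cc m 2 + cc m 1 * cc m 3 = κ 2 := congrFun hm 2
    have k3 : cc m 0 * cc m 1 * cc m 2 * cc m 3 = κ 3 := congrFun hm 3
    have hc := hκ3
    rw [← k3] at hc
    simp only [mul_ne_zero_iff] at hc
    obtain ⟨⟨⟨h0, h1⟩, h2⟩, h3⟩ := hc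
    have hpq : cc m 0 * cc m 2 - cc m 1 * cc m 3 ≠ 0 := by
      intro h
      refine hκd ?_
      rw [← k2, ← k3]
      linear_combination (cc m 0 * cc m 2 - cc m 1 * cc m 3) * h
  · exact isSymplecticAt_of_ne h0 h1 h2 h3 hpq
  · have hvec := hκvec (cc m 0 * cc m 2) (cc m 1 * cc m 3) k2 (by rw [← k3]; ring)
    let k : Fin 4 → ℂ := ![κ 0, κ 1, cc m 0 * cc m 2, cc m 1 * cc m 3]
    have hk : k 3 - k 2 ≠ 0 := by
      change cc m 1 * cc m 3 - cc m 0 * cc m 2 ≠ 0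
      rw [← neg_sub]
      exact neg_ne_zero.2 hpq
    have hkvec : ![k 0, k 1, k 2 + k 3, k 2 * k 3] = κ := hvec
    obtain ⟨γ₀, γ₁, hγ⟩ := exists_eq_leafPoint (k := k) h0 h1 hk k0 k1 rfl rfl
    have := mem_closure_regular hk (hE' k (by rw [hkvec]; exact hκE)) (ac m) (bc m 0) (bc m 1) γ₀ γ₁
    rw [hkvec, ← hγ] at this
    exact this

end TodaFourThree

end

theorem mainTheorem7 :
    -- the Toda Hamiltonian belongs to the family, and the spectral curve has the expansion `R`
    (∀ m, TodaFourThree.todaH m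
      = (1 / 2) * TodaFourThree.H0 m ^ 2 - TodaFourThree.H1 m) ∧
    (∀ (m : TodaFourThree.Phase) (x ν : ℂ), ν ≠ 0 →
      (x • (1 : Matrix (Fin 4) (Fin 4) ℂ) - TodaFourThree.lax m ν).det
        = TodaFourThree.spectralFun (TodaFourThree.casimirs m) (TodaFourThree.hams m) x (ν ^ 4)) ∧
    -- the generic level set is a symplectic leaf in which the regular points are dense
    (∃ E : MvPolynomial (Fin 4) ℂ, E ≠ 0 ∧ ∀ κ : Fin 4 → ℂ, MvPolynomial.eval κ E ≠ 0 →
      (TodaFourThree.leaf κ).Nonempty ∧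
      (∀ m ∈ TodaFourThree.leaf κ, TodaFourThree.IsSymplecticAt m) ∧
      TodaFourThree.leaf κ ⊆ closure (TodaFourThree.leaf κ ∩ TodaFourThree.regularSet)) ∧
    -- near each regular point, branches of `(λ, μ)` exist and form a chart of the leaf
    (∀ κ : Fin 4 → ℂ, ∀ m ∈ TodaFourThree.leaf κ ∩ TodaFourThree.regularSet,
      ∃ (V : Set TodaFourThree.Phase) (lam mu : Fin 4 → TodaFourThree.Phase → ℂ),
        m ∈ V ∧ V ⊆ TodaFourThree.regularSet ∧ TodaFourThree.IsBranch V lam mu ∧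
        Set.InjOn (fun p => ((fun i => lam i p, fun i => mu i p) : (Fin 4 → ℂ) × (Fin 4 → ℂ)))
          (V ∩ TodaFourThree.leaf κ) ∧
        IsOpen ((fun p => ((fun i => lam i p, fun i => mu i p) : (Fin 4 → ℂ) × (Fin 4 → ℂ))) ''
          (V ∩ TodaFourThree.leaf κ))) ∧
    -- any branches are DN coordinates, and the spectral curve gives the separation relations
    (∀ (V : Set TodaFourThree.Phase) (lam mu : Fin 4 → TodaFourThree.Phase → ℂ),
      TodaFourThree.IsBranch V lam mu → ∀ κ : Fin 4 → ℂ,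
        (∀ m ∈ V ∩ TodaFourThree.leaf κ ∩ TodaFourThree.regularSet,
          TodaFourThree.IsSymplecticAt m ∧
          TodaFourThree.IsIntegrableAt m ∧
          TodaFourThree.IsDarbouxNijenhuisAt lam mu m ∧
          ∀ (i : Fin 4) (ν : ℂ), ν ^ 4 = Complex.exp (mu i m) →
            (lam i m • (1 : Matrix (Fin 4) (Fin 4) ℂ) - TodaFourThree.lax m ν).det = 0) ∧
        TodaFourThree.IsSeparatedBy (V ∩ TodaFourThree.leaf κ ∩ TodaFourThree.regularSet)
          lam mu TodaFourThree.hams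
          (fun _ x y h => TodaFourThree.spectralFun κ h x (Complex.exp y))) := by
  refine ⟨TodaFourThree.todaH_eq, TodaFourThree.det_lax, TodaFourThree.exists_generic, ?_, ?_⟩
  · rintro κ m ⟨-, hm⟩
    obtain ⟨V, lam, mu, hV, hVr, hB, hκ⟩ := TodaFourThree.exists_chart hm
    exact ⟨V, lam, mu, hV, hVr, hB, hκ κ⟩
  · intro V lam mu hB κ
    refine ⟨?_, hB.isSeparatedBy κ⟩
    rintro m ⟨⟨hm, -⟩, hr⟩
    exact ⟨hB.isSymplecticAt hm hr, TodaFourThree.isIntegrableAt hr, hB.isDarbouxNijenhuisAt hm hr,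
      fun i ν hν => hB.det_lax_eq_zero hm i hν⟩
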